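/- **Setting.** Let $0<c\le C<\infty$ be fixed. For each sample size $n$ let $p=p_n$, with $p_n\to\infty$ as $n\to\infty$, and let $\mathbf y_t=A\mathbf y_{t-1}+\mathbf e_t$ ($t\ge 1$) be a stationary $p$-dimensional Gaussian VAR(1) process, where $A=A_n\in\mathbb R^{p\times p}$, the $\mathbf e_t$ are i.i.d. $N(0,\Sigma_{\mathbf e})$ with $\Sigma_{\mathbf e}=\Sigma_{\mathbf e,n}$ positive definite, and $\mathbf y_0$ is independent of $(\mathbf e_t)_{t\ge1}$. Assume that the process is stable (all eigenvalues of $A$ have modulus $<1$), with stability measures bounded uniformly in $n$: the eigenvalues of $\Sigma_{\mathbf e}$, and those of $(I-zA)^{*}(I-zA)$ for every $z\in\mathbb C$ with $|z|=1$, lie in $[c,C]$. Let $i=i_n\in\{1,\dots,p\}$, let $a_i$ be the $i$th row of $A$ (as a column vector) and $s_i=|\{j:a_{ij}\neq0\}|$. Put $Y_i=(y_{i1},\dots,y_{in})^{\mathsf T}$ and $\mathbf X=(\mathbf y_0,\dots,\mathbf y_{n-1})^{\mathsf T}$, let $$\hat a_i^{\rm Lasso}\in\operatorname*{argmin}_{\alpha\in\mathbb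 R^p}\{\|Y_i-\mathbf X\alpha\|_2^2/n+2\lambda\|\alpha\|_1\},$$ and let $\hat\varepsilon_i=Y_i-\mathbf X\hat a_i^{\rm Lasso}$, with centered residuals $r_t=\hat\varepsilon_{it}-\frac1n\sum_{u=1}^n\hat\varepsilon_{iu}$. The bootstrap errors $\varepsilon_i^*=(\varepsilon^*_{i1},\dots,\varepsilon^*_{in})^{\mathsf T}$ are generated in one of two ways: * residual bootstrap: $\varepsilon^*_{it}=r_{U_t}$, with $U_1,\dots,U_n$ i.i.d. uniform on $\{1,\dots,n\}$ and independent of the data $(\mathbf y_0,\dots,\mathbf y_n)$; * multiplier wild bootstrap: $\varepsilon^*_{it}=W_tr_t$, with $W_1,\dots,W_n$ i.i.d. from a fixed law (not depending on $n$) with $EW_t=0$, $EW_t^2=1$, $EW_t^4<\infty$, and independent of the data. Put $Y_i^*=\mathbf X\hat a_i^{\rm Lasso}+\varepsilon_i^*$, let $$\hat a_i^{\rm Lasso*}\in\operatorname*{argmin}_{\alpha\in\mathbb R^p}\{\|Y_i^*-\mathbf X\alpha\|_2^2/n+2\lambda^*\|\alpha\|_1\},$$ and let $\hat s_i^*=|\{j:\hat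 a^{\rm Lasso*}_{ij}\neq0\}|$. **Conventions.** $Z_n=O_p(r_n)$ means: for every $\eta>0$ there is $M<\infty$ with $P(|Z_n|>Mr_n)\le\eta$ for all large $n$, where $P$ is the joint probability of the data and of the bootstrap randomness. $a_n\asymp b_n$ means $c_1b_n\le a_n\le c_2b_n$ for all large $n$, for some constants $c_1,c_2>0$. **Theorem.** There is a constant $K>0$, depending only on $c$ and $C$, such that the following holds for both bootstrap schemes. Assume that $\max(s_i,1)(\log p)^{3/2}/\sqrt n\to0$, that $\lambda\asymp\sqrt{\log p/n}$, and that $\lambda\ge K\sqrt{\log p/n}$ for all large $n$. (a) If $\lambda^*\asymp\log p/\sqrt n$, then $$\|\hat a_i^{\rm Lasso*}-\hat a_i^{\rm Lasso}\|_1=O_p\big(s_i\log p/\sqrt n\big),\qquad \|\mathbf X(\hat a_i^{\rm Lasso*}-\hat a_i^{\rm Lasso})\|_2^2/n=O_p\big(s_i\log^2p/n\big).$$ (b) If $\lambda^*\ge K\sqrt{\log p/n}$ for all large $n$, then $\hat s_i^*=O_p(s_i)$. -/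

import Mathlib

open MeasureTheory ProbabilityTheory Filter Topology

namespace VARBootstrap

noncomputable section

/-- `a n ≍ b n`: `a n` lies eventually between two positive constant multiples of `b n`. -/
def AsympEq (a b : ℕ → ℝ) : Prop :=
  ∃ c₁ c₂ : ℝ, 0 < c₁ ∧ 0 < c₂ ∧ ∀ᶠ n in atTop, c₁ * b n ≤ a n ∧ a n ≤ c₂ * b n

/-- `Z n = O_p (r n)`, where `Z n` lives on the probability space `(Ω n, P n)`: for every `η > 0`
there is a constant `M` such that eventually `P n (|Z n| > M * r n) ≤ η`. -/
def IsBigOp {Ω : ℕ → Type*} [∀ n, MeasurableSpace (Ω n)] (P : ∀ n, Measure (Ω n))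
    (Z : ∀ n, Ω n → ℝ) (r : ℕ → ℝ) : Prop :=
  ∀ η : ℝ, 0 < η → ∃ M : ℝ, 0 < M ∧
    ∀ᶠ n in atTop, P n {ω | M * r n < |Z n ω|} ≤ ENNReal.ofReal η

/-- The number of nonzero entries of a vector. -/
def sparsity {p : ℕ} (a : Fin p → ℝ) : ℕ := (Finset.univ.filter fun j => a j ≠ 0).card

/-- The `ℓ¹` norm. -/
def norm1 {p : ℕ} (a : Fin p → ℝ) : ℝ := ∑ j, |a j|

/-- The squared `ℓ²` norm. -/
def sqNorm2 {n : ℕ} (v : Fin n → ℝ) : ℝ := ∑ t, v t ^ 2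

/-- The Lasso objective `‖Y - X α‖₂² / n + 2 lam ‖α‖₁`. -/
def lassoObjective {n p : ℕ} (X : Matrix (Fin n) (Fin p) ℝ) (Y : Fin n → ℝ) (lam : ℝ)
    (α : Fin p → ℝ) : ℝ :=
  sqNorm2 (Y - X.mulVec α) / n + 2 * lam * norm1 α

/-- `a` is a Lasso estimate: a global minimizer of the Lasso objective. -/
def IsLasso {n p : ℕ} (X : Matrix (Fin n) (Fin p) ℝ) (Y : Fin n → ℝ) (lam : ℝ)
    (a : Fin p → ℝ) : Prop :=
  ∀ α : Fin p → ℝ, lassoObjective X Y lam a ≤ lassoObjective X Y lam α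

/-- The vector `v` minus its average. -/
def center {n : ℕ} (v : Fin n → ℝ) : Fin n → ℝ := fun t => v t - (∑ u, v u) / n

/-- Stability of the VAR(1) model with transition matrix `A` and noise covariance `S`, with
stability measures controlled by `c` and `C`: all eigenvalues of `A` lie in the open unit disc, the
eigenvalues of `(I - z A)ᴴ (I - z A)` for `|z| = 1` and those of `S` lie in `[c, C]`. -/
structure StableVAR {p : ℕ} (c C : ℝ) (A S : Matrix (Fin p) (Fin p) ℝ) : Prop where
  stable : ∀ z ∈ spectrum ℂ (A.map (fun x : ℝ => (x : ℂ))), ‖z‖ < 1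
  transfer_bounds : ∀ z : ℂ, ‖z‖ = 1 → ∀ v : Fin p → ℂ,
    c * ∑ j, ‖v j‖ ^ 2 ≤
        ∑ j, ‖((1 - z • A.map (fun x : ℝ => (x : ℂ))).mulVec v) j‖ ^ 2 ∧
      ∑ j, ‖((1 - z • A.map (fun x : ℝ => (x : ℂ))).mulVec v) j‖ ^ 2 ≤
        C * ∑ j, ‖v j‖ ^ 2
  noise_posDef : S.PosDef
  noise_bounds : ∀ v : Fin p → ℝ,
    c * ∑ j, v j ^ 2 ≤ dotProduct v (S.mulVec v) ∧
      dotProduct v (S.mulVec v) ≤ C * ∑ j, v j ^ 2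

/-- `y 0, y 1, …` is a stationary Gaussian VAR(1) process `y (t+1) = A (y t) + e (t+1)`, where the
noises `e 1, e 2, …` are i.i.d. `N(0, S)` and independent of `y 0`. (The value `e 0` is unused.)
As `(y t)` is a Markov chain, equality of all its marginal laws is strict stationarity. -/
structure IsStationaryVAR {p : ℕ} {Ω : Type*} [MeasurableSpace Ω] (P : Measure Ω)
    (A S : Matrix (Fin p) (Fin p) ℝ) (y e : ℕ → Ω → EuclideanSpace ℝ (Fin p)) : Prop where
  noise_law : ∀ t, HasLaw (e (t + 1)) (multivariateGaussian 0 S) P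
  noise_indep : iIndepFun (fun t => e (t + 1)) P
  init_indep : IndepFun (y 0) (fun ω (t : ℕ) => e (t + 1) ω) P
  stationary : ∀ t, IdentDistrib (y t) (y 0) P P
  recursion : ∀ t ω j, y (t + 1) ω j = A.mulVec (fun k => y t ω k) j + e (t + 1) ω j

/-- The design matrix with rows `y 0, …, y (n-1)`. -/
def design {p : ℕ} {Ω : Type*} (y : ℕ → Ω → EuclideanSpace ℝ (Fin p)) (n : ℕ) (ω : Ω) :
    Matrix (Fin n) (Fin p) ℝ :=
  Matrix.of fun t j => y t ω j

/-- The response `(y_{i,1}, …, y_{i,n})` of the `i`-th equation. -/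
def response {p : ℕ} {Ω : Type*} (y : ℕ → Ω → EuclideanSpace ℝ (Fin p)) (i : Fin p) (n : ℕ)
    (ω : Ω) : Fin n → ℝ :=
  fun t => y (t + 1) ω i

/-- The observations `(y 0, …, y n)`, as one random variable. -/
def observations {p : ℕ} {Ω : Type*} (y : ℕ → Ω → EuclideanSpace ℝ (Fin p)) (n : ℕ) (ω : Ω) :
    Fin (n + 1) → EuclideanSpace ℝ (Fin p) :=
  fun t => y t ω

/-- `εs` is obtained by drawing `n` times, independently and uniformly with replacement, from the
entries of the data-dependent vector `r`, where the draws are independent of the data. -/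
def IsResidualBootstrap {n : ℕ} {Ω D : Type*} [MeasurableSpace Ω] [MeasurableSpace D]
    (P : Measure Ω) (data : Ω → D) (r εs : Ω → Fin n → ℝ) : Prop :=
  ∃ U : Fin n → Ω → Fin n,
    (∀ t, HasLaw (U t) (uniformOn Set.univ) P) ∧ iIndepFun U P ∧
      IndepFun data (fun ω t => U t ω) P ∧ ∀ ω t, εs ω t = r ω (U t ω)

/-- Admissible law of a bootstrap multiplier: mean `0`, variance `1`, finite fourth moment. -/
structure IsMultiplierLaw (ν : Measure ℝ) : Prop where
  prob : IsProbabilityMeasure ν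
  fourth_moment : Integrable (fun w => w ^ 4) ν
  mean : ∫ w, w ∂ν = 0
  variance : ∫ w, w ^ 2 ∂ν = 1

/-- `εs` is obtained by multiplying the entries of the data-dependent vector `r` by i.i.d.
multipliers of law `ν`, independent of the data. -/
def IsWildBootstrap {n : ℕ} {Ω D : Type*} [MeasurableSpace Ω] [MeasurableSpace D]
    (P : Measure Ω) (ν : Measure ℝ) (data : Ω → D) (r εs : Ω → Fin n → ℝ) : Prop :=
  ∃ W : Fin n → Ω → ℝ,
    (∀ t, HasLaw (W t) ν P) ∧ iIndepFun W P ∧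
      IndepFun data (fun ω t => W t ω) P ∧ ∀ ω t, εs ω t = W t ω * r ω t

end

end VARBootstrap

/-! One deterministic fact about the Lasso is used twice. Suppose that the scores `Xᵀε` are at most
`nλ/2` in absolute value and that the Gram form is comparable with `‖v‖₂²` up to a small multiple of
`‖v‖₁²`. Then the ℓ¹ error is of order `sλ`, the prediction error of order `sλ²`, and the number of
selected variables of order `s` (`IsLasso.bounds`). The last claim holds because every active
coordinate has score at least `nλ`: the noise explains at most half of it, so the prediction error
must pay for the rest. The fact applies to the data with the row `a_i`, and then to the bootstrap
sample, which has the same design and whose true vector is the first Lasso estimate, already known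
to have sparsity of order `s_i` (`bootstrap_lasso_bounds`).

The bootstrap scores come from resampled residuals. With `d` the error of the first Lasso, the
residual vector is `ε - X d`, and centering and resampling are linear. The score therefore splits
into the resampled score of the true errors, of order `√(n log p)`, and a combination with weights
`d k` of resampled scores of the regressors, each at most `√n log p`
(`GoodResample.residual_score`). Since `‖d‖₁` is of order `s √(log p / n)`, the second part is
negligible as soon as `s log p / √n` is small. No uniformity over random sparse vectors is needed.

Two probabilistic inputs remain. Stability on the unit circle, combined with a discrete Parseval
identity, shows that every linear functional of the process and the noise is centered Gaussian with
variance at most a constant times the squared coefficients (`IsStationaryVAR.hasLaw_sum`). The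
Maurey–Pisier inequality then controls scores, Gram entries and sums of fourth powers
(`IsStationaryVAR.goodSample`). Conditionally on the data the bootstrap errors are independent with
four moments, and truncation with a Bernstein argument controls the maximal score (`max_sum_tail`,
`ResamplingScheme.goodResample`). Both schemes are instances of `ResamplingScheme`; the multiplier
law enters only through its fourth moment, and only in the failure probability, so `K` depends on
`c` and `C` alone. -/

namespace VARBootstrap

noncomputable section

/-! ### Deterministic bounds for the Lasso. -/

section Lasso

variable {n p : ℕ}

lemma norm1_nonneg (a : Fin p → ℝ) : 0 ≤ norm1 a := Finset.sum_nonneg fun _ _ => abs_nonneg _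

lemma sqNorm2_nonneg (a : Fin n → ℝ) : 0 ≤ sqNorm2 a := Finset.sum_nonneg fun _ _ => sq_nonneg _

lemma sqNorm2_sub (u v : Fin n → ℝ) :
    sqNorm2 (u - v) = sqNorm2 u - 2 * ∑ t, u t * v t + sqNorm2 v := by
  simp only [sqNorm2, Pi.sub_apply, Finset.mul_sum, ← Finset.sum_sub_distrib,
    ← Finset.sum_add_distrib]
  exact Finset.sum_congr rfl fun t _ => by ring

lemma sum_mul_mulVec (X : Matrix (Fin n) (Fin p) ℝ) (u : Fin n → ℝ) (v : Fin p → ℝ) :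
    ∑ t, u t * (X.mulVec v) t = ∑ j, v j * ∑ t, X t j * u t := by
  simp only [Matrix.mulVec, dotProduct, Finset.mul_sum]
  rw [Finset.sum_comm]
  exact Finset.sum_congr rfl fun t _ => Finset.sum_congr rfl fun j _ => by ring

lemma sum_mul_le_norm1 (v w : Fin p → ℝ) {B : ℝ} (hw : ∀ j, |w j| ≤ B) :
    |∑ j, v j * w j| ≤ norm1 v * B := by
  refine (Finset.abs_sum_le_sum_abs _ _).trans ?_
  rw [norm1, Finset.sum_mul]
  exact Finset.sum_le_sum fun j _ => by
    rw [abs_mul]; exact mul_le_mul_of_nonneg_left (hw j) (abs_nonneg _)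

/-- The basic inequality for a Lasso estimate. -/
lemma IsLasso.basic_inequality {X : Matrix (Fin n) (Fin p) ℝ} {a b : Fin p → ℝ} {ε : Fin n → ℝ}
    {lam : ℝ} (hn : 0 < n) (h : IsLasso X (X.mulVec a + ε) lam b) (hlam : 0 ≤ lam)
    (hε : ∀ j, |∑ t, X t j * ε t| ≤ n * (lam / 2)) :
    sqNorm2 (X.mulVec (b - a)) / n + lam * norm1 (b - a) ≤
      4 * lam * ∑ j with a j ≠ 0, |(b - a) j| := by
  have hn' : (0 : ℝ) < n := by exact_mod_cast hn
  have h1 := h a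
  simp only [lassoObjective, add_sub_cancel_left] at h1
  have h2 : X.mulVec a + ε - X.mulVec b = ε - X.mulVec (b - a) := by
    rw [Matrix.mulVec_sub]; abel
  rw [h2, sqNorm2_sub, sum_mul_mulVec] at h1
  have h3 := (le_abs_self _).trans (sum_mul_le_norm1 (b - a) _ hε)
  have h4 : sqNorm2 (X.mulVec (b - a)) / n ≤
      lam * norm1 (b - a) + 2 * lam * (norm1 a - norm1 b) := by
    have h5 : (sqNorm2 ε - 2 * ∑ j, (b - a) j * ∑ t, X t j * ε t +
        sqNorm2 (X.mulVec (b - a))) / n = sqNorm2 ε / n -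
        2 * (∑ j, (b - a) j * ∑ t, X t j * ε t) / n + sqNorm2 (X.mulVec (b - a)) / n := by ring
    have h6 : 2 * (∑ j, (b - a) j * ∑ t, X t j * ε t) / n ≤ lam * norm1 (b - a) := by
      rw [div_le_iff₀ hn']; linarith
    linarith
  -- Coordinatewise: off the support of `a` the two terms cancel, and on it the reverse triangle
  -- inequality doubles `|b j - a j|`.
  have h7 : 2 * norm1 (b - a) + 2 * (norm1 a - norm1 b) ≤
      4 * ∑ j with a j ≠ 0, |(b - a) j| := by
    simp only [norm1, Finset.sum_filter, Finset.mul_sum, ← Finset.sum_sub_distrib,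
      ← Finset.sum_add_distrib]
    refine Finset.sum_le_sum fun j _ => ?_
    by_cases hj : a j = 0
    · simp [hj]
    · have := abs_sub_abs_le_abs_sub (a j) (b j)
      rw [abs_sub_comm] at this
      simp only [ne_eq, hj, not_false_eq_true, if_true, Pi.sub_apply]
      linarith
  nlinarith [mul_le_mul_of_nonneg_left h7 hlam]

lemma sum_filter_abs_sq_le (a v : Fin p → ℝ) :
    (∑ j with a j ≠ 0, |v j|) ^ 2 ≤ sparsity a * sqNorm2 v := by
  have h1 := sq_sum_le_card_mul_sum_sq (s := Finset.univ.filter fun j => a j ≠ 0)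
    (f := fun j => |v j|)
  refine h1.trans ?_
  rw [sparsity]
  refine mul_le_mul_of_nonneg_left ?_ (Nat.cast_nonneg _)
  simp only [sq_abs]
  exact Finset.sum_le_sum_of_subset_of_nonneg (Finset.filter_subset _ _)
    fun _ _ _ => sq_nonneg _

lemma norm1_sq_le_sparsity (v : Fin p → ℝ) : norm1 v ^ 2 ≤ sparsity v * sqNorm2 v := by
  have h := sum_filter_abs_sq_le v v
  have : ∑ j with v j ≠ 0, |v j| = norm1 v := by
    rw [norm1, Finset.sum_filter]
    exact Finset.sum_congr rfl fun j _ => by by_cases hj : v j = 0 <;> simp [hj]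
  rwa [this] at h

/-- Oracle bounds for the Lasso under a restricted eigenvalue condition. -/
lemma IsLasso.oracle_bounds {X : Matrix (Fin n) (Fin p) ℝ} {a b : Fin p → ℝ} {ε : Fin n → ℝ}
    {lam s κ : ℝ} (hn : 0 < n) (h : IsLasso X (X.mulVec a + ε) lam b) (hlam : 0 < lam)
    (hε : ∀ j, |∑ t, X t j * ε t| ≤ n * (lam / 2)) (hs : (sparsity a : ℝ) ≤ s) (hκ : 0 < κ)
    (hRE : ∀ v : Fin p → ℝ, norm1 v ^ 2 ≤ 16 * s * sqNorm2 v →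
      κ * sqNorm2 v ≤ sqNorm2 (X.mulVec v) / n) :
    norm1 (b - a) ≤ 16 * lam * s / κ ∧ sqNorm2 (X.mulVec (b - a)) / n ≤ 16 * lam ^ 2 * s / κ := by
  have hb := h.basic_inequality hn hlam.le hε
  set D := ∑ j with a j ≠ 0, |(b - a) j|
  set Q := sqNorm2 (X.mulVec (b - a)) / n
  set N := sqNorm2 (b - a)
  have hN : 0 ≤ N := sqNorm2_nonneg _
  have hQ : 0 ≤ Q := div_nonneg (sqNorm2_nonneg _) (Nat.cast_nonneg _)
  have hD : 0 ≤ D := Finset.sum_nonneg fun _ _ => abs_nonneg _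
  have hs0 : 0 ≤ s := (Nat.cast_nonneg _).trans hs
  have hDN : D ^ 2 ≤ s * N :=
    (sum_filter_abs_sq_le a (b - a)).trans (mul_le_mul_of_nonneg_right hs hN)
  have h1 : norm1 (b - a) ≤ 4 * D := by
    have : lam * norm1 (b - a) ≤ lam * (4 * D) := by linarith
    exact le_of_mul_le_mul_left this hlam
  have h1' : norm1 (b - a) ^ 2 ≤ 16 * s * N := by
    have := pow_le_pow_left₀ (norm1_nonneg (b - a)) h1 2
    nlinarith
  have h2 : κ * N ≤ Q := hRE _ h1'
  have h3 : Q ≤ 4 * lam * D := by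
    have := mul_nonneg hlam.le (norm1_nonneg (b - a)); linarith
  have h4 : Q ≤ 16 * lam ^ 2 * s / κ := by
    rw [le_div_iff₀ hκ]
    -- Self-bounding argument: `Q² ≤ 16 λ² s N ≤ 16 λ² s Q / κ`, and one factor `Q` cancels unless
    -- it vanishes.
    rcases hQ.eq_or_lt with h0 | h0
    · rw [← h0]; simp; positivity
    · have h5 : Q ^ 2 ≤ 16 * lam ^ 2 * (s * N) := by
        calc Q ^ 2 ≤ (4 * lam * D) ^ 2 := pow_le_pow_left₀ hQ h3 2
          _ = 16 * lam ^ 2 * D ^ 2 := by ring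
          _ ≤ _ := by gcongr
      have h6 : Q * (Q * κ) ≤ Q * (16 * lam ^ 2 * s) := by
        calc Q * (Q * κ) = κ * Q ^ 2 := by ring
          _ ≤ κ * (16 * lam ^ 2 * (s * N)) := by gcongr
          _ = 16 * lam ^ 2 * s * (κ * N) := by ring
          _ ≤ 16 * lam ^ 2 * s * Q := by gcongr
          _ = _ := by ring
      exact le_of_mul_le_mul_left h6 h0
  refine ⟨?_, h4⟩
  have h7 : norm1 (b - a) ^ 2 ≤ (16 * lam * s / κ) ^ 2 := by
    calc norm1 (b - a) ^ 2 ≤ 16 * s * N := h1'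
      _ ≤ 16 * s * (Q / κ) := by
        gcongr; rw [le_div_iff₀ hκ]; linarith
      _ ≤ 16 * s * (16 * lam ^ 2 * s / κ / κ) := by gcongr
      _ = _ := by field_simp
  exact abs_le_of_sq_le_sq' h7 (by positivity) |>.2

/-- On the support of a Lasso estimate the absolute score equals at least the penalty level. -/
lemma IsLasso.score_ge {X : Matrix (Fin n) (Fin p) ℝ} {Y : Fin n → ℝ} {b : Fin p → ℝ}
    {lam : ℝ} (hn : 0 < n) (h : IsLasso X Y lam b) {j : Fin p} (hj : b j ≠ 0) :
    n * lam ≤ |∑ t, X t j * (Y - X.mulVec b) t| := by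
  have hn' : (0 : ℝ) < n := by exact_mod_cast hn
  set c := ∑ t, X t j * (Y - X.mulVec b) t with hc
  set q := ∑ t, X t j ^ 2 with hq
  obtain ⟨σ, hσ, hσb⟩ : ∃ σ : ℝ, σ ^ 2 = 1 ∧ b j = σ * |b j| := by
    rcases lt_or_gt_of_ne hj with h0 | h0
    · exact ⟨-1, by norm_num, by rw [abs_of_neg h0]; ring⟩
    · exact ⟨1, by norm_num, by rw [abs_of_pos h0]; ring⟩
  have hσ1 : |σ| = 1 := by
    have : |σ| ^ 2 = 1 ^ 2 := by rw [sq_abs, hσ]; norm_num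
    exact (pow_left_inj₀ (abs_nonneg _) zero_le_one two_ne_zero).1 this
  -- Moving `b j` towards zero by `u` saves `2 λ u` in the penalty and changes the quadratic part by
  -- `(2 u σ c + u² q) / n`. Minimality compares the two; letting `u` tend to zero removes `q`.
  have key : ∀ u : ℝ, 0 < u → u ≤ |b j| → n * lam ≤ |c| + u * q / 2 := by
    intro u hu hub
    have h1 := h (b - Pi.single j (u * σ))
    simp only [lassoObjective] at h1
    have h2 : Y - X.mulVec (b - Pi.single j (u * σ)) =
        (Y - X.mulVec b) - (fun t => -(u * σ) * X t j) := by
      rw [Matrix.mulVec_sub]; ext t; simp [Matrix.mulVec_single]; ring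
    have h3 : sqNorm2 ((Y - X.mulVec b) - (fun t => -(u * σ) * X t j)) =
        sqNorm2 (Y - X.mulVec b) + 2 * (u * σ) * c + u ^ 2 * q := by
      rw [sqNorm2_sub, hc, hq, sqNorm2, sqNorm2]
      have e1 : ∑ t, (Y - X.mulVec b) t * (-(u * σ) * X t j) =
          -(u * σ) * ∑ t, X t j * (Y - X.mulVec b) t := by
        rw [Finset.mul_sum]; exact Finset.sum_congr rfl fun t _ => by ring
      have e2 : ∑ t, (-(u * σ) * X t j) ^ 2 = u ^ 2 * ∑ t, X t j ^ 2 := by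
        rw [Finset.mul_sum]
        exact Finset.sum_congr rfl fun t _ => by
          calc (-(u * σ) * X t j) ^ 2 = u ^ 2 * σ ^ 2 * X t j ^ 2 := by ring
            _ = _ := by rw [hσ]; ring
      rw [e1, e2]; ring
    have h4 : norm1 (b - Pi.single j (u * σ)) = norm1 b - u := by
      rw [norm1, norm1, ← Finset.add_sum_erase _ _ (Finset.mem_univ j),
        ← Finset.add_sum_erase _ (fun j => |b j|) (Finset.mem_univ j)]
      have e1 : ∑ x ∈ Finset.univ.erase j, |(b - Pi.single j (u * σ) : Fin p → ℝ) x| =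
          ∑ x ∈ Finset.univ.erase j, |b x| :=
        Finset.sum_congr rfl fun x hx => by simp [(Finset.mem_erase.1 hx).1]
      have e2 : |(b - Pi.single j (u * σ) : Fin p → ℝ) j| = |b j| - u := by
        simp only [Pi.sub_apply, Pi.single_eq_same]
        have : b j - u * σ = σ * (|b j| - u) := by linear_combination hσb
        rw [this, abs_mul, hσ1, one_mul, abs_of_nonneg (by linarith)]
      rw [e1, e2]; ring
    rw [h2, h3, h4] at h1
    have h5 : (sqNorm2 (Y - X.mulVec b) + 2 * (u * σ) * c + u ^ 2 * q) / n =
        sqNorm2 (Y - X.mulVec b) / n + (2 * (u * σ) * c + u ^ 2 * q) / n := by ring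
    have h6 : 2 * lam * u ≤ (2 * (u * σ) * c + u ^ 2 * q) / n := by linarith
    rw [le_div_iff₀ hn'] at h6
    have h7 : σ * c ≤ |c| := by
      calc σ * c ≤ |σ * c| := le_abs_self _
        _ = |c| := by rw [abs_mul, hσ1, one_mul]
    have h8 : u * (n * lam) ≤ u * (σ * c + u * q / 2) := by nlinarith
    linarith [le_of_mul_le_mul_left h8 hu]
  have hq0 : 0 ≤ q := Finset.sum_nonneg fun _ _ => sq_nonneg _
  refine le_of_forall_pos_le_add fun δ hδ => ?_
  have hbj : 0 < |b j| := abs_pos.2 hj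
  refine (key (min |b j| (δ / (q + 1))) (by positivity) (min_le_left _ _)).trans ?_
  have : min |b j| (δ / (q + 1)) * q ≤ δ / (q + 1) * (q + 1) := by
    gcongr
    · exact min_le_right _ _
    · linarith
  rw [div_mul_cancel₀ _ (by positivity)] at this
  linarith

/-- The number of variables selected by the Lasso. -/
lemma IsLasso.sparsity_le {X : Matrix (Fin n) (Fin p) ℝ} {a b : Fin p → ℝ} {ε : Fin n → ℝ}
    {lam s κ φ : ℝ} (hn : 0 < n) (h : IsLasso X (X.mulVec a + ε) lam b) (hlam : 0 < lam)
    (hε : ∀ j, |∑ t, X t j * ε t| ≤ n * (lam / 2)) (hκ : 0 < κ) (hφ : 0 ≤ φ) (hs : 0 ≤ s)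
    (hQ : sqNorm2 (X.mulVec (b - a)) / n ≤ 16 * lam ^ 2 * s / κ)
    (hup : ∀ v : Fin p → ℝ, (sparsity v : ℝ) ≤ 64 * φ * s / κ + 1 →
      sqNorm2 (X.mulVec v) / n ≤ φ * sqNorm2 v) :
    (sparsity b : ℝ) ≤ 64 * φ * s / κ := by
  have hn' : (0 : ℝ) < n := by exact_mod_cast hn
  have key : ∀ J : Finset (Fin p), (∀ j ∈ J, b j ≠ 0) → (J.card : ℝ) ≤ 64 * φ * s / κ + 1 →
      (J.card : ℝ) ≤ 64 * φ * s / κ := by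
    intro J hJ hJc
    -- The part of `Xᵀ X (b - a)` carried by `J`. Each of its entries is at least `nλ/2`, being a
    -- Lasso score minus a noise score. Cauchy–Schwarz against the prediction error then limits how
    -- many there are.
    set w : Fin p → ℝ := fun j => if j ∈ J then ∑ t, X t j * (X.mulVec (b - a)) t else 0 with hw
    have hws : sparsity w ≤ J.card := by
      refine Finset.card_le_card fun j hj => ?_
      by_contra hcon
      simp [hw, hcon] at hj
    have hwJ : ∀ j ∈ J, (n * (lam / 2)) ^ 2 ≤ w j ^ 2 := by
      intro j hj
      have h1 := h.score_ge hn (hJ j hj)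
      have h2 : ∑ t, X t j * (X.mulVec a + ε - X.mulVec b) t =
          ∑ t, X t j * ε t - ∑ t, X t j * (X.mulVec (b - a)) t := by
        rw [← Finset.sum_sub_distrib, Matrix.mulVec_sub]
        exact Finset.sum_congr rfl fun t _ => by simp; ring
      rw [h2] at h1
      have h3 := abs_sub (∑ t, X t j * ε t) (∑ t, X t j * (X.mulVec (b - a)) t)
      have h4 : n * (lam / 2) ≤ |w j| := by
        simp only [hw, hj, if_true]
        linarith [hε j]
      rw [← sq_abs (w j)]
      exact pow_le_pow_left₀ (by positivity) h4 2
    have hW : sqNorm2 w = ∑ t, (X.mulVec (b - a)) t * (X.mulVec w) t := by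
      rw [sum_mul_mulVec, sqNorm2]
      refine Finset.sum_congr rfl fun j _ => ?_
      by_cases hj : j ∈ J <;> simp [hw, hj, sq]
    have hWJ : J.card * (n * (lam / 2)) ^ 2 ≤ sqNorm2 w := by
      rw [← nsmul_eq_mul]
      refine (Finset.card_nsmul_le_sum J _ _ hwJ).trans ?_
      exact Finset.sum_le_sum_of_subset_of_nonneg (Finset.subset_univ _) fun _ _ _ => sq_nonneg _
    have hCS : sqNorm2 w ^ 2 ≤ sqNorm2 (X.mulVec (b - a)) * sqNorm2 (X.mulVec w) := by
      rw [hW]; exact Finset.sum_mul_sq_le_sq_mul_sq _ _ _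
    have hup' := hup w (le_trans (by exact_mod_cast hws) hJc)
    rw [div_le_iff₀ hn'] at hup' hQ
    have hW0 := sqNorm2_nonneg w
    have hWle : sqNorm2 w ≤ 16 * lam ^ 2 * s / κ * n * (φ * n) := by
      rcases hW0.eq_or_lt with h0 | h0
      · rw [← h0]; positivity
      · have : sqNorm2 w * sqNorm2 w ≤ (16 * lam ^ 2 * s / κ * n * (φ * n)) * sqNorm2 w := by
          calc sqNorm2 w * sqNorm2 w = sqNorm2 w ^ 2 := by ring
            _ ≤ _ := hCS
            _ ≤ (16 * lam ^ 2 * s / κ * n) * (φ * sqNorm2 w * n) :=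
              mul_le_mul hQ hup' (sqNorm2_nonneg _) (by positivity)
            _ = _ := by ring
        exact le_of_mul_le_mul_right this h0
    have h9 : J.card * (n * (lam / 2)) ^ 2 ≤ (64 * φ * s / κ) * (n * (lam / 2)) ^ 2 := by
      refine hWJ.trans (hWle.trans_eq ?_)
      field_simp; ring
    exact le_of_mul_le_mul_right h9 (by positivity)
  by_contra! hcon
  set M := 64 * φ * s / κ with hM
  have hM0 : 0 ≤ M := by positivity
  -- The upper bound `hup` is only available for sparse vectors, so the whole support cannot be
  -- used. A subset with `⌊M⌋ + 1` elements is small enough for `hup` and too large for `key`.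
  have h1 : ⌊M⌋₊ + 1 ≤ sparsity b := Nat.succ_le_of_lt ((Nat.floor_lt hM0).2 hcon)
  obtain ⟨J, hJ, hJc⟩ := Finset.exists_subset_card_eq h1
  have h2 := key J (fun j hj => (Finset.mem_filter.1 (hJ hj)).2) (by
    rw [hJc]; push_cast; linarith [Nat.floor_le hM0])
  rw [hJc] at h2
  push_cast at h2
  linarith [Nat.lt_floor_add_one M]

/-- Two-sided comparison of the empirical quadratic form with the Euclidean norm, up to an
`ℓ¹` error term. -/
structure DesignBounds (X : Matrix (Fin n) (Fin p) ℝ) (κ φ τ : ℝ) : Prop where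
  lower : ∀ v : Fin p → ℝ,
    κ * sqNorm2 v - τ * norm1 v ^ 2 ≤ sqNorm2 (X.mulVec v) / n
  upper : ∀ v : Fin p → ℝ,
    sqNorm2 (X.mulVec v) / n ≤ φ * sqNorm2 v + τ * norm1 v ^ 2

/-- Error bounds and sparsity of the Lasso for a well-conditioned design. -/
lemma IsLasso.bounds {X : Matrix (Fin n) (Fin p) ℝ} {a b : Fin p → ℝ} {ε : Fin n → ℝ}
    {lam s κ φ τ : ℝ} (hn : 0 < n) (h : IsLasso X (X.mulVec a + ε) lam b) (hlam : 0 < lam)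
    (hε : ∀ j, |∑ t, X t j * ε t| ≤ n * (lam / 2)) (hs : (sparsity a : ℝ) ≤ s)
    (hκ : 0 < κ) (hφ : 0 ≤ φ) (hτ : 0 ≤ τ) (hX : DesignBounds X κ φ τ)
    (hτ1 : τ * (32 * s) ≤ κ) (hτ2 : τ * (128 * (φ + 1) * s / κ + 1) ≤ 1) :
    norm1 (b - a) ≤ 32 * lam * s / κ ∧
      sqNorm2 (X.mulVec (b - a)) / n ≤ 32 * lam ^ 2 * s / κ ∧
      (sparsity b : ℝ) ≤ 128 * (φ + 1) * s / κ := by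
  have hs0 : 0 ≤ s := (Nat.cast_nonneg _).trans hs
  -- Half of `κ` is spent on absorbing the ℓ¹ error over the cone.
  have h1 := h.oracle_bounds (κ := κ / 2) hn hlam hε hs (by positivity) (fun v hv => by
    have h2 := hX.lower v
    have h3 : τ * norm1 v ^ 2 ≤ κ / 2 * sqNorm2 v := by
      calc τ * norm1 v ^ 2 ≤ τ * (16 * s * sqNorm2 v) := by gcongr
        _ = τ * (32 * s) * (sqNorm2 v / 2) := by ring
        _ ≤ κ * (sqNorm2 v / 2) := by
          gcongr; exact div_nonneg (sqNorm2_nonneg v) (by norm_num)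
        _ = _ := by ring
    linarith)
  have e1 : 16 * lam * s / (κ / 2) = 32 * lam * s / κ := by field_simp; ring
  have e2 : 16 * lam ^ 2 * s / (κ / 2) = 32 * lam ^ 2 * s / κ := by field_simp; ring
  have e3 : 64 * (φ + 1) * s / (κ / 2) = 128 * (φ + 1) * s / κ := by field_simp; ring
  refine ⟨e1 ▸ h1.1, e2 ▸ h1.2, ?_⟩
  rw [← e3]
  refine h.sparsity_le hn hlam hε (by positivity) (by positivity) hs0 h1.2 fun v hv => ?_
  rw [e3] at hv
  refine (hX.upper v).trans ?_
  -- For sparse `v` the ℓ¹ error costs at most one extra unit, whence `φ + 1`.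
  have h3 : τ * norm1 v ^ 2 ≤ 1 * sqNorm2 v := by
    calc τ * norm1 v ^ 2 ≤ τ * (sparsity v * sqNorm2 v) := by
          gcongr; exact norm1_sq_le_sparsity v
      _ ≤ τ * ((128 * (φ + 1) * s / κ + 1) * sqNorm2 v) := by
          gcongr; exact sqNorm2_nonneg v
      _ = τ * (128 * (φ + 1) * s / κ + 1) * sqNorm2 v := by ring
      _ ≤ _ := mul_le_mul_of_nonneg_right hτ2 (sqNorm2_nonneg v)
  linarith

end Lasso

/-! ### Energy bounds from stability on the unit circle. -/

section Stability

variable {p : ℕ}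

/-- Parseval's identity for the discrete Fourier transform on `M` points. -/
lemma sum_norm_sq_dft {M : ℕ} {ζ : ℂ} (hζ : IsPrimitiveRoot ζ M) (hM : 0 < M) (h : ℕ → ℂ) :
    ∑ k ∈ Finset.range M, ‖∑ s ∈ Finset.range M, (ζ ^ k) ^ s * h s‖ ^ 2 =
      M * ∑ s ∈ Finset.range M, ‖h s‖ ^ 2 := by
  have hnorm : ‖ζ‖ = 1 := hζ.norm'_eq_one hM.ne'
  have hζ0 : ζ ≠ 0 := hζ.ne_zero hM.ne'
  have hconj : (starRingEnd ℂ) ζ = ζ⁻¹ := (Complex.inv_eq_conj hnorm).symm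
  have horth : ∀ s ∈ Finset.range M, ∀ r ∈ Finset.range M,
      ∑ k ∈ Finset.range M, (ζ ^ k) ^ s * (ζ⁻¹ ^ k) ^ r = if s = r then (M : ℂ) else 0 := by
    intro s hs r hr
    have e : ∀ k, (ζ ^ k) ^ s * (ζ⁻¹ ^ k) ^ r = (ζ ^ s * ζ⁻¹ ^ r) ^ k := fun k => by
      rw [mul_pow, ← pow_mul, ← pow_mul, ← pow_mul, ← pow_mul, mul_comm k s, mul_comm k r]
    simp_rw [e]
    split_ifs with hsr
    · subst hsr
      rw [← mul_pow, mul_inv_cancel₀ hζ0]; simp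
    · have hne : ζ ^ s * ζ⁻¹ ^ r ≠ 1 := by
        intro h1
        apply hsr
        refine hζ.pow_inj (Finset.mem_range.1 hs) (Finset.mem_range.1 hr) ?_
        rwa [inv_pow, ← div_eq_mul_inv, div_eq_one_iff_eq (pow_ne_zero _ hζ0)] at h1
      rw [geom_sum_eq hne, mul_pow, ← pow_mul, ← pow_mul, mul_comm s, mul_comm r, pow_mul,
        pow_mul, inv_pow, hζ.pow_eq_one]
      simp
  have key : ∀ z : ℂ, ((‖z‖ ^ 2 : ℝ) : ℂ) = z * (starRingEnd ℂ) z := fun z => by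
    rw [Complex.mul_conj, Complex.normSq_eq_norm_sq]
  apply Complex.ofReal_injective
  push_cast
  simp_rw [← Complex.ofReal_pow, key, map_sum, map_mul, map_pow, hconj, Finset.sum_mul_sum]
  rw [Finset.sum_comm]
  simp_rw [Finset.mul_sum]
  refine Finset.sum_congr rfl fun s hs => ?_
  rw [Finset.sum_comm]
  have e2 : ∀ r ∈ Finset.range M, ∑ k ∈ Finset.range M,
      (ζ ^ k) ^ s * h s * ((ζ⁻¹ ^ k) ^ r * (starRingEnd ℂ) (h r)) =
      h s * (starRingEnd ℂ) (h r) * if s = r then (M : ℂ) else 0 := by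
    intro r hr
    rw [← horth s hs r hr, Finset.mul_sum]
    exact Finset.sum_congr rfl fun k _ => by ring
  rw [Finset.sum_congr rfl e2]
  simp only [mul_ite, mul_zero, Finset.sum_ite_eq, hs, if_true]
  ring

lemma norm_dotProduct_sq_le (v w : Fin p → ℂ) :
    ‖∑ j, v j * w j‖ ^ 2 ≤ (∑ j, ‖v j‖ ^ 2) * ∑ j, ‖w j‖ ^ 2 := by
  calc ‖∑ j, v j * w j‖ ^ 2 ≤ (∑ j, ‖v j‖ * ‖w j‖) ^ 2 := by
        gcongr
        refine (norm_sum_le _ _).trans_eq ?_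
        exact Finset.sum_congr rfl fun j _ => norm_mul _ _
    _ ≤ _ := Finset.sum_mul_sq_le_sq_mul_sq _ _ _

/-- A lower bound for a square complex matrix passes to its conjugate transpose. -/
lemma conjTranspose_lower_bound {c : ℝ} (hc : 0 < c) {N : Matrix (Fin p) (Fin p) ℂ}
    (hN : ∀ v : Fin p → ℂ, c * ∑ j, ‖v j‖ ^ 2 ≤ ∑ j, ‖(N.mulVec v) j‖ ^ 2) (v : Fin p → ℂ) :
    c * ∑ j, ‖v j‖ ^ 2 ≤ ∑ j, ‖(N.conjTranspose.mulVec v) j‖ ^ 2 := by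
  have hinj : Function.Injective N.mulVecLin := by
    rw [injective_iff_map_eq_zero]
    intro w hw
    have h1 := hN w
    rw [← Matrix.mulVecLin_apply, hw] at h1
    have h2 : ∑ j, ‖w j‖ ^ 2 = 0 := by
      refine le_antisymm ?_ (Finset.sum_nonneg fun _ _ => sq_nonneg _)
      have : c * ∑ j, ‖w j‖ ^ 2 ≤ 0 := by simpa using h1
      exact nonpos_of_mul_nonpos_right this hc
    ext j
    have := (Finset.sum_eq_zero_iff_of_nonneg fun _ _ => sq_nonneg _).1 h2 j (Finset.mem_univ j)
    simpa using this
  -- With `N w = v`, one has `‖v‖² = ⟨w, Nᴴ v⟩`. Cauchy–Schwarz together with `c ‖w‖² ≤ ‖v‖²` gives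
  -- the claim after cancelling `‖v‖²`.
  obtain ⟨w, hw⟩ := LinearMap.injective_iff_surjective.1 hinj v
  rw [Matrix.mulVecLin_apply] at hw
  set V := ∑ j, ‖v j‖ ^ 2 with hV
  set T := ∑ j, ‖(N.conjTranspose.mulVec v) j‖ ^ 2 with hT
  have hT0 : 0 ≤ T := Finset.sum_nonneg fun _ _ => sq_nonneg _
  have h1 : c * ∑ j, ‖w j‖ ^ 2 ≤ V := by simpa [hw] using hN w
  have h2 : ((V : ℝ) : ℂ) = ∑ j, (star w) j * (N.conjTranspose.mulVec v) j := by
    have e1 : ∑ j, (star w) j * (N.conjTranspose.mulVec v) j = star (N.mulVec w) ⬝ᵥ v := by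
      rw [Matrix.star_mulVec, ← Matrix.dotProduct_mulVec]; rfl
    rw [e1, hw, hV]
    push_cast
    refine Finset.sum_congr rfl fun j _ => ?_
    rw [Pi.star_apply, RCLike.star_def, ← Complex.ofReal_pow, ← Complex.normSq_eq_norm_sq,
      ← Complex.mul_conj, mul_comm]
  have h3 := norm_dotProduct_sq_le (star w) (N.conjTranspose.mulVec v)
  rw [← h2] at h3
  simp only [Pi.star_apply, norm_star, Complex.norm_real, Real.norm_eq_abs, sq_abs] at h3
  rcases (show 0 ≤ V from Finset.sum_nonneg fun _ _ => sq_nonneg _).eq_or_lt with h0 | h0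
  · rw [← h0]; simpa using hT0
  · have : V * (c * V) ≤ V * T := by
      calc V * (c * V) = c * V ^ 2 := by ring
        _ ≤ c * ((∑ j, ‖w j‖ ^ 2) * T) := by gcongr
        _ = (c * ∑ j, ‖w j‖ ^ 2) * T := by ring
        _ ≤ V * T := by gcongr
    exact le_of_mul_le_mul_left this h0

/-- Linear functionals of the process propagate through `Aᵀ`, so the bound is needed for the
transpose. As `A` is real, `1 - z Aᵀ` is the adjoint of `1 - z̄ A`. -/
lemma StableVAR.transpose_lower_bound {c C : ℝ} (hc : 0 < c) {A S : Matrix (Fin p) (Fin p) ℝ}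
    (h : StableVAR c C A S) {z : ℂ} (hz : ‖z‖ = 1) (v : Fin p → ℂ) :
    c * ∑ j, ‖v j‖ ^ 2 ≤
      ∑ j, ‖((1 - z • A.transpose.map (fun x : ℝ => (x : ℂ))).mulVec v) j‖ ^ 2 := by
  have h1 := conjTranspose_lower_bound hc
    (fun v => (h.transfer_bounds ((starRingEnd ℂ) z) (by simpa using hz) v).1) v
  have h2 : (1 - (starRingEnd ℂ) z • A.map (fun x : ℝ => (x : ℂ))).conjTranspose =
      1 - z • A.transpose.map (fun x : ℝ => (x : ℂ)) := by
    ext j k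
    simp [Matrix.conjTranspose_apply, Matrix.one_apply, eq_comm]
  rwa [h2] at h1

/-- The output of the linear recursion `f (s+1) = B (f s) + u (s+1)`, `f 0 = u 0`. -/
def linRec (B : Matrix (Fin p) (Fin p) ℝ) (u : ℕ → Fin p → ℝ) : ℕ → Fin p → ℝ
  | 0 => u 0
  | s + 1 => B.mulVec (linRec B u s) + u (s + 1)

/-- Multiplication by `1 - zB` undoes the recursion on generating functions. Cutting at `N` leaves a
single boundary coefficient, so the result is a polynomial with `N + 1` coefficients. -/
lemma linRec_transform (B : Matrix (Fin p) (Fin p) ℝ) (u : ℕ → Fin p → ℝ) (z : ℂ) (N : ℕ) :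
    (1 - z • B.map (fun x : ℝ => (x : ℂ))).mulVec
        (fun j => ∑ s ∈ Finset.range N, z ^ s * (linRec B u s j : ℂ)) =
      fun j => ∑ s ∈ Finset.range (N + 1), z ^ s *
        ((if s < N then u s j else u N j - linRec B u N j : ℝ) : ℂ) := by
  induction N with
  | zero => ext j; simp [linRec, Matrix.mulVec, dotProduct]
  | succ N ih =>
    have e1 : (fun j => ∑ s ∈ Finset.range (N + 1), z ^ s * (linRec B u s j : ℂ)) =
        (fun j => ∑ s ∈ Finset.range N, z ^ s * (linRec B u s j : ℂ)) +
          z ^ N • fun j => (linRec B u N j : ℂ) := by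
      ext j; simp [Finset.sum_range_succ]
    have e2 : (B.map (fun x : ℝ => (x : ℂ))).mulVec (fun j => (linRec B u N j : ℂ)) =
        fun j => (((B.mulVec (linRec B u N)) j : ℝ) : ℂ) := by
      ext j; simp [Matrix.mulVec, dotProduct]
    rw [e1, Matrix.mulVec_add, ih, Matrix.mulVec_smul, Matrix.sub_mulVec, Matrix.one_mulVec,
      Matrix.smul_mulVec, e2]
    ext j
    simp only [Pi.add_apply, Pi.smul_apply, Pi.sub_apply, smul_eq_mul]
    rw [Finset.sum_range_succ, Finset.sum_range_succ _ (N + 1), Finset.sum_range_succ]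
    have e3 : ∀ s ∈ Finset.range N, z ^ s *
        ((if s < N then u s j else u N j - linRec B u N j : ℝ) : ℂ) =
        z ^ s * ((if s < N + 1 then u s j else u (N + 1) j - linRec B u (N + 1) j : ℝ) : ℂ) := by
      intro s hs
      have := Finset.mem_range.1 hs
      simp [this, this.trans (Nat.lt_succ_self N)]
    rw [Finset.sum_congr rfl e3]
    simp only [lt_self_iff_false, if_false, Nat.lt_succ_self, if_true, linRec, Pi.add_apply]
    push_cast
    ring

/-- Energy bound for the recursion driven by the transpose of a stable matrix. -/
lemma StableVAR.linRec_energy {c C : ℝ} (hc : 0 < c) {A S : Matrix (Fin p) (Fin p) ℝ}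
    (h : StableVAR c C A S) (u : ℕ → Fin p → ℝ) (N : ℕ) :
    c * ∑ s ∈ Finset.range N, sqNorm2 (linRec A.transpose u s) ≤
      ∑ s ∈ Finset.range N, sqNorm2 (u s) + sqNorm2 (u N - linRec A.transpose u N) := by
  set f := linRec A.transpose u
  set ζ := Complex.exp (2 * Real.pi * Complex.I / ((N + 1 : ℕ) : ℂ))
  have hζ : IsPrimitiveRoot ζ (N + 1) := Complex.isPrimitiveRoot_exp (N + 1) (Nat.succ_ne_zero N)
  have hnorm : ‖ζ‖ = 1 := hζ.norm'_eq_one (Nat.succ_ne_zero N)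
  set g : ℕ → Fin p → ℝ := fun s j => if s < N then u s j else u N j - f N j with hg
  have h1 : ∀ k, c * ∑ j, ‖∑ s ∈ Finset.range (N + 1),
        (ζ ^ k) ^ s * ((if s < N then f s j else 0 : ℝ) : ℂ)‖ ^ 2 ≤
      ∑ j, ‖∑ s ∈ Finset.range (N + 1), (ζ ^ k) ^ s * (g s j : ℂ)‖ ^ 2 := by
    intro k
    have h2 := h.transpose_lower_bound hc (z := ζ ^ k) (by simp [hnorm])
      (fun j => ∑ s ∈ Finset.range N, (ζ ^ k) ^ s * (f s j : ℂ))
    rw [linRec_transform] at h2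
    have e : ∀ j, ∑ s ∈ Finset.range (N + 1),
        (ζ ^ k) ^ s * ((if s < N then f s j else 0 : ℝ) : ℂ) =
        ∑ s ∈ Finset.range N, (ζ ^ k) ^ s * (f s j : ℂ) := by
      intro j
      rw [Finset.sum_range_succ]
      simp only [lt_self_iff_false, if_false, Complex.ofReal_zero, mul_zero, add_zero]
      exact Finset.sum_congr rfl fun s hs => by simp [Finset.mem_range.1 hs]
    simp_rw [e]
    exact h2
  -- Summation over all roots of unity of order `N + 1` and Parseval turn the bound at each
  -- frequency into an energy bound in time.
  have h3 := Finset.sum_le_sum fun k (_ : k ∈ Finset.range (N + 1)) => h1 k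
  rw [← Finset.mul_sum, Finset.sum_comm] at h3
  rw [Finset.sum_comm (s := Finset.range (N + 1))] at h3
  simp_rw [sum_norm_sq_dft hζ (Nat.succ_pos N), ← Finset.mul_sum] at h3
  have hN : (0 : ℝ) < ((N + 1 : ℕ) : ℝ) := by positivity
  have h4 : c * ∑ j, ∑ s ∈ Finset.range (N + 1), ‖((if s < N then f s j else 0 : ℝ) : ℂ)‖ ^ 2 ≤
      ∑ j, ∑ s ∈ Finset.range (N + 1), ‖(g s j : ℂ)‖ ^ 2 := by
    refine le_of_mul_le_mul_left ?_ hN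
    calc _ = c * (((N + 1 : ℕ) : ℝ) * _) := by rw [mul_left_comm]
      _ ≤ _ := h3
  rw [Finset.sum_comm] at h4
  rw [Finset.sum_comm (s := Finset.univ)] at h4
  rw [Finset.sum_range_succ, Finset.sum_range_succ] at h4
  simp only [lt_self_iff_false, if_false, Complex.ofReal_zero, norm_zero, ne_eq,
    OfNat.ofNat_ne_zero, not_false_eq_true, zero_pow, Finset.sum_const_zero, add_zero,
    Complex.norm_real, Real.norm_eq_abs, sq_abs] at h4
  calc c * ∑ s ∈ Finset.range N, sqNorm2 (f s) = c * ∑ s ∈ Finset.range N, ∑ j,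
        (if s < N then f s j else 0) ^ 2 := by
        congr 1
        exact Finset.sum_congr rfl fun s hs => by simp [Finset.mem_range.1 hs, sqNorm2]
    _ ≤ _ := h4
    _ = _ := by
        congr 1
        · exact Finset.sum_congr rfl fun s hs => by simp [Finset.mem_range.1 hs, sqNorm2, hg]
        · simp [sqNorm2, hg]

/-- The powers of a matrix with spectral radius less than one converge to zero. -/
lemma tendsto_pow_zero_of_spectrum_lt_one {B : Matrix (Fin p) (Fin p) ℂ}
    (h : ∀ z ∈ spectrum ℂ B, ‖z‖ < 1) : Tendsto (fun N => B ^ N) atTop (𝓝 0) := by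
  let _ : NormedRing (Matrix (Fin p) (Fin p) ℂ) := Matrix.linftyOpNormedRing
  let _ : NormedAlgebra ℂ (Matrix (Fin p) (Fin p) ℂ) := Matrix.linftyOpNormedAlgebra
  rcases subsingleton_or_nontrivial (Matrix (Fin p) (Fin p) ℂ) with hs | hs
  · simp [Subsingleton.elim _ (0 : Matrix (Fin p) (Fin p) ℂ)]
  have hr : spectralRadius ℂ B < 1 := by
    have := spectrum.spectralRadius_lt_of_forall_lt B (r := 1)
      (fun z hz => by simpa [← NNReal.coe_lt_coe] using h z hz)
    simpa using this
  obtain ⟨r, hr1, hr2⟩ := ENNReal.lt_iff_exists_nnreal_btwn.1 hr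
  -- Gelfand's formula: eventually `‖B ^ N‖ ≤ r ^ N` for some `r < 1`.
  have hlim := spectrum.pow_nnnorm_pow_one_div_tendsto_nhds_spectralRadius B
  have hev := hlim.eventually_lt_const hr1
  refine tendsto_zero_iff_norm_tendsto_zero.2 ?_
  have hr2' : (r : ℝ) < 1 := by exact_mod_cast hr2
  refine squeeze_zero' (Eventually.of_forall fun _ => norm_nonneg _) ?_
    (tendsto_pow_atTop_nhds_zero_of_lt_one r.coe_nonneg hr2')
  filter_upwards [hev, eventually_gt_atTop 0] with N hN hN0
  have h1 : ((‖B ^ N‖₊ : ENNReal) ^ (1 / N : ℝ)) ^ (N : ℝ) ≤ (r : ENNReal) ^ (N : ℝ) :=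
    ENNReal.rpow_le_rpow hN.le (Nat.cast_nonneg N)
  rw [← ENNReal.rpow_mul, one_div_mul_cancel (by positivity), ENNReal.rpow_one,
    ENNReal.rpow_natCast, ← ENNReal.coe_pow, ENNReal.coe_le_coe] at h1
  exact_mod_cast h1

lemma StableVAR.tendsto_pow {c C : ℝ} {A S : Matrix (Fin p) (Fin p) ℝ}
    (h : StableVAR c C A S) : Tendsto (fun N => A.transpose ^ N) atTop (𝓝 0) := by
  have h1 := tendsto_pow_zero_of_spectrum_lt_one h.stable
  refine tendsto_pi_nhds.2 fun j => tendsto_pi_nhds.2 fun k => ?_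
  have h2 := tendsto_pi_nhds.1 (tendsto_pi_nhds.1 h1 k) j
  have e : ∀ N, ((A.map (fun x : ℝ => (x : ℂ))) ^ N) k j = (((A.transpose ^ N) j k : ℝ) : ℂ) := by
    intro N
    have : A.map (fun x : ℝ => (x : ℂ)) ^ N = (A ^ N).map (fun x : ℝ => (x : ℂ)) :=
      (Matrix.map_pow (f := Complex.ofRealHom) A N).symm
    rw [this, ← Matrix.transpose_pow]; rfl
  simp_rw [e] at h2
  have := (Complex.continuous_re.tendsto _).comp h2
  simpa [Function.comp_def] using this

lemma linRec_add (B : Matrix (Fin p) (Fin p) ℝ) {u : ℕ → Fin p → ℝ} {m : ℕ}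
    (hu : ∀ s, m < s → u s = 0) (k : ℕ) :
    linRec B u (m + k) = (B ^ k).mulVec (linRec B u m) := by
  induction k with
  | zero => simp
  | succ k ih =>
    rw [← add_assoc, linRec, hu (m + k + 1) (by omega), add_zero, ih, Matrix.mulVec_mulVec,
      pow_succ']

lemma StableVAR.tendsto_linRec {c C : ℝ} {A S : Matrix (Fin p) (Fin p) ℝ}
    (h : StableVAR c C A S) {u : ℕ → Fin p → ℝ} {m : ℕ} (hu : ∀ s, m < s → u s = 0) :
    Tendsto (linRec A.transpose u) atTop (𝓝 0) := by
  rw [← tendsto_add_atTop_iff_nat m]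
  have h1 : Continuous fun B : Matrix (Fin p) (Fin p) ℝ =>
      B.mulVec (linRec A.transpose u m) := by fun_prop
  have h2 := (h1.tendsto 0).comp h.tendsto_pow
  simp only [Matrix.zero_mulVec] at h2
  refine h2.congr fun k => ?_
  rw [Function.comp_apply, ← linRec_add _ hu, add_comm]

lemma continuous_sqNorm2 {n : ℕ} : Continuous (sqNorm2 (n := n)) := by
  unfold sqNorm2; fun_prop

/-- Energy bound for the recursion with finitely supported input. -/
lemma StableVAR.sum_sqNorm2_linRec_le {c C : ℝ} (hc : 0 < c) {A S : Matrix (Fin p) (Fin p) ℝ}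
    (h : StableVAR c C A S) {u : ℕ → Fin p → ℝ} {m : ℕ} (hu : ∀ s, m < s → u s = 0) (N : ℕ) :
    ∑ s ∈ Finset.range N, sqNorm2 (linRec A.transpose u s) ≤
      (∑ s ∈ Finset.range (m + 1), sqNorm2 (u s)) / c := by
  rw [le_div_iff₀' hc]
  -- After time `m` the input vanishes, so the boundary term in `linRec_energy` is `- f k`, which
  -- dies out by stability.
  have h0 : Tendsto (fun k => ∑ s ∈ Finset.range (m + 1), sqNorm2 (u s) +
      sqNorm2 (- linRec A.transpose u k)) atTop
      (𝓝 (∑ s ∈ Finset.range (m + 1), sqNorm2 (u s) + sqNorm2 (0 : Fin p → ℝ))) := by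
    refine tendsto_const_nhds.add ((continuous_sqNorm2.tendsto _).comp ?_)
    simpa using (h.tendsto_linRec hu).neg
  have h00 : sqNorm2 (0 : Fin p → ℝ) = 0 := by simp [sqNorm2]
  rw [h00, add_zero] at h0
  refine ge_of_tendsto h0 ?_
  filter_upwards [eventually_ge_atTop (max N (m + 1))] with k hk
  have hk1 : N ≤ k := (le_max_left _ _).trans hk
  have hk2 : m + 1 ≤ k := (le_max_right _ _).trans hk
  have h1 := h.linRec_energy hc u k
  rw [hu k (by omega), zero_sub] at h1
  have h2 : ∑ s ∈ Finset.range k, sqNorm2 (u s) = ∑ s ∈ Finset.range (m + 1), sqNorm2 (u s) := by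
    symm
    refine Finset.sum_subset (Finset.range_mono hk2) fun s _ hs => ?_
    rw [hu s (by simpa using hs)]; exact h00
  rw [h2] at h1
  refine le_trans ?_ h1
  gcongr
  exact fun _ _ _ => sqNorm2_nonneg _

end Stability

/-! ### Gaussian law of the stationary process and of its linear functionals. -/

section GaussianLaw

variable {p : ℕ} {Ω : Type*} [MeasurableSpace Ω] {P : Measure Ω}
  {A S : Matrix (Fin p) (Fin p) ℝ} {y e : ℕ → Ω → EuclideanSpace ℝ (Fin p)} {c C : ℝ}

/-- The quadratic form of a matrix. -/
def quadForm (S : Matrix (Fin p) (Fin p) ℝ) (v : Fin p → ℝ) : ℝ := v ⬝ᵥ S.mulVec v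

lemma quadForm_smul (S : Matrix (Fin p) (Fin p) ℝ) (r : ℝ) (v : Fin p → ℝ) :
    quadForm S (r • v) = r ^ 2 * quadForm S v := by
  simp only [quadForm, Matrix.mulVec_smul, smul_dotProduct, dotProduct_smul, smul_eq_mul]; ring

lemma StableVAR.quadForm_ge (h : StableVAR c C A S) (v : Fin p → ℝ) :
    c * sqNorm2 v ≤ quadForm S v := (h.noise_bounds v).1

lemma StableVAR.quadForm_le (h : StableVAR c C A S) (v : Fin p → ℝ) :
    quadForm S v ≤ C * sqNorm2 v := (h.noise_bounds v).2

lemma StableVAR.quadForm_nonneg (hc : 0 < c) (h : StableVAR c C A S) (v : Fin p → ℝ) :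
    0 ≤ quadForm S v := (mul_nonneg hc.le (sqNorm2_nonneg v)).trans (h.quadForm_ge v)

lemma StableVAR.c_le_C (h : StableVAR c C A S) (i : Fin p) : c ≤ C := by
  have h1 := (h.quadForm_ge (Pi.single i 1)).trans (h.quadForm_le (Pi.single i 1))
  have h2 : sqNorm2 (Pi.single i 1 : Fin p → ℝ) = 1 := by
    simp [sqNorm2, Pi.single_apply]
  simpa [h2] using h1

lemma IsStationaryVAR.aemeasurable_noise (h : IsStationaryVAR P A S y e) (t : ℕ) :
    AEMeasurable (e (t + 1)) P := (h.noise_law t).aemeasurable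

lemma IsStationaryVAR.aemeasurable (h : IsStationaryVAR P A S y e) (t : ℕ) :
    AEMeasurable (y t) P := (h.stationary t).aemeasurable_fst

lemma charFun_map_dotProduct {X : Ω → EuclideanSpace ℝ (Fin p)} (hX : AEMeasurable X P)
    (v : Fin p → ℝ) (τ : ℝ) :
    charFun (P.map fun ω => v ⬝ᵥ X ω) τ = charFun (P.map X) (WithLp.toLp 2 (τ • v)) := by
  have hm : Measurable fun x : EuclideanSpace ℝ (Fin p) => v ⬝ᵥ x := by
    unfold dotProduct; fun_prop
  have hmX : AEMeasurable (fun ω => v ⬝ᵥ X ω) P := hm.comp_aemeasurable hX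
  rw [charFun_apply_real, charFun_apply, integral_map hmX (by fun_prop),
    integral_map hX (by fun_prop)]
  congr 1; ext ω
  congr 2
  rw [← Complex.ofReal_mul]
  congr 1
  simp only [PiLp.inner_apply, dotProduct, Finset.mul_sum]
  exact Finset.sum_congr rfl fun j _ => by simp; ring

lemma charFun_noise (hS : S.PosSemidef) (h : IsStationaryVAR P A S y e) (t : ℕ)
    (v : Fin p → ℝ) :
    charFun (P.map (e (t + 1))) (WithLp.toLp 2 v) = Complex.exp (-(quadForm S v : ℂ) / 2) := by
  rw [(h.noise_law t).map_eq, charFun_multivariateGaussian hS]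
  simp [quadForm]; ring_nf

/-- The characteristic function of the stationary law, as a function on vectors. -/
def statChar (P : Measure Ω) (y : ℕ → Ω → EuclideanSpace ℝ (Fin p)) (v : Fin p → ℝ) : ℂ :=
  charFun (P.map (y 0)) (WithLp.toLp 2 v)

lemma IsStationaryVAR.indep_init [IsProbabilityMeasure P] (h : IsStationaryVAR P A S y e)
    (n : ℕ) (v : Fin p → ℝ) (g : ℕ → Fin p → ℝ) :
    IndepFun (fun ω => v ⬝ᵥ y 0 ω) (fun ω => ∑ t ∈ Finset.range n, g t ⬝ᵥ e (t + 1) ω) P := by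
  refine h.init_indep.comp (φ := fun x : EuclideanSpace ℝ (Fin p) => v ⬝ᵥ x)
    (ψ := fun z : ℕ → EuclideanSpace ℝ (Fin p) => ∑ t ∈ Finset.range n, g t ⬝ᵥ z t) ?_ ?_
  · unfold dotProduct; fun_prop
  · unfold dotProduct; fun_prop

/-- The characteristic function of a linear functional of the initial value and the noises. -/
lemma IsStationaryVAR.charFun_functional [IsProbabilityMeasure P] (hS : S.PosSemidef)
    (h : IsStationaryVAR P A S y e) (n : ℕ) (v : Fin p → ℝ) (g : ℕ → Fin p → ℝ) (τ : ℝ) :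
    charFun (P.map fun ω => v ⬝ᵥ y 0 ω + ∑ t ∈ Finset.range n, g t ⬝ᵥ e (t + 1) ω) τ =
      statChar P y (τ • v) *
        Complex.exp (-((τ ^ 2 * ∑ t ∈ Finset.range n, quadForm S (g t) : ℝ) : ℂ) / 2) := by
  have hm : ∀ v : Fin p → ℝ, Measurable fun x : EuclideanSpace ℝ (Fin p) => v ⬝ᵥ x := fun v => by
    unfold dotProduct; fun_prop
  have hme : ∀ t, AEMeasurable (fun ω => g t ⬝ᵥ e (t + 1) ω) P := fun t =>
    (hm _).comp_aemeasurable (h.aemeasurable_noise t)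
  have hmy : AEMeasurable (fun ω => v ⬝ᵥ y 0 ω) P := (hm v).comp_aemeasurable (h.aemeasurable 0)
  rw [(h.indep_init n v g).charFun_map_fun_add_eq_mul hmy (by fun_prop)]
  have hi : iIndepFun (fun t ω => g t ⬝ᵥ e (t + 1) ω) P :=
    h.noise_indep.comp (fun t (x : EuclideanSpace ℝ (Fin p)) => g t ⬝ᵥ x) fun t => hm _
  rw [Pi.mul_apply, charFun_map_dotProduct (h.aemeasurable 0)]
  congr 1
  rw [(hi.restrict _).charFun_map_fun_finsetSum_eq_prod (fun t _ => hme t)]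
  rw [Finset.prod_apply]
  simp_rw [charFun_map_dotProduct (h.aemeasurable_noise _), charFun_noise hS h, quadForm_smul]
  rw [← Complex.exp_sum]
  congr 1
  push_cast
  rw [← Finset.sum_div, Finset.sum_neg_distrib, Finset.mul_sum]

lemma IsStationaryVAR.recursion_dotProduct (h : IsStationaryVAR P A S y e) (t : ℕ) (ω : Ω)
    (v : Fin p → ℝ) :
    v ⬝ᵥ y (t + 1) ω = A.transpose.mulVec v ⬝ᵥ y t ω + v ⬝ᵥ e (t + 1) ω := by
  have h1 : (y (t + 1) ω : Fin p → ℝ) = A.mulVec (y t ω) + e (t + 1) ω := by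
    ext j; exact h.recursion t ω j
  rw [h1, dotProduct_add, Matrix.dotProduct_mulVec, Matrix.mulVec_transpose]

/-- One step of the recursion with `y 1` and `y 0` equal in law. Iterating this functional equation
identifies the stationary law. -/
lemma IsStationaryVAR.statChar_step [IsProbabilityMeasure P] (hS : S.PosSemidef)
    (h : IsStationaryVAR P A S y e) (v : Fin p → ℝ) :
    statChar P y v =
      statChar P y (A.transpose.mulVec v) * Complex.exp (-(quadForm S v : ℂ) / 2) := by
  have h1 := h.charFun_functional hS 1 (A.transpose.mulVec v) (fun _ => v) 1
  simp only [Finset.sum_range_one, one_smul, one_pow, one_mul] at h1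
  rw [← h1]
  have h2 := charFun_map_dotProduct (h.aemeasurable 1) v 1
  rw [one_smul, (h.stationary 1).map_eq] at h2
  rw [statChar, ← h2]
  simp_rw [← h.recursion_dotProduct 0]

/-- The variance of `v ⬝ᵥ y t` in the stationary regime. -/
def statVar (A S : Matrix (Fin p) (Fin p) ℝ) (v : Fin p → ℝ) : ℝ :=
  ∑' k, quadForm S ((A.transpose ^ k).mulVec v)

/-- The powers are the response of `linRec` to the single impulse `v` at time zero. -/
lemma StableVAR.sum_pow_le (hc : 0 < c) (h : StableVAR c C A S) (v : Fin p → ℝ) (N : ℕ) :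
    ∑ k ∈ Finset.range N, sqNorm2 ((A.transpose ^ k).mulVec v) ≤ sqNorm2 v / c := by
  have hu : ∀ s, 0 < s → (Pi.single 0 v : ℕ → Fin p → ℝ) s = 0 := fun s hs => by
    simp [hs.ne']
  have h1 := h.sum_sqNorm2_linRec_le hc hu N
  have h2 : ∀ k, linRec A.transpose (Pi.single 0 v) k = (A.transpose ^ k).mulVec v := by
    intro k
    have := linRec_add A.transpose hu k
    simpa [linRec] using this
  simpa [h2] using h1

lemma StableVAR.summable_statVar (hc : 0 < c) (h : StableVAR c C A S) (v : Fin p → ℝ) :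
    Summable fun k => quadForm S ((A.transpose ^ k).mulVec v) := by
  refine Summable.of_nonneg_of_le (fun k => h.quadForm_nonneg hc _) (fun k => h.quadForm_le _)
    (Summable.mul_left C ?_)
  exact summable_of_sum_range_le (fun k => sqNorm2_nonneg _) (h.sum_pow_le hc v)

lemma StableVAR.statVar_nonneg (hc : 0 < c) (h : StableVAR c C A S) (v : Fin p → ℝ) :
    0 ≤ statVar A S v := tsum_nonneg fun _ => h.quadForm_nonneg hc _

lemma StableVAR.statVar_ge (hc : 0 < c) (h : StableVAR c C A S) (v : Fin p → ℝ) :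
    c * sqNorm2 v ≤ statVar A S v := by
  refine (h.quadForm_ge v).trans ?_
  have := (h.summable_statVar hc v).le_tsum 0 fun _ _ => h.quadForm_nonneg hc _
  simpa [statVar] using this

lemma statVar_smul (r : ℝ) (v : Fin p → ℝ) : statVar A S (r • v) = r ^ 2 * statVar A S v := by
  simp_rw [statVar, Matrix.mulVec_smul, quadForm_smul, tsum_mul_left]

/-- The stationary law is Gaussian. -/
lemma IsStationaryVAR.statChar_eq [IsProbabilityMeasure P] (hc : 0 < c) (hst : StableVAR c C A S)
    (h : IsStationaryVAR P A S y e) (v : Fin p → ℝ) :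
    statChar P y v = Complex.exp (-(statVar A S v : ℂ) / 2) := by
  have h1 : ∀ N : ℕ, statChar P y v = statChar P y ((A.transpose ^ N).mulVec v) *
      Complex.exp (-((∑ k ∈ Finset.range N,
        quadForm S ((A.transpose ^ k).mulVec v) : ℝ) : ℂ) / 2) := by
    intro N
    induction N with
    | zero => simp
    | succ N ih =>
      rw [ih, h.statChar_step hst.noise_posDef.posSemidef, Matrix.mulVec_mulVec, ← pow_succ',
        mul_assoc, ← Complex.exp_add, Finset.sum_range_succ]
      congr 2
      push_cast; ring
  have hcont : Continuous (statChar P y) := by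
    unfold statChar
    have : IsProbabilityMeasure (P.map (y 0)) :=
      Measure.isProbabilityMeasure_map (h.aemeasurable 0)
    have h3 : Continuous (charFun (P.map (y 0))) := continuous_charFun
    exact h3.comp (PiLp.continuous_toLp 2 _)
  -- The contribution of the remote past disappears, so normality of `y 0` follows from stationarity
  -- and need not be assumed.
  have h2 : Tendsto (fun N : ℕ => statChar P y ((A.transpose ^ N).mulVec v)) atTop (𝓝 1) := by
    have h3 : Continuous fun B : Matrix (Fin p) (Fin p) ℝ => statChar P y (B.mulVec v) := by
      refine hcont.comp ?_; fun_prop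
    have h4 := (h3.tendsto 0).comp hst.tendsto_pow
    have h5 : statChar P y (Matrix.mulVec 0 v) = 1 := by
      have : IsProbabilityMeasure (P.map (y 0)) :=
        Measure.isProbabilityMeasure_map (h.aemeasurable 0)
      simp [statChar]
    rw [h5] at h4
    exact h4
  have h6 : Tendsto (fun N : ℕ => Complex.exp (-((∑ k ∈ Finset.range N,
        quadForm S ((A.transpose ^ k).mulVec v) : ℝ) : ℂ) / 2)) atTop
      (𝓝 (Complex.exp (-(statVar A S v : ℂ) / 2))) := by
    have h7 : Continuous fun x : ℝ => Complex.exp (-(x : ℂ) / 2) := by fun_prop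
    exact (h7.tendsto _).comp (hst.summable_statVar hc v).hasSum.tendsto_sum_nat
  have h8 := h2.mul h6
  simp_rw [← h1, one_mul] at h8
  exact tendsto_nhds_unique tendsto_const_nhds h8

lemma hasLaw_gaussianReal_of_charFun [IsProbabilityMeasure P] {X : Ω → ℝ} (hX : AEMeasurable X P)
    {V : ℝ} (hV : 0 ≤ V)
    (h : ∀ τ : ℝ, charFun (P.map X) τ = Complex.exp (-((τ ^ 2 * V : ℝ) : ℂ) / 2)) :
    HasLaw X (gaussianReal 0 V.toNNReal) P := by
  refine ⟨hX, ?_⟩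
  have : IsProbabilityMeasure (P.map X) := Measure.isProbabilityMeasure_map hX
  refine Measure.ext_of_charFun (funext fun τ => ?_)
  rw [h, charFun_gaussianReal]
  congr 1
  have : ((V.toNNReal : ℝ) : ℂ) = V := by rw [Real.coe_toNNReal V hV]
  push_cast at this ⊢
  rw [this]; ring

lemma IsStationaryVAR.hasLaw_functional [IsProbabilityMeasure P] (hc : 0 < c)
    (hst : StableVAR c C A S) (h : IsStationaryVAR P A S y e) (n : ℕ) (v : Fin p → ℝ)
    (g : ℕ → Fin p → ℝ) :
    HasLaw (fun ω => v ⬝ᵥ y 0 ω + ∑ t ∈ Finset.range n, g t ⬝ᵥ e (t + 1) ω)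
      (gaussianReal 0 (statVar A S v + ∑ t ∈ Finset.range n, quadForm S (g t)).toNNReal) P := by
  have hm : ∀ v : Fin p → ℝ, Measurable fun x : EuclideanSpace ℝ (Fin p) => v ⬝ᵥ x := fun v => by
    unfold dotProduct; fun_prop
  have hme : ∀ t, AEMeasurable (fun ω => g t ⬝ᵥ e (t + 1) ω) P := fun t =>
    (hm _).comp_aemeasurable (h.aemeasurable_noise t)
  have hmy : AEMeasurable (fun ω => v ⬝ᵥ y 0 ω) P := (hm _).comp_aemeasurable (h.aemeasurable 0)
  refine hasLaw_gaussianReal_of_charFun (by fun_prop) (add_nonneg (hst.statVar_nonneg hc v)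
    (Finset.sum_nonneg fun t _ => hst.quadForm_nonneg hc _)) fun τ => ?_
  rw [h.charFun_functional hst.noise_posDef.posSemidef, h.statChar_eq hc hst, statVar_smul,
    ← Complex.exp_add]
  congr 1
  push_cast; ring

lemma IsStationaryVAR.hasLaw_dotProduct [IsProbabilityMeasure P] (hc : 0 < c)
    (hst : StableVAR c C A S) (h : IsStationaryVAR P A S y e) (t : ℕ) (v : Fin p → ℝ) :
    HasLaw (fun ω => v ⬝ᵥ y t ω) (gaussianReal 0 (statVar A S v).toNNReal) P := by
  have hm : Measurable fun x : EuclideanSpace ℝ (Fin p) => v ⬝ᵥ x := by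
    unfold dotProduct; fun_prop
  have h1 := h.hasLaw_functional hc hst 0 v 0
  simp only [Finset.range_zero, Finset.sum_empty, add_zero] at h1
  have h2 := (h.stationary t).comp hm
  exact ⟨h2.aemeasurable_fst, h2.map_eq.trans h1.map_eq⟩

/-- Read backwards in time, a coefficient `v` of `y (t+1)` becomes the coefficient `Aᵀ v` of `y t`
and leaves `v` on `e (t+1)`. The accumulated coefficients therefore obey `linRec` driven by `Aᵀ`. -/
lemma IsStationaryVAR.sum_dotProduct (h : IsStationaryVAR P A S y e) (u : ℕ → Fin p → ℝ)
    (n : ℕ) (ω : Ω) (k : ℕ) (hk : k ≤ n) :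
    ∑ s ∈ Finset.range (k + 1), u s ⬝ᵥ y (n - s) ω =
      linRec A.transpose u k ⬝ᵥ y (n - k) ω +
        ∑ s ∈ Finset.range k, linRec A.transpose u s ⬝ᵥ e (n - s) ω := by
  induction k with
  | zero => simp [linRec]
  | succ k ih =>
    rw [Finset.sum_range_succ, ih (by omega), Finset.sum_range_succ]
    have h1 : n - k = (n - (k + 1)) + 1 := by omega
    rw [h1, h.recursion_dotProduct, linRec, add_dotProduct]
    ring

lemma sqNorm2_add_le {n : ℕ} (u v : Fin n → ℝ) :
    sqNorm2 (u + v) ≤ 2 * (sqNorm2 u + sqNorm2 v) := by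
  simp only [sqNorm2, ← Finset.sum_add_distrib, Finset.mul_sum]
  exact Finset.sum_le_sum fun t _ => by
    simp only [Pi.add_apply]; nlinarith [sq_nonneg (u t - v t)]

/-- Linear functionals of the process and of the noise are Gaussian, with variance controlled by
the coefficients. -/
lemma IsStationaryVAR.hasLaw_sum [IsProbabilityMeasure P] (hc : 0 < c) (hC : 0 ≤ C)
    (hst : StableVAR c C A S) (h : IsStationaryVAR P A S y e) (n : ℕ) (u w : ℕ → Fin p → ℝ) :
    ∃ V : NNReal, (V : ℝ) ≤ (2 * C / c + 2 * C) *
        ∑ t ∈ Finset.range n, (sqNorm2 (u t) + sqNorm2 (w t)) ∧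
      HasLaw (fun ω => ∑ t ∈ Finset.range n, (u t ⬝ᵥ y t ω + w t ⬝ᵥ e (t + 1) ω))
        (gaussianReal 0 V) P := by
  -- The coefficients in reversed time. The entry at `s = 0` would belong to `y n`, which does not
  -- occur in the sum, so it is zero.
  set u' : ℕ → Fin p → ℝ := fun s => if s = 0 ∨ n < s then 0 else u (n - s) with hu'
  have hu0 : ∀ s, n < s → u' s = 0 := fun s hs => by simp [hu', hs]
  set f := linRec A.transpose u' with hf
  set g : ℕ → Fin p → ℝ := fun t => f (n - 1 - t) + w t with hg
  have h1 := h.hasLaw_functional hc hst n (f n) g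
  have hsum : ∀ ω, f n ⬝ᵥ y 0 ω + ∑ t ∈ Finset.range n, g t ⬝ᵥ e (t + 1) ω =
      ∑ t ∈ Finset.range n, (u t ⬝ᵥ y t ω + w t ⬝ᵥ e (t + 1) ω) := by
    intro ω
    have h2 := h.sum_dotProduct u' n ω n le_rfl
    rw [Nat.sub_self] at h2
    have h3 : ∑ s ∈ Finset.range (n + 1), u' s ⬝ᵥ y (n - s) ω =
        ∑ t ∈ Finset.range n, u t ⬝ᵥ y t ω := by
      rw [Finset.sum_range_succ', ← Finset.sum_range_reflect (fun t => u t ⬝ᵥ y t ω)]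
      have h0 : u' 0 = 0 := by simp [hu']
      rw [h0, zero_dotProduct, add_zero]
      refine Finset.sum_congr rfl fun s hs => ?_
      have hs' := Finset.mem_range.1 hs
      have e1 : u' (s + 1) = u (n - (s + 1)) := by
        simp only [hu']; rw [if_neg (by omega)]
      rw [e1, Nat.sub_sub, add_comm 1 s]
    have h4 : ∑ s ∈ Finset.range n, f s ⬝ᵥ e (n - s) ω =
        ∑ t ∈ Finset.range n, f (n - 1 - t) ⬝ᵥ e (t + 1) ω := by
      rw [← Finset.sum_range_reflect]
      refine Finset.sum_congr rfl fun s hs => ?_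
      have hs' := Finset.mem_range.1 hs
      rw [show n - (n - 1 - s) = s + 1 by omega]
    rw [Finset.sum_add_distrib, ← h3, h2, ← hf, h4, add_assoc, ← Finset.sum_add_distrib]
    simp only [hg, add_dotProduct]
  refine ⟨_, ?_, by simpa only [hsum] using h1⟩
  rw [Real.coe_toNNReal _ (add_nonneg (hst.statVar_nonneg hc _)
    (Finset.sum_nonneg fun t _ => hst.quadForm_nonneg hc _))]
  have hU : ∀ N, ∑ s ∈ Finset.range N, sqNorm2 (f s) ≤
      (∑ t ∈ Finset.range n, sqNorm2 (u t)) / c := by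
    intro N
    refine (hst.sum_sqNorm2_linRec_le hc hu0 N).trans (le_of_eq ?_)
    congr 1
    rw [Finset.sum_range_succ', ← Finset.sum_range_reflect (fun t => sqNorm2 (u t))]
    have h0 : sqNorm2 (u' 0) = 0 := by simp [hu', sqNorm2]
    rw [h0, add_zero]
    refine Finset.sum_congr rfl fun s hs => ?_
    have hs' := Finset.mem_range.1 hs
    have e1 : u' (s + 1) = u (n - (s + 1)) := by
      simp only [hu']; rw [if_neg (by omega)]
    rw [e1, Nat.sub_sub, add_comm 1 s]
  have hq1 : ∑ t ∈ Finset.range n, quadForm S (g t) ≤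
      2 * C * ∑ s ∈ Finset.range n, sqNorm2 (f s) +
        2 * C * ∑ t ∈ Finset.range n, sqNorm2 (w t) := by
    rw [← Finset.sum_range_reflect (fun s => sqNorm2 (f s)), Finset.mul_sum, Finset.mul_sum,
      ← Finset.sum_add_distrib]
    refine Finset.sum_le_sum fun t _ => (hst.quadForm_le _).trans ?_
    have := mul_le_mul_of_nonneg_left (sqNorm2_add_le (f (n - 1 - t)) (w t)) hC
    linarith
  -- Since `(Aᵀ) ^ k (f n) = f (n + k)`, the variance due to `y 0` is the tail of the energy series
  -- whose first `n` terms bound the noise part. One energy bound pays for both.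
  have hq2 : statVar A S (f n) ≤
      2 * C * ((∑ t ∈ Finset.range n, sqNorm2 (u t)) / c -
        ∑ s ∈ Finset.range n, sqNorm2 (f s)) := by
    refine (hst.summable_statVar hc _).tsum_le_of_sum_range_le fun N => ?_
    have h5 : ∑ k ∈ Finset.range N, quadForm S ((A.transpose ^ k).mulVec (f n)) ≤
        C * ∑ k ∈ Finset.range N, sqNorm2 (f (n + k)) := by
      rw [Finset.mul_sum]
      refine Finset.sum_le_sum fun k _ => ?_
      rw [hf, linRec_add _ hu0]
      exact hst.quadForm_le _
    have h6 := hU (n + N)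
    rw [Finset.sum_range_add] at h6
    have h7 : 0 ≤ ∑ k ∈ Finset.range N, sqNorm2 (f (n + k)) :=
      Finset.sum_nonneg fun _ _ => sqNorm2_nonneg _
    calc _ ≤ C * ∑ k ∈ Finset.range N, sqNorm2 (f (n + k)) := h5
      _ ≤ 2 * C * ∑ k ∈ Finset.range N, sqNorm2 (f (n + k)) := by nlinarith [mul_nonneg hC h7]
      _ ≤ _ := by gcongr; linarith
  have hw0 : 0 ≤ ∑ t ∈ Finset.range n, sqNorm2 (w t) :=
    Finset.sum_nonneg fun _ _ => sqNorm2_nonneg _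
  have hu0' : 0 ≤ ∑ t ∈ Finset.range n, sqNorm2 (u t) :=
    Finset.sum_nonneg fun _ _ => sqNorm2_nonneg _
  rw [Finset.sum_add_distrib]
  have h8 : 0 ≤ 2 * C / c * ∑ t ∈ Finset.range n, sqNorm2 (w t) := by positivity
  have h9 : 0 ≤ 2 * C * ∑ t ∈ Finset.range n, sqNorm2 (u t) := by positivity
  calc _ ≤ 2 * C * ((∑ t ∈ Finset.range n, sqNorm2 (u t)) / c) +
        2 * C * ∑ t ∈ Finset.range n, sqNorm2 (w t) := by linarith
    _ = 2 * C / c * ∑ t ∈ Finset.range n, sqNorm2 (u t) +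
        2 * C * ∑ t ∈ Finset.range n, sqNorm2 (w t) := by ring
    _ ≤ _ := by nlinarith

lemma memLp_of_hasLaw_gaussianReal {X : Ω → ℝ} {V : NNReal} (hX : HasLaw X (gaussianReal 0 V) P)
    (q : NNReal) : MemLp X q P := by
  have h1 : MemLp id q (gaussianReal 0 V) := memLp_id_gaussianReal q
  rw [← hX.map_eq] at h1
  exact h1.comp_of_map hX.aemeasurable

lemma integral_of_hasLaw_gaussianReal {X : Ω → ℝ} {V : NNReal}
    (hX : HasLaw X (gaussianReal 0 V) P) : ∫ ω, X ω ∂P = 0 := by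
  rw [hX.integral_eq]; simp

lemma integral_sq_of_hasLaw_gaussianReal {X : Ω → ℝ} {V : NNReal}
    (hX : HasLaw X (gaussianReal 0 V) P) : ∫ ω, X ω ^ 2 ∂P = V := by
  have h1 := hX.variance_eq
  rw [variance_id_gaussianReal, variance_of_integral_eq_zero hX.aemeasurable
    (integral_of_hasLaw_gaussianReal hX)] at h1
  exact h1

lemma IsStationaryVAR.hasLaw_noise (hst : StableVAR c C A S)
    [IsProbabilityMeasure P] (hc : 0 < c) (h : IsStationaryVAR P A S y e) (t : ℕ) (j : Fin p) :
    ∃ V : NNReal, HasLaw (fun ω => e (t + 1) ω j) (gaussianReal 0 V) P := by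
  have h1 := h.hasLaw_functional hc hst (t + 1) 0 (Pi.single t (Pi.single j 1))
  refine ⟨_, h1.congr (ae_of_all _ fun ω => ?_)⟩
  simp only [zero_dotProduct, zero_add]
  rw [Finset.sum_eq_single t]
  · simp
  · intro b _ hb; simp [hb]
  · intro hh; simp at hh

lemma IsStationaryVAR.hasLaw_coord [IsProbabilityMeasure P] (hc : 0 < c)
    (hst : StableVAR c C A S) (h : IsStationaryVAR P A S y e) (t : ℕ) (j : Fin p) :
    ∃ V : NNReal, HasLaw (fun ω => y t ω j) (gaussianReal 0 V) P :=
  ⟨_, (h.hasLaw_dotProduct hc hst t (Pi.single j 1)).congr (ae_of_all _ fun ω => by simp)⟩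

/-- The process is uncorrelated with the future noise. -/
lemma IsStationaryVAR.integral_mul_noise_eq_zero [IsProbabilityMeasure P] (hc : 0 < c)
    (hst : StableVAR c C A S) (h : IsStationaryVAR P A S y e) (t : ℕ) :
    ∀ r, t ≤ r → ∀ j i, ∫ ω, y t ω j * e (r + 1) ω i ∂P = 0 := by
  have hm : ∀ j : Fin p, Measurable fun x : EuclideanSpace ℝ (Fin p) => x j := fun j => by fun_prop
  have hL2 : ∀ t j, MemLp (fun ω => y t ω j) 2 P := fun t j => by
    obtain ⟨V, hV⟩ := h.hasLaw_coord hc hst t j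
    exact_mod_cast memLp_of_hasLaw_gaussianReal hV 2
  have hL2e : ∀ t j, MemLp (fun ω => e (t + 1) ω j) 2 P := fun t j => by
    obtain ⟨V, hV⟩ := h.hasLaw_noise hst hc t j
    exact_mod_cast memLp_of_hasLaw_gaussianReal hV 2
  have hz : ∀ r i, ∫ ω, e (r + 1) ω i ∂P = 0 := fun r i => by
    obtain ⟨V, hV⟩ := h.hasLaw_noise hst hc r i
    exact integral_of_hasLaw_gaussianReal hV
  induction t with
  | zero =>
    intro r _ j i
    have hi : IndepFun (fun ω => y 0 ω j) (fun ω => e (r + 1) ω i) P :=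
      h.init_indep.comp (φ := fun x : EuclideanSpace ℝ (Fin p) => x j)
        (ψ := fun z : ℕ → EuclideanSpace ℝ (Fin p) => z r i) (hm j) (by fun_prop)
    rw [hi.integral_fun_mul_eq_mul_integral (hL2 0 j).aestronglyMeasurable
      (hL2e r i).aestronglyMeasurable, hz, mul_zero]
  | succ t ih =>
    intro r hr j i
    -- Unrolling one step leaves products with `y t`, covered by induction, and a product of noises
    -- at the distinct times `t + 1` and `r + 1`.
    have e1 : ∀ ω, y (t + 1) ω j * e (r + 1) ω i =
        (∑ k, A j k * (y t ω k * e (r + 1) ω i)) + e (t + 1) ω j * e (r + 1) ω i := by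
      intro ω
      rw [h.recursion t ω j, add_mul, Matrix.mulVec, dotProduct, Finset.sum_mul]
      congr 1
      exact Finset.sum_congr rfl fun k _ => by ring
    have hi : IndepFun (fun ω => e (t + 1) ω j) (fun ω => e (r + 1) ω i) P :=
      (h.noise_indep.indepFun (show t ≠ r by omega)).comp (hm j) (hm i)
    have i1 : ∀ k, Integrable (fun ω => A j k * (y t ω k * e (r + 1) ω i)) P := fun k =>
      ((hL2 t k).integrable_mul (hL2e r i)).const_mul _
    have i2 : Integrable (fun ω => e (t + 1) ω j * e (r + 1) ω i) P :=
      (hL2e t j).integrable_mul (hL2e r i)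
    simp_rw [e1]
    rw [integral_add (integrable_finsetSum _ fun k _ => i1 k) i2,
      integral_finsetSum _ fun k _ => i1 k,
      hi.integral_fun_mul_eq_mul_integral (hL2e t j).aestronglyMeasurable
      (hL2e r i).aestronglyMeasurable, hz, zero_mul, add_zero]
    refine Finset.sum_eq_zero fun k _ => ?_
    rw [integral_const_mul, ih r (by omega), mul_zero]

end GaussianLaw

/-! ### Concentration for dominated Gaussian vectors. -/

section Concentration

/-- A centered Gaussian measure whose covariance is at most `σ2` times the identity. -/
def GaussianDominated {E : Type*} [NormedAddCommGroup E] [InnerProductSpace ℝ E]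
    [MeasurableSpace E] (μ : Measure E) (σ2 : ℝ) : Prop :=
  ∀ w : E, ∃ V : NNReal, (V : ℝ) ≤ σ2 * ‖w‖ ^ 2 ∧
    μ.map (fun x => inner ℝ w x) = gaussianReal 0 V

lemma lintegral_exp_mul_gaussianReal (V : NNReal) (r : ℝ) :
    ∫⁻ x, ENNReal.ofReal (Real.exp (r * x)) ∂(gaussianReal 0 V) =
      ENNReal.ofReal (Real.exp (V * r ^ 2 / 2)) := by
  rw [← ofReal_integral_eq_lintegral_ofReal (integrable_exp_mul_gaussianReal r)
    (ae_of_all _ fun _ => (Real.exp_pos _).le)]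
  have h := congrFun (mgf_id_gaussianReal (μ := 0) (v := V)) r
  simp only [mgf, id, zero_mul, zero_add] at h
  rw [h]

lemma integral_exp_sq_gaussianReal {b : ℝ} (hb : b < 1 / 2) :
    ∫ x, Real.exp (b * x ^ 2) ∂(gaussianReal 0 1) = √((1 - 2 * b)⁻¹) := by
  rw [integral_gaussianReal_eq_integral_smul one_ne_zero]
  simp only [gaussianPDFReal, NNReal.coe_one, mul_one, sub_zero, smul_eq_mul]
  have h1 : ∀ x : ℝ, (√(2 * Real.pi))⁻¹ * Real.exp (-x ^ 2 / 2) * Real.exp (b * x ^ 2) =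
      (√(2 * Real.pi))⁻¹ * Real.exp (-(1 / 2 - b) * x ^ 2) := fun x => by
    rw [mul_assoc, ← Real.exp_add]; congr 2; ring
  simp_rw [h1]
  rw [integral_const_mul, integral_gaussian, ← Real.sqrt_inv, ← Real.sqrt_mul (by positivity)]
  congr 1
  have : (1 - 2 * b) ≠ 0 := by linarith
  have h2 : (1 / 2 - b) ≠ 0 := by linarith
  have hpi := Real.pi_ne_zero
  rw [show 1 - 2 * b = 2 * (1 / 2 - b) by ring]
  field_simp

/-- The exact value is `(1 - 2b)^(-1/2)`, and `(1 - 2b)(1 + 4b) ≥ 1` precisely when `b ≤ 1/4` for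
positive `b`. -/
lemma integral_exp_sq_gaussianReal_le {b : ℝ} (hb0 : 0 ≤ b) (hb : b ≤ 1 / 4) :
    ∫ x, Real.exp (b * x ^ 2) ∂(gaussianReal 0 1) ≤ Real.exp (2 * b) := by
  rw [integral_exp_sq_gaussianReal (by linarith)]
  refine Real.sqrt_le_iff.2 ⟨(Real.exp_pos _).le, ?_⟩
  rw [← Real.exp_nat_mul, inv_le_comm₀ (by linarith) (Real.exp_pos _), ← Real.exp_neg]
  have h1 : Real.exp (-(4 * b)) ≤ (1 + 4 * b)⁻¹ := by
    rw [Real.exp_neg]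
    exact inv_anti₀ (by positivity) (by linarith [Real.add_one_le_exp (4 * b)])
  have h2 : (1 + 4 * b)⁻¹ ≤ 1 - 2 * b := by
    rw [inv_le_iff_one_le_mul₀ (by positivity)]; nlinarith
  refine le_trans (le_of_eq ?_) (h1.trans h2)
  congr 1; push_cast; ring

/-- The Bochner integral of a non-integrable function is zero, whereas the computed value is
positive. -/
lemma integrable_exp_sq_gaussianReal {b : ℝ} (hb : b < 1 / 2) :
    Integrable (fun x => Real.exp (b * x ^ 2)) (gaussianReal 0 1) := by
  by_contra h
  have h1 := integral_exp_sq_gaussianReal hb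
  rw [integral_undef h] at h1
  have : 0 < √((1 - 2 * b)⁻¹) := Real.sqrt_pos.2 (inv_pos.2 (by linarith))
  linarith

lemma lintegral_exp_sq_stdGaussian_le {ι : Type*} [Fintype ι] {b : ℝ} (hb0 : 0 ≤ b)
    (hb : b ≤ 1 / 4) :
    ∫⁻ z, ENNReal.ofReal (Real.exp (b * ‖z‖ ^ 2)) ∂(stdGaussian (EuclideanSpace ℝ ι)) ≤
      ENNReal.ofReal (Real.exp (2 * b * Fintype.card ι)) := by
  rw [← map_pi_eq_stdGaussian, lintegral_map (by fun_prop) (by fun_prop)]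
  have h1 : ∀ z : ι → ℝ, Real.exp (b * ‖(WithLp.toLp 2 z : EuclideanSpace ℝ ι)‖ ^ 2) =
      ∏ i, Real.exp (b * z i ^ 2) := fun z => by
    rw [EuclideanSpace.real_norm_sq_eq, Finset.mul_sum, Real.exp_sum]
  simp_rw [h1]
  have hint : Integrable (fun z : ι → ℝ => ∏ i, Real.exp (b * z i ^ 2))
      (Measure.pi fun _ => gaussianReal 0 1) :=
    Integrable.fintype_prod (f := fun _ x => Real.exp (b * x ^ 2))
      fun _ => integrable_exp_sq_gaussianReal (by linarith)
  rw [← ofReal_integral_eq_lintegral_ofReal hint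
    (ae_of_all _ fun z => Finset.prod_nonneg fun i _ => (Real.exp_pos _).le)]
  refine ENNReal.ofReal_le_ofReal ?_
  rw [integral_fintype_prod_eq_prod (f := fun _ x => Real.exp (b * x ^ 2)), Finset.prod_const,
    Finset.card_univ]
  refine (pow_le_pow_left₀ (integral_nonneg fun _ => (Real.exp_pos _).le)
    (integral_exp_sq_gaussianReal_le hb0 hb) _).trans_eq ?_
  rw [← Real.exp_nat_mul]; congr 1; ring

section General

variable {E : Type*} [NormedAddCommGroup E] [InnerProductSpace ℝ E] [MeasurableSpace E]
  [BorelSpace E] {μ : Measure E} {σ2 : ℝ}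

lemma GaussianDominated.lintegral_exp_inner_le (h : GaussianDominated μ σ2) (w : E) :
    ∫⁻ x, ENNReal.ofReal (Real.exp (inner ℝ w x)) ∂μ ≤
      ENNReal.ofReal (Real.exp (σ2 * ‖w‖ ^ 2 / 2)) := by
  obtain ⟨V, hV, hlaw⟩ := h w
  have h1 := lintegral_exp_mul_gaussianReal V 1
  rw [← hlaw, lintegral_map (by fun_prop) (by fun_prop)] at h1
  simp only [one_mul, one_pow, mul_one] at h1
  rw [h1]
  gcongr

lemma GaussianDominated.isGaussian [CompleteSpace E] (h : GaussianDominated μ σ2) :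
    IsGaussian μ := by
  refine isGaussian_of_map_eq_gaussianReal fun L => ?_
  obtain ⟨V, -, hlaw⟩ := h ((InnerProductSpace.toDual ℝ E).symm L)
  refine ⟨0, V, ?_⟩
  rw [← hlaw]
  congr 1
  ext x
  simp

lemma GaussianDominated.integral_dual [CompleteSpace E] (h : GaussianDominated μ σ2)
    (L : StrongDual ℝ E) : ∫ x, L x ∂μ = 0 := by
  obtain ⟨V, -, hlaw⟩ := h ((InnerProductSpace.toDual ℝ E).symm L)
  have h1 : (fun x => inner ℝ ((InnerProductSpace.toDual ℝ E).symm L) x) = L := by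
    ext x; simp
  rw [h1] at hlaw
  have h2 : ∫ x, x ∂(gaussianReal 0 V) = 0 := by simp
  rwa [← hlaw, integral_map (by fun_prop) (by fun_prop)] at h2

set_option maxHeartbeats 1000000 in
/-- The Maurey–Pisier inequality. -/
theorem GaussianDominated.lintegral_exp_sub_le [CompleteSpace E] [SecondCountableTopology E]
    (h : GaussianDominated μ σ2)
    {F : E → ℝ} {G : E → E} (hG : Continuous G) (hF : ∀ x, HasFDerivAt F (innerSL ℝ (G x)) x) :
    ∫⁻ z, ENNReal.ofReal (Real.exp (F z.2 - F z.1)) ∂(μ.prod μ) ≤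
      ∫⁻ x, ENNReal.ofReal (Real.exp (Real.pi ^ 2 / 8 * σ2 * ‖G x‖ ^ 2)) ∂μ := by
  have hgauss := h.isGaussian
  set k : ℝ := Real.pi / 2 with hk
  have hk0 : 0 < k := by positivity
  set H : E × E → ℝ := fun z => Real.exp (k * inner ℝ (G z.1) z.2) with hH
  have hHc : Continuous H := by fun_prop
  set R : ℝ → E × E → E × E := fun θ z => ContinuousLinearMap.rotation θ z with hR
  have hRc : Continuous fun q : ℝ × (E × E) => R q.1 q.2 := by
    simp only [hR, ContinuousLinearMap.rotation_apply]
    fun_prop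
  -- Along the path `cos θ • x + sin θ • y` from `x` to `y`, the increment of `F` is the integral of
  -- `⟨G, velocity⟩` over `(0, π/2]`. Jensen's inequality moves the exponential inside the average
  -- over `θ`, which costs the factor `k = π/2`.
  have hpt : ∀ z : E × E, ENNReal.ofReal (Real.exp (F z.2 - F z.1)) ≤
      ENNReal.ofReal k⁻¹ * ∫⁻ θ in Set.Ioc 0 k, ENNReal.ofReal (H (R θ z)) := by
    intro z
    have hc1 : Continuous fun θ => inner ℝ (G (R θ z).1) (R θ z).2 := by fun_prop
    have hder : ∀ θ : ℝ, HasDerivAt (fun θ => F (R θ z).1)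
        (inner ℝ (G (R θ z).1) (R θ z).2) θ := by
      intro θ
      have h1 : HasDerivAt (fun θ => (R θ z).1) (R θ z).2 θ := by
        simp only [hR, ContinuousLinearMap.rotation_apply]
        exact ((Real.hasDerivAt_cos θ).smul_const z.1).add ((Real.hasDerivAt_sin θ).smul_const z.2)
      exact (hF _).comp_hasDerivAt θ h1
    have hint := intervalIntegral.integral_eq_sub_of_hasDerivAt (a := 0) (b := k)
      (fun θ _ => hder θ) (hc1.intervalIntegrable _ _)
    have e0 : (R 0 z).1 = z.1 := by simp [hR, ContinuousLinearMap.rotation_apply]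
    have e1 : (R k z).1 = z.2 := by simp [hR, hk, ContinuousLinearMap.rotation_apply]
    rw [e0, e1, intervalIntegral.integral_of_le hk0.le] at hint
    have hvol : (volume.real (Set.Ioc 0 k)) = k := by simp [hk0.le]
    have hJ := (convexOn_exp).map_set_average_le (μ := volume) (t := Set.Ioc 0 k)
      (f := fun θ => k * inner ℝ (G (R θ z).1) (R θ z).2) Real.continuous_exp.continuousOn
      isClosed_univ (by simp [hk0]) (by simp) (by simp)
      ((hc1.const_mul k).integrableOn_Ioc)
      ((Real.continuous_exp.comp (hc1.const_mul k)).integrableOn_Ioc)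
    rw [setAverage_eq, setAverage_eq, hvol, integral_const_mul, hint, smul_eq_mul, smul_eq_mul,
      inv_mul_cancel_left₀ hk0.ne'] at hJ
    refine (ENNReal.ofReal_le_ofReal hJ).trans_eq ?_
    have hi : IntegrableOn (fun θ => Real.exp (k * inner ℝ (G (R θ z).1) (R θ z).2))
        (Set.Ioc 0 k) := (Real.continuous_exp.comp (hc1.const_mul k)).integrableOn_Ioc
    rw [ENNReal.ofReal_mul (by positivity), ofReal_integral_eq_lintegral_ofReal hi
      (ae_of_all _ fun _ => (Real.exp_pos _).le)]
  -- Position and velocity on the path are a rotation of two independent copies, and a centered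
  -- Gaussian pair is invariant under rotations.
  have hrot : ∀ θ, ∫⁻ z, ENNReal.ofReal (H (R θ z)) ∂(μ.prod μ) =
      ∫⁻ z, ENNReal.ofReal (H z) ∂(μ.prod μ) := by
    intro θ
    have h1 := IsGaussian.map_rotation_eq_self_of_forall_strongDual_eq_zero (μ := μ)
      h.integral_dual θ
    conv_rhs => rw [← h1]
    rw [lintegral_map (by fun_prop) (by fun_prop)]
  have hc2 : Continuous fun q : (E × E) × ℝ => H (R q.2 q.1) :=
    hHc.comp (hRc.comp (continuous_snd.prodMk continuous_fst))
  have hm : Measurable (Function.uncurry fun (z : E × E) (θ : ℝ) => ENNReal.ofReal (H (R θ z))) :=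
    hc2.measurable.ennreal_ofReal
  have hm2 : Measurable fun z => ENNReal.ofReal (H z) := hHc.measurable.ennreal_ofReal
  clear_value H R
  calc ∫⁻ z, ENNReal.ofReal (Real.exp (F z.2 - F z.1)) ∂(μ.prod μ)
      ≤ ∫⁻ z, (ENNReal.ofReal k⁻¹ *
          ∫⁻ θ in Set.Ioc 0 k, ENNReal.ofReal (H (R θ z))) ∂(μ.prod μ) :=
        lintegral_mono hpt
    _ = ENNReal.ofReal k⁻¹ * ∫⁻ θ in Set.Ioc 0 k,
          (∫⁻ z, ENNReal.ofReal (H (R θ z)) ∂(μ.prod μ)) := by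
        rw [lintegral_const_mul' _ _ ENNReal.ofReal_ne_top]
        congr 1
        exact lintegral_lintegral_swap hm.aemeasurable
    _ = ∫⁻ z, ENNReal.ofReal (H z) ∂(μ.prod μ) := by
        generalize hI : ∫⁻ z, ENNReal.ofReal (H z) ∂(μ.prod μ) = I at hrot ⊢
        rw [lintegral_congr hrot, setLIntegral_const, Real.volume_Ioc, sub_zero, mul_left_comm,
          ← ENNReal.ofReal_mul (inv_nonneg.2 hk0.le), inv_mul_cancel₀ hk0.ne', ENNReal.ofReal_one,
          mul_one]
    _ = ∫⁻ x, ∫⁻ y, ENNReal.ofReal (H (x, y)) ∂μ ∂μ :=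
        lintegral_prod _ hm2.aemeasurable
    _ ≤ _ := by
        refine lintegral_mono fun x => ?_
        rw [hH]
        -- For fixed `x` the second copy is integrated out; the exponent is `k² σ2 ‖G x‖² / 2` with
        -- `k² / 2 = π² / 8`.
        have h1 := h.lintegral_exp_inner_le (k • G x)
        simp only [inner_smul_left, norm_smul, conj_trivial] at h1
        refine h1.trans_eq ?_
        congr 2
        rw [mul_pow, Real.norm_eq_abs, sq_abs, hk]; ring

end General

/-- Exponential moments of the squared norm, by decoupling with a standard Gaussian vector. -/
lemma GaussianDominated.lintegral_exp_sq_le {ι : Type*} [Fintype ι]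
    {μ : Measure (EuclideanSpace ℝ ι)} {σ2 : ℝ} (hσ : 0 ≤ σ2) (h : GaussianDominated μ σ2)
    {a : ℝ} (ha0 : 0 ≤ a) (ha : a * σ2 ≤ 1 / 4) :
    ∫⁻ x, ENNReal.ofReal (Real.exp (a * ‖x‖ ^ 2)) ∂μ ≤
      ENNReal.ofReal (Real.exp (2 * (a * σ2) * Fintype.card ι)) := by
  have hgauss := h.isGaussian
  set γ := stdGaussian (EuclideanSpace ℝ ι)
  set r := √(2 * a) with hr
  have hr2 : r ^ 2 = 2 * a := Real.sq_sqrt (by positivity)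
  -- The squared norm is linearized by an independent standard Gaussian `z`. After exchanging the
  -- integrals only the domination of `μ` in the direction `z` is needed, so the covariance need not
  -- be diagonalized.
  have h1 : ∀ x : EuclideanSpace ℝ ι, ENNReal.ofReal (Real.exp (a * ‖x‖ ^ 2)) =
      ∫⁻ z, ENNReal.ofReal (Real.exp (r * inner ℝ x z)) ∂γ := by
    intro x
    have hlaw : γ.map (fun z => inner ℝ x z) = gaussianReal 0 (‖x‖₊ ^ 2) := by
      have h2 := IsGaussian.map_eq_gaussianReal (μ := γ) (innerSL ℝ x)
      rw [integral_strongDual_stdGaussian, variance_dual_stdGaussian, innerSL_apply_norm] at h2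
      rw [Real.toNNReal_pow (norm_nonneg _), norm_toNNReal] at h2
      exact h2
    have h3 := lintegral_exp_mul_gaussianReal (‖x‖₊ ^ 2) r
    rw [← hlaw, lintegral_map (by fun_prop) (by fun_prop)] at h3
    rw [h3, hr2]
    congr 2
    push_cast; ring
  simp_rw [h1]
  rw [lintegral_lintegral_swap (by fun_prop)]
  refine le_trans (lintegral_mono fun z => ?_) (lintegral_exp_sq_stdGaussian_le
    (mul_nonneg ha0 hσ) ha)
  have h4 := h.lintegral_exp_inner_le (r • z)
  simp only [inner_smul_left, norm_smul, conj_trivial] at h4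
  simp_rw [real_inner_comm z]
  refine h4.trans_eq ?_
  congr 2
  rw [mul_pow, Real.norm_eq_abs, sq_abs, hr2]; ring

end Concentration

/-! ### Tail bounds for bilinear forms and for sums of fourth powers. -/

section Tails

lemma ofReal_integral_le_lintegral_ofReal {α : Type*} [MeasurableSpace α] {μ : Measure α}
    {f : α → ℝ} (hf : Integrable f μ) :
    ENNReal.ofReal (∫ x, f x ∂μ) ≤ ∫⁻ x, ENNReal.ofReal (f x) ∂μ := by
  rw [integral_eq_lintegral_pos_part_sub_lintegral_neg_part hf]
  refine (ENNReal.ofReal_le_ofReal (sub_le_self _ ENNReal.toReal_nonneg)).trans ?_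
  exact ENNReal.ofReal_toReal_le

/-- The exponential Markov inequality. -/
lemma measure_ge_le_of_lintegral_exp {α : Type*} [MeasurableSpace α] {μ : Measure α} {f : α → ℝ}
    (hf : AEMeasurable f μ) {B lam τ : ℝ} (hlam : 0 ≤ lam)
    (h : ∫⁻ x, ENNReal.ofReal (Real.exp (lam * f x)) ∂μ ≤ ENNReal.ofReal (Real.exp B)) :
    μ {x | τ ≤ f x} ≤ ENNReal.ofReal (Real.exp (-(lam * τ) + B)) := by
  have h1 := mul_meas_ge_le_lintegral₀ (μ := μ)
    (f := fun x => ENNReal.ofReal (Real.exp (lam * f x))) (by fun_prop)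
    (ENNReal.ofReal (Real.exp (lam * τ)))
  have h2 : μ {x | τ ≤ f x} ≤
      μ {x | ENNReal.ofReal (Real.exp (lam * τ)) ≤ ENNReal.ofReal (Real.exp (lam * f x))} := by
    refine measure_mono fun x hx => ?_
    have hx' : τ ≤ f x := hx
    simp only [Set.mem_ofPred_eq]
    gcongr
  have h3 : ENNReal.ofReal (Real.exp (lam * τ)) * μ {x | τ ≤ f x} ≤
      ENNReal.ofReal (Real.exp B) := (mul_le_mul_right h2 _).trans (h1.trans h)
  have h4 : ENNReal.ofReal (Real.exp (-(lam * τ) + B)) =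
      ENNReal.ofReal (Real.exp B) / ENNReal.ofReal (Real.exp (lam * τ)) := by
    rw [← ENNReal.ofReal_div_of_pos (Real.exp_pos _), ← Real.exp_sub]
    congr 2; ring
  rw [h4, ENNReal.le_div_iff_mul_le (Or.inl (by simp [Real.exp_pos])) (Or.inl (by simp)), mul_comm]
  exact h3

/-- Jensen's inequality in the independent copy, obtained from `1 + x ≤ exp x`. It replaces the mean
by a copy, the form in which the Maurey–Pisier inequality applies. -/
lemma lintegral_exp_center_le {α : Type*} [MeasurableSpace α] {μ : Measure α}
    [IsProbabilityMeasure μ] {q : α → ℝ} (hq : Measurable q) (hqi : Integrable q μ) (lam : ℝ) :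
    ∫⁻ x, ENNReal.ofReal (Real.exp (lam * (q x - ∫ y, q y ∂μ))) ∂μ ≤
      ∫⁻ z, ENNReal.ofReal (Real.exp (lam * q z.2 - lam * q z.1)) ∂(μ.prod μ) := by
  set m := ∫ y, q y ∂μ
  rw [lintegral_prod_symm _ (by fun_prop)]
  refine lintegral_mono fun x => ?_
  have hi0 : Integrable (fun y => lam * (q y - m)) μ :=
    (hqi.sub (integrable_const _)).const_mul _
  have hi : Integrable (fun y => Real.exp (lam * (q x - m)) * (1 - lam * (q y - m))) μ :=
    ((integrable_const _).sub hi0).const_mul _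
  calc ENNReal.ofReal (Real.exp (lam * (q x - m)))
      = ENNReal.ofReal (∫ y, Real.exp (lam * (q x - m)) * (1 - lam * (q y - m)) ∂μ) := by
        congr 1
        rw [integral_const_mul, integral_sub (integrable_const _) hi0, integral_const_mul,
          integral_sub hqi (integrable_const _)]
        simp [m]
    _ ≤ ∫⁻ y, ENNReal.ofReal (Real.exp (lam * (q x - m)) * (1 - lam * (q y - m))) ∂μ :=
        ofReal_integral_le_lintegral_ofReal hi
    _ ≤ _ := by
        refine lintegral_mono fun y => ENNReal.ofReal_le_ofReal ?_
        have h1 : lam * q x - lam * q y = lam * (q x - m) + -(lam * (q y - m)) := by ring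
        simp only
        rw [h1, Real.exp_add]
        gcongr
        linarith [Real.add_one_le_exp (-(lam * (q y - m)))]

section BilinearForm

variable {n : ℕ}

/-- The inner product of the two halves of a vector. -/
def halfProd (z : EuclideanSpace ℝ (Fin n ⊕ Fin n)) : ℝ := ∑ t, z (Sum.inl t) * z (Sum.inr t)

/-- Exchange of the two halves of a vector. -/
def halfSwap (z : EuclideanSpace ℝ (Fin n ⊕ Fin n)) : EuclideanSpace ℝ (Fin n ⊕ Fin n) :=
  WithLp.toLp 2 fun s => z s.swap

lemma continuous_halfSwap : Continuous (halfSwap (n := n)) := by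
  unfold halfSwap
  fun_prop

lemma norm_halfSwap_sq (z : EuclideanSpace ℝ (Fin n ⊕ Fin n)) :
    ‖halfSwap z‖ ^ 2 = ‖z‖ ^ 2 := by
  simp only [EuclideanSpace.real_norm_sq_eq, halfSwap, Fintype.sum_sum_type, Sum.swap_inl,
    Sum.swap_inr]
  rw [add_comm]

/-- The gradient has the same norm as `z`, so Maurey–Pisier reduces the bilinear form to an
exponential moment of `‖z‖²`. -/
lemma hasFDerivAt_halfProd (z : EuclideanSpace ℝ (Fin n ⊕ Fin n)) :
    HasFDerivAt halfProd (innerSL ℝ (halfSwap z)) z := by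
  have hp : ∀ s : Fin n ⊕ Fin n, HasFDerivAt (fun x : EuclideanSpace ℝ (Fin n ⊕ Fin n) => x s)
      (EuclideanSpace.proj s : EuclideanSpace ℝ (Fin n ⊕ Fin n) →L[ℝ] ℝ) z := fun s =>
    (EuclideanSpace.proj s : EuclideanSpace ℝ (Fin n ⊕ Fin n) →L[ℝ] ℝ).hasFDerivAt
  have h1 := HasFDerivAt.fun_sum (u := Finset.univ)
    fun (t : Fin n) _ => (hp (Sum.inl t)).mul (hp (Sum.inr t))
  refine h1.congr_fderiv ?_
  ext w
  simp only [_root_.sum_apply, innerSL_apply_apply, PiLp.inner_apply, halfSwap,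
    Fintype.sum_sum_type, Sum.swap_inl, Sum.swap_inr]
  rw [← Finset.sum_add_distrib]
  refine Finset.sum_congr rfl fun t _ => ?_
  simp
  ring

/-- Concentration of the inner product of the two halves of a dominated Gaussian vector. -/
lemma GaussianDominated.halfProd_tail {μ : Measure (EuclideanSpace ℝ (Fin n ⊕ Fin n))} {σ2 : ℝ}
    (hσ : 0 ≤ σ2) (h : GaussianDominated μ σ2) {lam τ : ℝ} (hlam : 0 ≤ lam)
    (hsmall : 5 * lam ^ 2 * σ2 ^ 2 ≤ 1) :
    μ {z | τ ≤ |halfProd z - ∫ x, halfProd x ∂μ|} ≤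
      ENNReal.ofReal (2 * Real.exp (-(lam * τ) + 5 * lam ^ 2 * σ2 ^ 2 * n)) := by
  have hgauss := h.isGaussian
  have hcont : Continuous (halfProd (n := n)) := by unfold halfProd; fun_prop
  have hint : Integrable (halfProd (n := n)) μ := by
    have hL2 : ∀ s : Fin n ⊕ Fin n, MemLp
        (fun x : EuclideanSpace ℝ (Fin n ⊕ Fin n) => x s) 2 μ := fun s =>
      IsGaussian.memLp_dual μ (EuclideanSpace.proj s : StrongDual ℝ _) 2 (by simp)
    exact integrable_finsetSum _ fun t _ => (hL2 (Sum.inl t)).integrable_mul (hL2 (Sum.inr t))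
  set m := ∫ x, halfProd x ∂μ
  have hmgf : ∀ r : ℝ, r ^ 2 = lam ^ 2 →
      ∫⁻ z, ENNReal.ofReal (Real.exp (r * (halfProd z - m))) ∂μ ≤
        ENNReal.ofReal (Real.exp (5 * lam ^ 2 * σ2 ^ 2 * n)) := by
    intro r hr
    refine (lintegral_exp_center_le hcont.measurable hint r).trans ?_
    have hG : Continuous fun z : EuclideanSpace ℝ (Fin n ⊕ Fin n) => r • halfSwap z :=
      continuous_halfSwap.const_smul r
    refine (h.lintegral_exp_sub_le (F := fun z => r * halfProd z) hG fun z => ?_).trans ?_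
    · have := (hasFDerivAt_halfProd z).const_mul r
      refine this.congr_fderiv ?_
      ext w; simp
    · have ha : ∀ z : EuclideanSpace ℝ (Fin n ⊕ Fin n),
          Real.pi ^ 2 / 8 * σ2 * ‖r • halfSwap z‖ ^ 2 ≤ (5 / 4 * lam ^ 2 * σ2) * ‖z‖ ^ 2 := by
        intro z
        rw [norm_smul, mul_pow, Real.norm_eq_abs, sq_abs, norm_halfSwap_sq, hr]
        have hpi : Real.pi ^ 2 ≤ 10 := by nlinarith [Real.pi_lt_d2, Real.pi_pos]
        have : 0 ≤ σ2 * (lam ^ 2 * ‖z‖ ^ 2) := by positivity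
        nlinarith
      refine (lintegral_mono fun z => ENNReal.ofReal_le_ofReal (Real.exp_le_exp.2 (ha z))).trans ?_
      -- With `a = (5/4) lam² σ2` the requirement `a σ2 ≤ 1/4` is `hsmall`, and the `2n` coordinates
      -- give the exponent `5 lam² σ2² n`.
      refine (h.lintegral_exp_sq_le hσ (by positivity) (by nlinarith)).trans_eq ?_
      congr 2
      simp only [Fintype.card_sum, Fintype.card_fin]
      push_cast; ring
  have h1 := measure_ge_le_of_lintegral_exp (f := fun z => halfProd z - m) (τ := τ)
    (by fun_prop) hlam (hmgf lam rfl)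
  have h2 := measure_ge_le_of_lintegral_exp (f := fun z => -(halfProd z - m)) (τ := τ)
    (by fun_prop) hlam (by
      have := hmgf (-lam) (by ring)
      simpa only [neg_mul, mul_neg] using this)
  have h3 : {z : EuclideanSpace ℝ (Fin n ⊕ Fin n) | τ ≤ |halfProd z - m|} ⊆
      {z | τ ≤ halfProd z - m} ∪ {z | τ ≤ -(halfProd z - m)} := fun z hz => by
    have hz' : τ ≤ |halfProd z - m| := hz
    exact le_abs.1 hz'
  refine (measure_mono h3).trans ((measure_union_le _ _).trans ((add_le_add h1 h2).trans_eq ?_))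
  rw [← ENNReal.ofReal_add (Real.exp_pos _).le (Real.exp_pos _).le]
  congr 1; ring

end BilinearForm

section FourthPower

variable {n : ℕ}

/-- `n` plus the sum of the fourth powers of the coordinates. -/
def quarticSum (x : EuclideanSpace ℝ (Fin n)) : ℝ := n + ∑ t, x t ^ 4

lemma quarticSum_pos (hn : 0 < n) (x : EuclideanSpace ℝ (Fin n)) : 0 < quarticSum x := by
  have : (0 : ℝ) < n := by exact_mod_cast hn
  have h2 : 0 ≤ ∑ t, x t ^ 4 := Finset.sum_nonneg fun t _ => by positivity
  unfold quarticSum; linarith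

lemma continuous_quarticSum : Continuous (quarticSum (n := n)) := by
  unfold quarticSum; fun_prop

/-- The gradient of the fourth root of `quarticSum`. -/
def quarticGrad (x : EuclideanSpace ℝ (Fin n)) : EuclideanSpace ℝ (Fin n) :=
  WithLp.toLp 2 fun t => x t ^ 3 / (√(quarticSum x) * √√(quarticSum x))

/-- The summand `n` in `quarticSum` keeps the fourth root differentiable at the origin too. -/
lemma hasFDerivAt_sqrt_sqrt_quarticSum (hn : 0 < n) (x : EuclideanSpace ℝ (Fin n)) :
    HasFDerivAt (fun x : EuclideanSpace ℝ (Fin n) => √√(quarticSum x))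
      (innerSL ℝ (quarticGrad x)) x := by
  have hp : ∀ t : Fin n, HasFDerivAt (fun x : EuclideanSpace ℝ (Fin n) => x t)
      (EuclideanSpace.proj t : EuclideanSpace ℝ (Fin n) →L[ℝ] ℝ) x := fun t =>
    (EuclideanSpace.proj t : EuclideanSpace ℝ (Fin n) →L[ℝ] ℝ).hasFDerivAt
  have hD := quarticSum_pos hn x
  have hD2 : 0 < √(quarticSum x) := Real.sqrt_pos.2 hD
  have hD4 : 0 < √√(quarticSum x) := Real.sqrt_pos.2 hD2
  have h1 := (HasFDerivAt.fun_sum (u := Finset.univ) fun (t : Fin n) _ =>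
    (hp t).pow 4).const_add (n : ℝ)
  have h2 := (HasFDerivAt.sqrt (f := quarticSum) h1 hD.ne').sqrt hD2.ne'
  refine h2.congr_fderiv ?_
  ext w
  simp only [_root_.sum_apply, innerSL_apply_apply, PiLp.inner_apply, quarticGrad,
    _root_.smul_apply, smul_eq_mul, Finset.mul_sum]
  refine Finset.sum_congr rfl fun t _ => ?_
  simp
  field_simp
  ring

/-- This is the Lipschitz bound for an ℓ⁴ type norm with respect to ℓ². It follows from `x t ^ 6 ≤ x
t ^ 4 * √(quarticSum x)`. -/
lemma norm_quarticGrad_sq_le (hn : 0 < n) (x : EuclideanSpace ℝ (Fin n)) :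
    ‖quarticGrad x‖ ^ 2 ≤ 1 := by
  have hD := quarticSum_pos hn x
  have hD2 : 0 < √(quarticSum x) := Real.sqrt_pos.2 hD
  have hD4 : 0 < √√(quarticSum x) := Real.sqrt_pos.2 hD2
  rw [EuclideanSpace.real_norm_sq_eq]
  have h1 : ∀ t, (quarticGrad x t) ^ 2 ≤ x t ^ 4 / quarticSum x := by
    intro t
    simp only [quarticGrad]
    rw [div_pow, mul_pow, Real.sq_sqrt hD.le, Real.sq_sqrt hD2.le]
    have h2 : x t ^ 2 ≤ √(quarticSum x) := by
      refine Real.le_sqrt_of_sq_le ?_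
      have h3 : x t ^ 4 ≤ ∑ t, x t ^ 4 :=
        Finset.single_le_sum (f := fun t => x t ^ 4) (fun t _ => by positivity) (Finset.mem_univ t)
      have : (0 : ℝ) ≤ n := Nat.cast_nonneg n
      unfold quarticSum; nlinarith
    rw [div_le_div_iff₀ (by positivity) hD]
    calc (x t ^ 3) ^ 2 * quarticSum x = x t ^ 4 * quarticSum x * x t ^ 2 := by ring
      _ ≤ x t ^ 4 * quarticSum x * √(quarticSum x) := by gcongr
      _ = _ := by ring
  refine (Finset.sum_le_sum fun t _ => h1 t).trans ?_
  rw [← Finset.sum_div, div_le_one hD]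
  have : (0 : ℝ) ≤ n := Nat.cast_nonneg n
  unfold quarticSum; linarith

lemma pow_four_le_exp (x : ℝ) {σ : ℝ} (hσ : 0 < σ) :
    x ^ 4 ≤ 24 * σ ^ 4 * (Real.exp (σ⁻¹ * x) + Real.exp (-σ⁻¹ * x)) := by
  have h1 := Real.pow_div_factorial_le_exp |σ⁻¹ * x| (abs_nonneg _) 4
  have h2 : |σ⁻¹ * x| ^ 4 = (σ⁻¹ * x) ^ 4 := by
    rw [show (4 : ℕ) = 2 * 2 from rfl, pow_mul, sq_abs, ← pow_mul]
  have h3 : Real.exp |σ⁻¹ * x| ≤ Real.exp (σ⁻¹ * x) + Real.exp (-σ⁻¹ * x) := by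
    rw [neg_mul]
    rcases abs_choice (σ⁻¹ * x) with h | h <;> rw [h] <;> linarith [Real.exp_pos (σ⁻¹ * x),
      Real.exp_pos (-(σ⁻¹ * x))]
  rw [h2] at h1
  have h4 : (σ⁻¹ * x) ^ 4 ≤ 24 * (Real.exp (σ⁻¹ * x) + Real.exp (-σ⁻¹ * x)) := by
    have : ((Nat.factorial 4 : ℕ) : ℝ) = 24 := by norm_num [Nat.factorial]
    rw [this] at h1
    linarith
  calc x ^ 4 = σ ^ 4 * (σ⁻¹ * x) ^ 4 := by field_simp
    _ ≤ σ ^ 4 * (24 * (Real.exp (σ⁻¹ * x) + Real.exp (-σ⁻¹ * x))) := by gcongr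
    _ = _ := by ring

lemma GaussianDominated.lintegral_pow_four_le {μ : Measure (EuclideanSpace ℝ (Fin n))} {σ2 : ℝ}
    (hσ : 0 < σ2) (h : GaussianDominated μ σ2) (t : Fin n) :
    ∫⁻ x, ENNReal.ofReal (x t ^ 4) ∂μ ≤ ENNReal.ofReal (96 * σ2 ^ 2) := by
  set σ := √σ2
  have hσ0 : 0 < σ := Real.sqrt_pos.2 hσ
  have hσ2 : σ ^ 2 = σ2 := Real.sq_sqrt hσ.le
  have key : ∀ r : ℝ, r ^ 2 = σ2⁻¹ →
      ∫⁻ x, ENNReal.ofReal (Real.exp (r * x t)) ∂μ ≤ ENNReal.ofReal 2 := by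
    intro r hr
    have h1 := h.lintegral_exp_inner_le (EuclideanSpace.single t r)
    simp only [EuclideanSpace.inner_single_left, PiLp.norm_single, conj_trivial,
      Real.norm_eq_abs, sq_abs, hr, mul_inv_cancel₀ hσ.ne'] at h1
    refine h1.trans (ENNReal.ofReal_le_ofReal ?_)
    have h2 : Real.exp (1 / 2) ^ 2 ≤ 2 ^ 2 := by
      rw [← Real.exp_nat_mul]; norm_num; linarith [Real.exp_one_lt_d9]
    exact (pow_le_pow_iff_left₀ (Real.exp_pos _).le (by norm_num) two_ne_zero).1 h2
  calc ∫⁻ x, ENNReal.ofReal (x t ^ 4) ∂μ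
      ≤ ∫⁻ x, ENNReal.ofReal (24 * σ ^ 4) * (ENNReal.ofReal (Real.exp (σ⁻¹ * x t)) +
          ENNReal.ofReal (Real.exp (-σ⁻¹ * x t))) ∂μ := by
        refine lintegral_mono fun x => ?_
        rw [← ENNReal.ofReal_add (Real.exp_pos _).le (Real.exp_pos _).le,
          ← ENNReal.ofReal_mul (by positivity)]
        exact ENNReal.ofReal_le_ofReal (pow_four_le_exp _ hσ0)
    _ = ENNReal.ofReal (24 * σ ^ 4) * (∫⁻ x, ENNReal.ofReal (Real.exp (σ⁻¹ * x t)) ∂μ +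
          ∫⁻ x, ENNReal.ofReal (Real.exp (-σ⁻¹ * x t)) ∂μ) := by
        rw [lintegral_const_mul' _ _ ENNReal.ofReal_ne_top, lintegral_add_left (by fun_prop)]
    _ ≤ ENNReal.ofReal (24 * σ ^ 4) * (ENNReal.ofReal 2 + ENNReal.ofReal 2) := by
        gcongr
        · exact key _ (by rw [inv_pow, hσ2])
        · exact key _ (by rw [neg_sq, inv_pow, hσ2])
    _ = ENNReal.ofReal (96 * σ2 ^ 2) := by
        rw [← ENNReal.ofReal_add (by norm_num) (by norm_num), ← ENNReal.ofReal_mul (by positivity),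
          ← hσ2]
        congr 1; ring

/-- Upper tail of the sum of fourth powers of a dominated Gaussian vector. -/
lemma GaussianDominated.quartic_tail {μ : Measure (EuclideanSpace ℝ (Fin n))} {σ2 : ℝ}
    (hn : 0 < n) (hσ : 0 < σ2) (h : GaussianDominated μ σ2) {τ : ℝ} (hτ : 0 ≤ τ) :
    μ {x | 8 * ((1 + 192 * σ2 ^ 2) * n + τ ^ 4) ≤ ∑ t, x t ^ 4} ≤
      ENNReal.ofReal (2 * Real.exp (-(τ ^ 2 / (5 * σ2)))) := by
  have hgauss := h.isGaussian
  have hn' : (0 : ℝ) < n := by exact_mod_cast hn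
  -- The summand `n` of `quarticSum` plus twice the bound `96 σ2² n` for the mean; Markov's
  -- inequality then makes the fourth root of `D` an upper bound for a median of `F`.
  set D : ℝ := (1 + 192 * σ2 ^ 2) * n with hD
  have hD0 : 0 < D := by positivity
  set m := √√D with hm
  have hm4 : m ^ 4 = D := by
    rw [hm, show (4 : ℕ) = 2 * 2 from rfl, pow_mul, Real.sq_sqrt (Real.sqrt_nonneg _),
      Real.sq_sqrt hD0.le]
  set F : EuclideanSpace ℝ (Fin n) → ℝ := fun x => √√(quarticSum x) with hF
  have hFc : Continuous F := by
    have := continuous_quarticSum (n := n)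
    fun_prop
  have hF4 : ∀ x, F x ^ 4 = quarticSum x := fun x => by
    change √√(quarticSum x) ^ 4 = _
    rw [show (4 : ℕ) = 2 * 2 from rfl, pow_mul, Real.sq_sqrt (Real.sqrt_nonneg _),
      Real.sq_sqrt (quarticSum_pos hn x).le]
  -- at least half of the mass lies below the level `m`
  have hhalf : ENNReal.ofReal (1 / 2) ≤ μ {x | F x ≤ m} := by
    have h1 := mul_meas_ge_le_lintegral (μ := μ) (f := fun x : EuclideanSpace ℝ (Fin n) =>
      ENNReal.ofReal (∑ t, x t ^ 4)) (by fun_prop) (ENNReal.ofReal (192 * σ2 ^ 2 * n))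
    have h2 : ∫⁻ x : EuclideanSpace ℝ (Fin n), ENNReal.ofReal (∑ t, x t ^ 4) ∂μ ≤
        ENNReal.ofReal (96 * σ2 ^ 2 * n) := by
      have e1 : ∀ x : EuclideanSpace ℝ (Fin n), ENNReal.ofReal (∑ t, x t ^ 4) =
          ∑ t, ENNReal.ofReal (x t ^ 4) := fun x =>
        ENNReal.ofReal_sum_of_nonneg fun t _ => by positivity
      simp_rw [e1]
      rw [lintegral_finsetSum _ fun t _ => by fun_prop]
      refine (Finset.sum_le_sum fun t _ => h.lintegral_pow_four_le hσ t).trans_eq ?_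
      rw [Finset.sum_const, Finset.card_univ, Fintype.card_fin, nsmul_eq_mul, mul_comm,
        ← ENNReal.ofReal_natCast, ← ENNReal.ofReal_mul (by positivity)]
    set a := μ {x | ENNReal.ofReal (192 * σ2 ^ 2 * n) ≤
      ENNReal.ofReal (∑ t, (x : EuclideanSpace ℝ (Fin n)) t ^ 4)}
    have h3 : a ≤ ENNReal.ofReal (1 / 2) := by
      have h4 : ENNReal.ofReal (192 * σ2 ^ 2 * n) * a ≤
          ENNReal.ofReal (192 * σ2 ^ 2 * n) * ENNReal.ofReal (1 / 2) := by
        refine (h1.trans h2).trans_eq ?_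
        rw [← ENNReal.ofReal_mul (by positivity)]
        congr 1; ring
      exact (ENNReal.mul_le_mul_iff_right (by simp; positivity) (by simp)).1 h4
    have h5 : {x | F x ≤ m}ᶜ ⊆ {x | ENNReal.ofReal (192 * σ2 ^ 2 * n) ≤
        ENNReal.ofReal (∑ t, (x : EuclideanSpace ℝ (Fin n)) t ^ 4)} := by
      intro x hx
      simp only [Set.mem_compl_iff, Set.mem_ofPred_eq, not_le] at hx ⊢
      refine ENNReal.ofReal_le_ofReal ?_
      have h6 : m ^ 4 ≤ F x ^ 4 := pow_le_pow_left₀ (Real.sqrt_nonneg _) hx.le 4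
      rw [hm4, hF4, quarticSum] at h6
      linarith
    have h7 : μ {x | F x ≤ m}ᶜ ≤ ENNReal.ofReal (1 / 2) := (measure_mono h5).trans h3
    have hmeas : MeasurableSet {x | F x ≤ m} := measurableSet_le hFc.measurable measurable_const
    have h8 := prob_add_prob_compl (μ := μ) hmeas
    have h9 : (1 : ENNReal) = ENNReal.ofReal (1 / 2) + ENNReal.ofReal (1 / 2) := by
      rw [← ENNReal.ofReal_add (by norm_num) (by norm_num)]; norm_num
    have h10 : ENNReal.ofReal (1 / 2) + ENNReal.ofReal (1 / 2) ≤
        μ {x | F x ≤ m} + ENNReal.ofReal (1 / 2) := by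
      rw [← h9, ← h8]; gcongr
    exact (ENNReal.add_le_add_iff_right ENNReal.ofReal_ne_top).1 h10
  -- The minimizer of `-lam τ + (5/4) σ2 lam²`, with minimum `-τ² / (5 σ2)`.
  set lam := 2 * τ / (5 * σ2) with hlam
  have hlam0 : 0 ≤ lam := by positivity
  have hmp := h.lintegral_exp_sub_le (F := fun x => lam * F x)
    (G := fun x => lam • quarticGrad x) (by
      refine Continuous.const_smul ?_ lam
      unfold quarticGrad
      have := continuous_quarticSum (n := n)
      refine (PiLp.continuous_toLp 2 _).comp (continuous_pi fun t => ?_)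
      refine Continuous.div (by fun_prop) (by fun_prop) fun x => ?_
      have := quarticSum_pos hn x
      positivity)
    (fun x => by
      refine ((hasFDerivAt_sqrt_sqrt_quarticSum hn x).const_mul lam).congr_fderiv ?_
      ext w; simp)
  have hmp2 : ∫⁻ z, ENNReal.ofReal (Real.exp (lam * (F z.2 - F z.1))) ∂(μ.prod μ) ≤
      ENNReal.ofReal (Real.exp (5 / 4 * σ2 * lam ^ 2)) := by
    simp only [← mul_sub] at hmp
    refine hmp.trans ?_
    calc _ ≤ ∫⁻ _, ENNReal.ofReal (Real.exp (5 / 4 * σ2 * lam ^ 2)) ∂μ := by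
          refine lintegral_mono fun x => ENNReal.ofReal_le_ofReal (Real.exp_le_exp.2 ?_)
          rw [norm_smul, mul_pow, Real.norm_eq_abs, sq_abs]
          have hpi : Real.pi ^ 2 ≤ 10 := by nlinarith [Real.pi_lt_d2, Real.pi_pos]
          have := norm_quarticGrad_sq_le hn x
          calc _ ≤ 10 / 8 * σ2 * (lam ^ 2 * 1) := by gcongr
            _ = _ := by ring
      _ = _ := by simp
  have htail := measure_ge_le_of_lintegral_exp (f := fun z : _ × _ => F z.2 - F z.1) (τ := τ)
    (by fun_prop) hlam0 hmp2
  -- For two independent copies the first is below `m` with probability at least one half, so a tail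
  -- bound for the difference becomes a tail bound above `m`.
  have hsub : {x | F x ≤ m} ×ˢ {x | m + τ ≤ F x} ⊆ {z : _ × _ | τ ≤ F z.2 - F z.1} := by
    rintro ⟨a, b⟩ ⟨ha, hb⟩
    simp only [Set.mem_ofPred_eq] at ha hb ⊢
    linarith
  have h11 : ENNReal.ofReal (1 / 2) * μ {x | m + τ ≤ F x} ≤
      ENNReal.ofReal (Real.exp (-(τ ^ 2 / (5 * σ2)))) := by
    calc _ ≤ μ {x | F x ≤ m} * μ {x | m + τ ≤ F x} := by gcongr
      _ = (μ.prod μ) ({x | F x ≤ m} ×ˢ {x | m + τ ≤ F x}) := (Measure.prod_prod _ _).symm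
      _ ≤ _ := measure_mono hsub
      _ ≤ _ := htail
      _ = _ := by
        congr 2
        rw [hlam]; field_simp; ring
  have h12 : {x : EuclideanSpace ℝ (Fin n) | 8 * (D + τ ^ 4) ≤ ∑ t, x t ^ 4} ⊆
      {x | m + τ ≤ F x} := by
    intro x hx
    simp only [Set.mem_ofPred_eq] at hx ⊢
    have h13 : (m + τ) ^ 4 ≤ F x ^ 4 := by
      rw [hF4, quarticSum]
      have hm0 : 0 ≤ m := Real.sqrt_nonneg _
      have h14 : (m + τ) ^ 4 ≤ 8 * (m ^ 4 + τ ^ 4) := by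
        have := add_pow_le hm0 hτ 4
        norm_num at this
        linarith
      rw [hm4] at h14
      linarith
    exact (pow_le_pow_iff_left₀ (by positivity) (Real.sqrt_nonneg _) (by norm_num)).1 h13
  refine (measure_mono h12).trans ?_
  have h15 : ENNReal.ofReal (1 / 2) * μ {x | m + τ ≤ F x} ≤ ENNReal.ofReal (1 / 2) *
      ENNReal.ofReal (2 * Real.exp (-(τ ^ 2 / (5 * σ2)))) := by
    refine h11.trans_eq ?_
    rw [← ENNReal.ofReal_mul (by norm_num)]
    congr 1; ring
  exact (ENNReal.mul_le_mul_iff_right (by simp) (by simp)).1 h15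

end FourthPower

end Tails

/-! ### Regularity of the observed sample. -/

section Data

variable {Ω : Type*} [MeasurableSpace Ω] {P : Measure Ω}

/-- A finite family of random variables all of whose linear combinations are centered Gaussian with
variance at most `σ2` times the squared norm of the coefficients. -/
def DominatedFamily {ι : Type*} [Fintype ι] (P : Measure Ω) (G : ι → Ω → ℝ) (σ2 : ℝ) : Prop :=
  ∀ w : ι → ℝ, ∃ V : NNReal, (V : ℝ) ≤ σ2 * ∑ s, w s ^ 2 ∧
    HasLaw (fun ω => ∑ s, w s * G s ω) (gaussianReal 0 V) P

section Family

variable {ι : Type*} [Fintype ι] {G : ι → Ω → ℝ} {σ2 : ℝ}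

lemma DominatedFamily.hasLaw_single (h : DominatedFamily P G σ2) (s : ι) :
    ∃ V : NNReal, (V : ℝ) ≤ σ2 ∧ HasLaw (G s) (gaussianReal 0 V) P := by
  classical
  obtain ⟨V, hV, hlaw⟩ := h (Pi.single s 1)
  refine ⟨V, by simpa [Pi.single_apply] using hV, hlaw.congr (ae_of_all _ fun ω => ?_)⟩
  simp [Pi.single_apply]

lemma DominatedFamily.aemeasurable (h : DominatedFamily P G σ2) (s : ι) :
    AEMeasurable (G s) P := by
  obtain ⟨V, -, hlaw⟩ := h.hasLaw_single s
  exact hlaw.aemeasurable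

lemma DominatedFamily.aemeasurable_toLp (h : DominatedFamily P G σ2) :
    AEMeasurable (fun ω => (WithLp.toLp 2 fun s => G s ω : EuclideanSpace ℝ ι)) P :=
  (by fun_prop : Measurable (WithLp.toLp 2 : (ι → ℝ) → EuclideanSpace ℝ ι)).comp_aemeasurable
    (aemeasurable_pi_lambda _ h.aemeasurable)

lemma DominatedFamily.gaussianDominated (h : DominatedFamily P G σ2) :
    GaussianDominated (P.map fun ω => (WithLp.toLp 2 fun s => G s ω : EuclideanSpace ℝ ι)) σ2 := by
  intro w
  obtain ⟨V, hV, hlaw⟩ := h w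
  refine ⟨V, by rwa [EuclideanSpace.real_norm_sq_eq], ?_⟩
  rw [AEMeasurable.map_map_of_aemeasurable (by fun_prop) h.aemeasurable_toLp, ← hlaw.map_eq]
  congr 1
  ext ω
  simp only [Function.comp_apply, PiLp.inner_apply]
  exact Finset.sum_congr rfl fun s _ => by simp [mul_comm]

lemma DominatedFamily.abs_tail [IsProbabilityMeasure P] (hσ : 0 < σ2)
    (h : DominatedFamily P G σ2) (s : ι) {R : ℝ} (hR : 0 ≤ R) :
    P {ω | R ≤ |G s ω|} ≤ ENNReal.ofReal (2 * Real.exp (-(R ^ 2 / (2 * σ2)))) := by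
  obtain ⟨V, hV, hlaw⟩ := h.hasLaw_single s
  set lam := R / σ2
  have hlam : 0 ≤ lam := by positivity
  have hm : ∀ r : ℝ, r ^ 2 = lam ^ 2 →
      ∫⁻ ω, ENNReal.ofReal (Real.exp (r * G s ω)) ∂P ≤
        ENNReal.ofReal (Real.exp (σ2 * lam ^ 2 / 2)) := by
    intro r hr
    have h1 := lintegral_exp_mul_gaussianReal V r
    rw [← hlaw.map_eq, lintegral_map' (by fun_prop) hlaw.aemeasurable] at h1
    rw [h1, hr]
    gcongr
  have h1 := measure_ge_le_of_lintegral_exp (τ := R) hlaw.aemeasurable hlam (hm lam rfl)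
  have h2 := measure_ge_le_of_lintegral_exp (f := fun ω => -(G s ω)) (τ := R)
    hlaw.aemeasurable.neg hlam (by simpa only [neg_mul, mul_neg] using hm (-lam) (by ring))
  have h3 : {ω | R ≤ |G s ω|} ⊆ {ω | R ≤ G s ω} ∪ {ω | R ≤ -(G s ω)} := fun ω hω => by
    have hω' : R ≤ |G s ω| := hω
    exact le_abs.1 hω'
  refine (measure_mono h3).trans ((measure_union_le _ _).trans ((add_le_add h1 h2).trans_eq ?_))
  rw [← ENNReal.ofReal_add (Real.exp_pos _).le (Real.exp_pos _).le]
  have : -(lam * R) + σ2 * lam ^ 2 / 2 = -(R ^ 2 / (2 * σ2)) := by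
    simp only [lam]; field_simp; ring
  rw [this]
  congr 1; ring

end Family

variable {n : ℕ} {σ2 : ℝ}

lemma DominatedFamily.prod_tail [IsProbabilityMeasure P] (hσ : 0 ≤ σ2) {a b : Fin n → Ω → ℝ}
    (h : DominatedFamily P (Sum.elim a b) σ2) {lam τ : ℝ} (hlam : 0 ≤ lam)
    (hsmall : 5 * lam ^ 2 * σ2 ^ 2 ≤ 1) :
    P {ω | τ ≤ |∑ t, a t ω * b t ω - ∫ ω, ∑ t, a t ω * b t ω ∂P|} ≤
      ENNReal.ofReal (2 * Real.exp (-(lam * τ) + 5 * lam ^ 2 * σ2 ^ 2 * n)) := by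
  have h1 := h.gaussianDominated.halfProd_tail hσ (τ := τ) hlam hsmall
  have hc : Continuous (halfProd (n := n)) := by unfold halfProd; fun_prop
  rw [integral_map h.aemeasurable_toLp hc.aestronglyMeasurable,
    Measure.map_apply_of_aemeasurable h.aemeasurable_toLp
      (measurableSet_le measurable_const (by fun_prop))] at h1
  exact h1

lemma DominatedFamily.quartic_tail [IsProbabilityMeasure P] (hn : 0 < n) (hσ : 0 < σ2)
    {a : Fin n → Ω → ℝ} (h : DominatedFamily P a σ2) {τ : ℝ} (hτ : 0 ≤ τ) :
    P {ω | 8 * ((1 + 192 * σ2 ^ 2) * n + τ ^ 4) ≤ ∑ t, a t ω ^ 4} ≤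
      ENNReal.ofReal (2 * Real.exp (-(τ ^ 2 / (5 * σ2)))) := by
  have h1 := h.gaussianDominated.quartic_tail hn hσ hτ
  rwa [Measure.map_apply_of_aemeasurable h.aemeasurable_toLp
      (measurableSet_le measurable_const (by fun_prop))] at h1

variable {p : ℕ} {A S : Matrix (Fin p) (Fin p) ℝ}
  {y e : ℕ → Ω → EuclideanSpace ℝ (Fin p)} {c C : ℝ}

/-- The constant dominating the covariances of the process and of the noise. -/
def covBound (c C : ℝ) : ℝ := 2 * (2 * C / c + 2 * C)

lemma covBound_pos (hc : 0 < c) (hC : 0 < C) : 0 < covBound c C := by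
  unfold covBound; positivity

lemma IsStationaryVAR.hasLaw_sum_fin [IsProbabilityMeasure P] (hc : 0 < c) (hC : 0 ≤ C)
    (hst : StableVAR c C A S) (h : IsStationaryVAR P A S y e) (u w : Fin n → Fin p → ℝ) :
    ∃ V : NNReal, (V : ℝ) ≤ (2 * C / c + 2 * C) * ∑ t, (sqNorm2 (u t) + sqNorm2 (w t)) ∧
      HasLaw (fun ω => ∑ t : Fin n, (u t ⬝ᵥ y t ω + w t ⬝ᵥ e (t + 1) ω)) (gaussianReal 0 V) P := by
  obtain ⟨V, hV, hlaw⟩ := h.hasLaw_sum hc hC hst n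
    (fun t => if ht : t < n then u ⟨t, ht⟩ else 0) (fun t => if ht : t < n then w ⟨t, ht⟩ else 0)
  simp only [Finset.sum_range, Fin.is_lt, dite_true, Fin.eta] at hV hlaw
  exact ⟨V, hV, hlaw⟩

lemma sqNorm2_single (j : Fin p) (r : ℝ) : sqNorm2 (Pi.single j r : Fin p → ℝ) = r ^ 2 := by
  rw [sqNorm2, Finset.sum_eq_single j]
  · simp
  · intro b _ hb; simp [hb]
  · simp

/-- Both coefficients at time `t` multiply the same `y t` and add up when `j = k`; this accounts for
the factor two in `covBound`. -/
lemma IsStationaryVAR.dominated_pair [IsProbabilityMeasure P] (hc : 0 < c) (hC : 0 ≤ C)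
    (hst : StableVAR c C A S) (h : IsStationaryVAR P A S y e) (n : ℕ) (j k : Fin p) :
    DominatedFamily P (Sum.elim (fun (t : Fin n) ω => y t ω j) (fun (t : Fin n) ω => y t ω k))
      (covBound c C) := by
  intro w
  obtain ⟨V, hV, hlaw⟩ := h.hasLaw_sum_fin (n := n) hc hC hst
    (fun t => Pi.single j (w (Sum.inl t)) + Pi.single k (w (Sum.inr t))) 0
  refine ⟨V, hV.trans ?_, hlaw.congr (ae_of_all _ fun ω => ?_)⟩
  · have e1 : covBound c C * ∑ s, w s ^ 2 = (2 * C / c + 2 * C) * (2 * ∑ s, w s ^ 2) := by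
      unfold covBound; ring
    rw [e1]
    have h0 : 0 ≤ 2 * C / c + 2 * C := by positivity
    refine mul_le_mul_of_nonneg_left ?_ h0
    rw [Fintype.sum_sum_type, ← Finset.sum_add_distrib, Finset.mul_sum]
    refine Finset.sum_le_sum fun t _ => ?_
    have h1 := sqNorm2_add_le (Pi.single j (w (Sum.inl t)) : Fin p → ℝ)
      (Pi.single k (w (Sum.inr t)))
    rw [sqNorm2_single, sqNorm2_single] at h1
    have h2 : sqNorm2 ((0 : Fin n → Fin p → ℝ) t) = 0 := by simp [sqNorm2]
    rw [h2]; linarith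
  · simp only [Fintype.sum_sum_type, Sum.elim_inl, Sum.elim_inr, add_dotProduct,
      single_dotProduct, Pi.zero_apply, zero_dotProduct, add_zero, Finset.sum_add_distrib]

lemma IsStationaryVAR.dominated_noise_pair [IsProbabilityMeasure P] (hc : 0 < c) (hC : 0 ≤ C)
    (hst : StableVAR c C A S) (h : IsStationaryVAR P A S y e) (n : ℕ) (j i : Fin p) :
    DominatedFamily P (Sum.elim (fun (t : Fin n) ω => y t ω j)
      (fun (t : Fin n) ω => e (t + 1) ω i)) (covBound c C) := by
  intro w
  obtain ⟨V, hV, hlaw⟩ := h.hasLaw_sum_fin (n := n) hc hC hst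
    (fun t => Pi.single j (w (Sum.inl t))) (fun t => Pi.single i (w (Sum.inr t)))
  refine ⟨V, hV.trans ?_, hlaw.congr (ae_of_all _ fun ω => ?_)⟩
  · have e1 : covBound c C * ∑ s, w s ^ 2 = (2 * C / c + 2 * C) * (2 * ∑ s, w s ^ 2) := by
      unfold covBound; ring
    rw [e1]
    have h0 : 0 ≤ 2 * C / c + 2 * C := by positivity
    refine mul_le_mul_of_nonneg_left ?_ h0
    rw [Fintype.sum_sum_type, ← Finset.sum_add_distrib, Finset.mul_sum]
    refine Finset.sum_le_sum fun t _ => ?_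
    rw [sqNorm2_single, sqNorm2_single]
    nlinarith [sq_nonneg (w (Sum.inl t)), sq_nonneg (w (Sum.inr t))]
  · simp only [Fintype.sum_sum_type, Sum.elim_inl, Sum.elim_inr, single_dotProduct,
      Finset.sum_add_distrib]

lemma DominatedFamily.left {a b : Fin n → Ω → ℝ} (h : DominatedFamily P (Sum.elim a b) σ2) :
    DominatedFamily P a σ2 := fun w => by
  obtain ⟨V, hV, hlaw⟩ := h (Sum.elim w 0)
  exact ⟨V, by simpa [Fintype.sum_sum_type] using hV, by simpa [Fintype.sum_sum_type] using hlaw⟩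

lemma DominatedFamily.right {a b : Fin n → Ω → ℝ} (h : DominatedFamily P (Sum.elim a b) σ2) :
    DominatedFamily P b σ2 := fun w => by
  obtain ⟨V, hV, hlaw⟩ := h (Sum.elim 0 w)
  exact ⟨V, by simpa [Fintype.sum_sum_type] using hV, by simpa [Fintype.sum_sum_type] using hlaw⟩

lemma StableVAR.statVar_le (hc : 0 < c) (hC : 0 ≤ C) (hst : StableVAR c C A S) (v : Fin p → ℝ) :
    statVar A S v ≤ covBound c C * sqNorm2 v := by
  refine (hst.summable_statVar hc v).tsum_le_of_sum_range_le fun N => ?_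
  calc _ ≤ ∑ k ∈ Finset.range N, C * sqNorm2 ((A.transpose ^ k).mulVec v) :=
        Finset.sum_le_sum fun k _ => hst.quadForm_le _
    _ = C * ∑ k ∈ Finset.range N, sqNorm2 ((A.transpose ^ k).mulVec v) := by rw [Finset.mul_sum]
    _ ≤ C * (sqNorm2 v / c) := by gcongr; exact hst.sum_pow_le hc v N
    _ ≤ _ := by
        have := sqNorm2_nonneg v
        have h1 : 0 ≤ C / c * sqNorm2 v := by positivity
        have h2 : 0 ≤ C * sqNorm2 v := by positivity
        unfold covBound
        calc C * (sqNorm2 v / c) = C / c * sqNorm2 v := by ring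
          _ ≤ 4 * (C / c * sqNorm2 v) + 4 * (C * sqNorm2 v) := by linarith
          _ = _ := by ring

/-- The covariance matrix of the stationary law. -/
def statCov (P : Measure Ω) (y : ℕ → Ω → EuclideanSpace ℝ (Fin p)) (j k : Fin p) : ℝ :=
  ∫ ω, y 0 ω j * y 0 ω k ∂P

lemma IsStationaryVAR.memLp_coord [IsProbabilityMeasure P] (hc : 0 < c)
    (hst : StableVAR c C A S) (h : IsStationaryVAR P A S y e) (t : ℕ) (j : Fin p) :
    MemLp (fun ω => y t ω j) 2 P := by
  obtain ⟨V, hV⟩ := h.hasLaw_coord hc hst t j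
  exact_mod_cast memLp_of_hasLaw_gaussianReal hV 2

/-- Through this identity the two-sided bounds on `statVar` become eigenvalue bounds for the
population Gram matrix. -/
lemma IsStationaryVAR.sum_statCov [IsProbabilityMeasure P] (hc : 0 < c)
    (hst : StableVAR c C A S) (h : IsStationaryVAR P A S y e) (v : Fin p → ℝ) :
    ∑ j, ∑ k, v j * v k * statCov P y j k = statVar A S v := by
  have h1 := integral_sq_of_hasLaw_gaussianReal (h.hasLaw_dotProduct hc hst 0 v)
  rw [Real.coe_toNNReal _ (hst.statVar_nonneg hc v)] at h1
  rw [← h1]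
  have hi : ∀ j k, Integrable (fun ω => v j * v k * (y 0 ω j * y 0 ω k)) P := fun j k =>
    ((h.memLp_coord hc hst 0 j).integrable_mul (h.memLp_coord hc hst 0 k)).const_mul _
  have e1 : ∀ ω, (v ⬝ᵥ y 0 ω) ^ 2 = ∑ j, ∑ k, v j * v k * (y 0 ω j * y 0 ω k) := fun ω => by
    rw [sq, dotProduct, Finset.sum_mul_sum]
    exact Finset.sum_congr rfl fun j _ => Finset.sum_congr rfl fun k _ => by ring
  simp_rw [e1, statCov]
  rw [integral_finsetSum _ fun j _ => integrable_finsetSum _ fun k _ => hi j k]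
  refine Finset.sum_congr rfl fun j _ => ?_
  rw [integral_finsetSum _ fun k _ => hi j k]
  exact Finset.sum_congr rfl fun k _ => (integral_const_mul _ _).symm

lemma IsStationaryVAR.integral_gram [IsProbabilityMeasure P] (hc : 0 < c)
    (hst : StableVAR c C A S) (h : IsStationaryVAR P A S y e) (n : ℕ) (j k : Fin p) :
    ∫ ω, ∑ t : Fin n, y t ω j * y t ω k ∂P = n * statCov P y j k := by
  have hi : ∀ t : Fin n, Integrable (fun ω => y t ω j * y t ω k) P := fun t =>
    (h.memLp_coord hc hst t j).integrable_mul (h.memLp_coord hc hst t k)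
  rw [integral_finsetSum _ fun t _ => hi t]
  have h1 : ∀ t : Fin n, ∫ ω, y t ω j * y t ω k ∂P = statCov P y j k := fun t =>
    ((h.stationary t).comp (u := fun x : EuclideanSpace ℝ (Fin p) => x j * x k)
      (by fun_prop)).integral_eq
  simp [h1]

lemma IsStationaryVAR.integral_score [IsProbabilityMeasure P] (hc : 0 < c)
    (hst : StableVAR c C A S) (h : IsStationaryVAR P A S y e) (n : ℕ) (j i : Fin p) :
    ∫ ω, ∑ t : Fin n, y t ω j * e (t + 1) ω i ∂P = 0 := by
  have hL2e : ∀ t : Fin n, MemLp (fun ω => e (t + 1) ω i) 2 P := fun t => by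
    obtain ⟨V, hV⟩ := h.hasLaw_noise hst hc t i
    exact_mod_cast memLp_of_hasLaw_gaussianReal hV 2
  have hi : ∀ t : Fin n, Integrable (fun ω => y t ω j * e (t + 1) ω i) P := fun t =>
    (h.memLp_coord hc hst t j).integrable_mul (hL2e t)
  rw [integral_finsetSum _ fun t _ => hi t]
  exact Finset.sum_eq_zero fun t _ => h.integral_mul_noise_eq_zero hc hst t t le_rfl j i

/-- Deterministic regularity of a regression sample with regressors `X`, errors `ε` and population
Gram matrix `Γ`. -/
structure GoodSample (X : Matrix (Fin n) (Fin p) ℝ) (ε : Fin n → ℝ) (Γ : Fin p → Fin p → ℝ)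
    (τ M R : ℝ) : Prop where
  score : ∀ j, |∑ t, X t j * ε t| ≤ τ
  gram : ∀ j k, |∑ t, X t j * X t k - n * Γ j k| ≤ τ
  quartic : ∀ j, ∑ t, X t j ^ 4 ≤ M * n
  quartic_error : ∑ t, ε t ^ 4 ≤ M * n
  bound : ∀ t j, |X t j| ≤ R

/-- The constant in the deviation bounds for scores and Gram matrices. -/
def scoreConst (c C : ℝ) : ℝ := 5 * covBound c C ^ 2 + 3

/-- The constant in the bounds for sums of fourth powers. -/
def quarticConst (c C : ℝ) : ℝ := 8 * (1 + 292 * covBound c C ^ 2)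

/-- The innovations of the `i`-th equation. -/
def innovations (e : ℕ → Ω → EuclideanSpace ℝ (Fin p)) (i : Fin p) (n : ℕ) (ω : Ω) : Fin n → ℝ :=
  fun t => e (t + 1) ω i

/-- A stationary VAR sample is regular with high probability. -/
lemma IsStationaryVAR.goodSample [IsProbabilityMeasure P] (hc : 0 < c) (hC : 0 < C)
    (hst : StableVAR c C A S) (h : IsStationaryVAR P A S y e) (i : Fin p) (hn : 0 < n)
    (hL2 : Real.log p ^ 2 ≤ n) (hLn : 5 * (Real.log p / n) * covBound c C ^ 2 ≤ 1) :
    P {ω | ¬ GoodSample (design y n ω) (innovations e i n ω) (statCov P y)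
      (scoreConst c C * √(n * Real.log p)) (quarticConst c C)
      √(4 * covBound c C * (Real.log n + Real.log p))} ≤
      ENNReal.ofReal (10 * Real.exp (-Real.log p)) := by
  have hp : 0 < p := i.pos
  have hp' : (0 : ℝ) < p := by exact_mod_cast hp
  have hn' : (0 : ℝ) < n := by exact_mod_cast hn
  have hn1 : (1 : ℝ) ≤ n := by exact_mod_cast hn
  set σ2 := covBound c C
  have hσ : 0 < σ2 := covBound_pos hc hC
  set L := Real.log p with hL
  have hL0 : 0 ≤ L := Real.log_nonneg (by exact_mod_cast hp)
  have hexpL : Real.exp L = p := Real.exp_log hp'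
  have hlogn : 0 ≤ Real.log n := Real.log_nonneg hn1
  set τ := scoreConst c C * √(n * L) with hτ
  set R := √(4 * σ2 * (Real.log n + L)) with hR
  set lam := √(L / n) with hlam
  have hlam2 : lam ^ 2 = L / n := Real.sq_sqrt (by positivity)
  -- The term `5 σ2²` of `scoreConst` cancels the variance and `3` remains, so each event has
  -- probability at most `2 p⁻³` and a union over `p²` pairs is affordable.
  have hlamτ : -(lam * τ) + 5 * lam ^ 2 * σ2 ^ 2 * n = -(3 * L) := by
    have h1 : lam * √(n * L) = L := by
      rw [hlam, ← Real.sqrt_mul (by positivity), show L / n * (n * L) = L ^ 2 by field_simp,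
        Real.sqrt_sq hL0]
    have h2 : lam * τ = scoreConst c C * L := by rw [hτ, mul_left_comm, h1]
    rw [h2, hlam2, scoreConst]
    change -((5 * σ2 ^ 2 + 3) * L) + 5 * (L / n) * σ2 ^ 2 * n = -(3 * L)
    field_simp; ring
  have hsmall : 5 * lam ^ 2 * σ2 ^ 2 ≤ 1 := by rw [hlam2]; exact hLn
  have t1 : ∀ j, P {ω | τ ≤ |∑ t : Fin n, y t ω j * e (t + 1) ω i|} ≤
      ENNReal.ofReal (2 * Real.exp (-(3 * L))) := fun j => by
    have h1 := (h.dominated_noise_pair hc hC.le hst n j i).prod_tail hσ.le (τ := τ)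
      (Real.sqrt_nonneg _) hsmall
    rw [h.integral_score hc hst, hlamτ] at h1
    simpa only [sub_zero] using h1
  have t2 : ∀ j k, P {ω | τ ≤ |∑ t : Fin n, y t ω j * y t ω k - n * statCov P y j k|} ≤
      ENNReal.ofReal (2 * Real.exp (-(3 * L))) := fun j k => by
    have h1 := (h.dominated_pair hc hC.le hst n j k).prod_tail hσ.le (τ := τ)
      (Real.sqrt_nonneg _) hsmall
    rwa [h.integral_gram hc hst, hlamτ] at h1
  have hq : ∀ a : Fin n → Ω → ℝ, DominatedFamily P a σ2 →
      P {ω | quarticConst c C * n ≤ ∑ t, a t ω ^ 4} ≤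
        ENNReal.ofReal (2 * Real.exp (-(2 * L))) := by
    intro a ha
    -- This level gives the tail `2 p⁻²`. Its fourth power is `100 σ2² L² ≤ 100 σ2² n`, hence `292 =
    -- 192 + 100` in `quarticConst`.
    have h1 := ha.quartic_tail hn hσ (τ := √(10 * σ2 * L)) (Real.sqrt_nonneg _)
    have h2 : √(10 * σ2 * L) ^ 2 = 10 * σ2 * L := Real.sq_sqrt (by positivity)
    have h3 : √(10 * σ2 * L) ^ 4 ≤ 100 * σ2 ^ 2 * n := by
      calc √(10 * σ2 * L) ^ 4 = (√(10 * σ2 * L) ^ 2) ^ 2 := by ring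
        _ = 100 * σ2 ^ 2 * L ^ 2 := by rw [h2]; ring
        _ ≤ _ := by gcongr
    have h4 : 10 * σ2 * L / (5 * σ2) = 2 * L := by field_simp; ring
    rw [h2, h4] at h1
    refine (measure_mono fun ω hω => ?_).trans h1
    simp only [Set.mem_ofPred_eq] at hω ⊢
    refine le_trans ?_ hω
    change _ ≤ 8 * (1 + 292 * σ2 ^ 2) * n
    nlinarith
  have t5 : ∀ (t : Fin n) (j : Fin p), P {ω | R ≤ |y t ω j|} ≤
      ENNReal.ofReal (2 * Real.exp (-(2 * (Real.log n + L)))) := fun t j => by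
    have h1 := (h.dominated_pair hc hC.le hst n j j).left.abs_tail hσ t (Real.sqrt_nonneg _ : 0 ≤ R)
    have h2 : R ^ 2 / (2 * σ2) = 2 * (Real.log n + L) := by
      rw [hR, Real.sq_sqrt (by positivity)]; field_simp; ring
    rwa [h2] at h1
  have hsub : {ω | ¬ GoodSample (design y n ω) (innovations e i n ω) (statCov P y) τ
      (quarticConst c C) R} ⊆
      (⋃ j, {ω | τ ≤ |∑ t : Fin n, y t ω j * e (t + 1) ω i|}) ∪
      ((⋃ j, ⋃ k, {ω | τ ≤ |∑ t : Fin n, y t ω j * y t ω k - n * statCov P y j k|}) ∪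
      ((⋃ j, {ω | quarticConst c C * n ≤ ∑ t : Fin n, y t ω j ^ 4}) ∪
      ({ω | quarticConst c C * n ≤ ∑ t : Fin n, e (t + 1) ω i ^ 4} ∪
      (⋃ t : Fin n, ⋃ j, {ω | R ≤ |y t ω j|})))) := by
    intro ω hω
    by_contra hcon
    simp only [Set.mem_union, Set.mem_iUnion, Set.mem_ofPred_eq, not_or, not_exists,
      not_le] at hcon
    obtain ⟨h1, h2, h3, h4, h5⟩ := hcon
    exact hω ⟨fun j => (h1 j).le, fun j k => (h2 j k).le, fun j => (h3 j).le, h4.le,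
      fun t j => (h5 t j).le⟩
  have hunion : ∀ {κ : Type} [Fintype κ] (s : κ → Set Ω) (B : ℝ),
      (∀ k, P (s k) ≤ ENNReal.ofReal B) → P (⋃ k, s k) ≤ ENNReal.ofReal (Fintype.card κ * B) := by
    intro κ _ s B hs
    refine (measure_iUnion_fintype_le _ _).trans ((Finset.sum_le_sum fun k _ => hs k).trans_eq ?_)
    rw [Finset.sum_const, Finset.card_univ, nsmul_eq_mul, ENNReal.ofReal_mul (Nat.cast_nonneg _),
      ENNReal.ofReal_natCast]
  have hm : ∀ k : ℕ, Real.exp (-(k * L)) = ((p : ℝ) ^ k)⁻¹ := fun k => by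
    rw [Real.exp_neg, Real.exp_nat_mul, hexpL]
  have e3 : Real.exp (-(3 * L)) = ((p : ℝ) ^ 3)⁻¹ := by exact_mod_cast hm 3
  have e2 : Real.exp (-(2 * L)) = ((p : ℝ) ^ 2)⁻¹ := by exact_mod_cast hm 2
  have e1 : Real.exp (-L) = (p : ℝ)⁻¹ := by simpa using hm 1
  have e5 : Real.exp (-(2 * (Real.log n + L))) = ((p : ℝ) ^ 2)⁻¹ * ((n : ℝ) ^ 2)⁻¹ := by
    rw [mul_add, neg_add, Real.exp_add, e2, mul_comm]
    congr 1
    have : Real.exp (2 * Real.log n) = (n : ℝ) ^ 2 := by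
      have := Real.exp_nat_mul (Real.log n) 2
      rw [Real.exp_log hn'] at this; exact_mod_cast this
    rw [Real.exp_neg, this]
  have hp1 : (1 : ℝ) ≤ p := by exact_mod_cast hp
  have u1 := hunion _ _ t1
  have u2 := hunion _ _ fun j => hunion _ _ (t2 j)
  have u3 := hunion _ _ fun j => hq _ (h.dominated_pair hc hC.le hst n j j).left
  have u4 := hq _ (h.dominated_noise_pair hc hC.le hst n i i).right
  have u5 := hunion _ _ fun t => hunion _ _ (t5 t)
  refine (measure_mono hsub).trans ?_
  refine (measure_union_le _ _).trans ((add_le_add u1 ((measure_union_le _ _).trans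
    (add_le_add u2 ((measure_union_le _ _).trans (add_le_add u3
      ((measure_union_le _ _).trans (add_le_add u4 u5))))))).trans ?_)
  simp only [Fintype.card_fin, e1, e2, e3, e5]
  rw [← ENNReal.ofReal_add (by positivity) (by positivity),
    ← ENNReal.ofReal_add (by positivity) (by positivity),
    ← ENNReal.ofReal_add (by positivity) (by positivity),
    ← ENNReal.ofReal_add (by positivity) (by positivity)]
  refine ENNReal.ofReal_le_ofReal ?_
  have i1 : (p : ℝ) * (2 * ((p : ℝ) ^ 3)⁻¹) ≤ 2 * (p : ℝ)⁻¹ := by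
    have : ((p : ℝ) ^ 2)⁻¹ ≤ (p : ℝ)⁻¹ := inv_anti₀ hp' (by nlinarith)
    calc (p : ℝ) * (2 * ((p : ℝ) ^ 3)⁻¹) = 2 * ((p : ℝ) ^ 2)⁻¹ := by field_simp
      _ ≤ _ := by linarith
  have i2 : (p : ℝ) * (p * (2 * ((p : ℝ) ^ 3)⁻¹)) = 2 * (p : ℝ)⁻¹ := by field_simp
  have i3 : (p : ℝ) * (2 * ((p : ℝ) ^ 2)⁻¹) = 2 * (p : ℝ)⁻¹ := by field_simp
  have i4 : 2 * ((p : ℝ) ^ 2)⁻¹ ≤ 2 * (p : ℝ)⁻¹ := by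
    have : ((p : ℝ) ^ 2)⁻¹ ≤ (p : ℝ)⁻¹ := inv_anti₀ hp' (by nlinarith)
    linarith
  have i5 : (n : ℝ) * (p * (2 * (((p : ℝ) ^ 2)⁻¹ * ((n : ℝ) ^ 2)⁻¹))) ≤ 2 * (p : ℝ)⁻¹ := by
    have h1 : (n : ℝ)⁻¹ ≤ 1 := inv_le_one_of_one_le₀ hn1
    calc (n : ℝ) * (p * (2 * (((p : ℝ) ^ 2)⁻¹ * ((n : ℝ) ^ 2)⁻¹))) = 2 * (p : ℝ)⁻¹ * (n : ℝ)⁻¹ := by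
          field_simp
      _ ≤ 2 * (p : ℝ)⁻¹ * 1 := by gcongr
      _ = _ := mul_one _
  linarith

/-- The Gram matrix of a regular sample is close to the population Gram matrix. -/
lemma GoodSample.designBounds {X : Matrix (Fin n) (Fin p) ℝ} {ε : Fin n → ℝ}
    {Γ : Fin p → Fin p → ℝ} {τ M R κ φ : ℝ} (hn : 0 < n) (h : GoodSample X ε Γ τ M R)
    (hlow : ∀ v : Fin p → ℝ, κ * sqNorm2 v ≤ ∑ j, ∑ k, v j * v k * Γ j k)
    (hup : ∀ v : Fin p → ℝ, ∑ j, ∑ k, v j * v k * Γ j k ≤ φ * sqNorm2 v) :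
    DesignBounds X κ φ (τ / n) := by
  have hn' : (0 : ℝ) < n := by exact_mod_cast hn
  have key : ∀ v : Fin p → ℝ,
      |sqNorm2 (X.mulVec v) / n - ∑ j, ∑ k, v j * v k * Γ j k| ≤ τ / n * norm1 v ^ 2 := by
    intro v
    have e1 : sqNorm2 (X.mulVec v) = ∑ j, ∑ k, v j * v k * ∑ t, X t j * X t k := by
      have h1 : sqNorm2 (X.mulVec v) = ∑ t, (X.mulVec v) t * (X.mulVec v) t :=
        Finset.sum_congr rfl fun t _ => sq _
      rw [h1, sum_mul_mulVec]
      refine Finset.sum_congr rfl fun j _ => ?_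
      have h2 := sum_mul_mulVec X (fun t => X t j) v
      rw [h2, Finset.mul_sum]
      refine Finset.sum_congr rfl fun k _ => ?_
      rw [← mul_assoc]
      congr 1
      exact Finset.sum_congr rfl fun t _ => mul_comm _ _
    have e2 : sqNorm2 (X.mulVec v) / n - ∑ j, ∑ k, v j * v k * Γ j k =
        (∑ j, v j * ∑ k, v k * (∑ t, X t j * X t k - n * Γ j k)) / n := by
      rw [e1, eq_div_iff hn'.ne', sub_mul, div_mul_cancel₀ _ hn'.ne', Finset.sum_mul,
        ← Finset.sum_sub_distrib]
      refine Finset.sum_congr rfl fun j _ => ?_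
      rw [Finset.sum_mul, ← Finset.sum_sub_distrib, Finset.mul_sum]
      exact Finset.sum_congr rfl fun k _ => by ring
    rw [e2, abs_div, abs_of_pos hn', div_mul_eq_mul_div]
    gcongr
    -- Hölder's inequality in each index: the entrywise deviation is multiplied by `‖v‖₁²`.
    refine (sum_mul_le_norm1 v _ fun j => sum_mul_le_norm1 v _ (h.gram j)).trans_eq ?_
    ring
  refine ⟨fun v => ?_, fun v => ?_⟩
  · have := (abs_le.1 (key v)).1
    linarith [hlow v]
  · have := (abs_le.1 (key v)).2
    linarith [hup v]

end Data

/-! ### A maximal inequality under four moments. -/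

section Bernstein

variable {S : Type*}

/-- The function `g`, truncated where its envelope `H` exceeds `1 / lam`. -/
def truncate (lam : ℝ) (H g : S → ℝ) (s : S) : ℝ := {s | lam * H s ≤ 1}.indicator g s

lemma truncate_neg (lam : ℝ) (H g : S → ℝ) (s : S) :
    truncate lam H (-g) s = -truncate lam H g s := by
  unfold truncate
  by_cases hs : s ∈ {s | lam * H s ≤ 1} <;> simp [Set.indicator, hs]

/-- Where the truncation acts, `lam * H s > 1`, and three factors of it may be inserted for free.
Fourth moments of the envelope thus control both the bias and the discarded part. -/
lemma abs_truncate_sub_le {lam : ℝ} (hlam : 0 ≤ lam) {H g : S → ℝ} (hgH : ∀ s, |g s| ≤ H s)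
    (s : S) : |truncate lam H g s - g s| ≤ lam ^ 3 * H s ^ 4 := by
  have hH : 0 ≤ H s := (abs_nonneg _).trans (hgH s)
  by_cases hs : lam * H s ≤ 1
  · rw [truncate, Set.indicator_of_mem (by exact hs), sub_self, abs_zero]; positivity
  · rw [truncate, Set.indicator_of_notMem (by exact hs), zero_sub, abs_neg]
    refine (hgH s).trans ?_
    have h1 : 1 ≤ (lam * H s) ^ 3 := one_le_pow₀ (not_le.1 hs).le
    calc H s = 1 * H s := (one_mul _).symm
      _ ≤ (lam * H s) ^ 3 * H s := by gcongr
      _ = _ := by ring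

/-- After truncation the exponent lies in `[-1, 1]`, where `exp x ≤ 1 + x + x²`. In the linear term
the untruncated `g` is restored, so that its mean zero can be used. -/
lemma exp_truncate_le {lam : ℝ} (hlam : 0 ≤ lam) {H g : S → ℝ} (hgH : ∀ s, |g s| ≤ H s)
    (s : S) : Real.exp (lam * truncate lam H g s) ≤
      1 + lam * g s + lam ^ 4 * H s ^ 4 + lam ^ 2 * g s ^ 2 := by
  have h1 := abs_truncate_sub_le hlam hgH s
  have h2 : |lam * truncate lam H g s| ≤ 1 ∧ truncate lam H g s ^ 2 ≤ g s ^ 2 := by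
    by_cases hs : lam * H s ≤ 1
    · rw [truncate, Set.indicator_of_mem (by exact hs), abs_mul, abs_of_nonneg hlam]
      exact ⟨(mul_le_mul_of_nonneg_left (hgH s) hlam).trans hs, le_rfl⟩
    · rw [truncate, Set.indicator_of_notMem (by exact hs)]
      simp [sq_nonneg]
  have h3 := (abs_le.1 (Real.abs_exp_sub_one_sub_id_le h2.1)).2
  have h4 : lam * truncate lam H g s ≤ lam * g s + lam ^ 4 * H s ^ 4 := by
    have := mul_le_mul_of_nonneg_left ((le_abs_self _).trans h1) hlam
    linarith
  have h5 := mul_le_mul_of_nonneg_left h2.2 (sq_nonneg lam)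
  linarith

variable [MeasurableSpace S] {μ : Measure S}

lemma measurable_truncate {lam : ℝ} {H g : S → ℝ} (hH : Measurable H) (hg : Measurable g) :
    Measurable (truncate lam H g) :=
  hg.indicator (measurableSet_le (by fun_prop) measurable_const)

lemma integrable_of_pow_four [IsFiniteMeasure μ] {g H : S → ℝ} (hg : Measurable g)
    (hgH : ∀ s, |g s| ≤ H s) (hH : Integrable (fun s => H s ^ 4) μ) :
    Integrable g μ ∧ Integrable (fun s => g s ^ 2) μ := by
  have h0 : Integrable (fun s => 1 + H s ^ 4) μ := (integrable_const 1).add hH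
  refine ⟨h0.mono' hg.aestronglyMeasurable (ae_of_all _ fun s => ?_),
    h0.mono' (hg.pow_const 2).aestronglyMeasurable (ae_of_all _ fun s => ?_)⟩
  · refine (hgH s).trans ?_
    nlinarith [sq_nonneg (H s - 1), sq_nonneg (H s ^ 2 - 1)]
  · rw [Real.norm_of_nonneg (sq_nonneg _), ← sq_abs]
    have := pow_le_pow_left₀ (abs_nonneg _) (hgH s) 2
    nlinarith [sq_nonneg (H s ^ 2 - 1)]

lemma integral_exp_truncate_le [IsProbabilityMeasure μ] {lam : ℝ} (hlam : 0 ≤ lam) {H g : S → ℝ}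
    (hH : Measurable H) (hg : Measurable g) (hgH : ∀ s, |g s| ≤ H s)
    (hH4 : Integrable (fun s => H s ^ 4) μ) (hmean : ∫ s, g s ∂μ = 0) :
    Integrable (fun s => Real.exp (lam * truncate lam H g s)) μ ∧
      ∫ s, Real.exp (lam * truncate lam H g s) ∂μ ≤
        Real.exp (lam ^ 4 * ∫ s, H s ^ 4 ∂μ + lam ^ 2 * ∫ s, g s ^ 2 ∂μ) := by
  obtain ⟨hi1, hi2⟩ := integrable_of_pow_four hg hgH hH4
  have i1 : Integrable (fun s => 1 + lam * g s) μ := (integrable_const 1).add (hi1.const_mul lam)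
  have i2 : Integrable (fun s => 1 + lam * g s + lam ^ 4 * H s ^ 4) μ :=
    i1.add (hH4.const_mul _)
  have i3 : Integrable (fun s => 1 + lam * g s + lam ^ 4 * H s ^ 4 + lam ^ 2 * g s ^ 2) μ :=
    i2.add (hi2.const_mul _)
  have hm : Measurable fun s => Real.exp (lam * truncate lam H g s) :=
    Real.measurable_exp.comp ((measurable_truncate hH hg).const_mul lam)
  have i4 : Integrable (fun s => Real.exp (lam * truncate lam H g s)) μ :=
    i3.mono' hm.aestronglyMeasurable (ae_of_all _ fun s => by
      rw [Real.norm_of_nonneg (Real.exp_pos _).le]; exact exp_truncate_le hlam hgH s)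
  refine ⟨i4, (integral_mono i4 i3 fun s => exp_truncate_le hlam hgH s).trans ?_⟩
  rw [integral_add i2 (hi2.const_mul _), integral_add i1 (hH4.const_mul _),
    integral_add (integrable_const 1) (hi1.const_mul lam), integral_const_mul, integral_const_mul,
    integral_const_mul, hmean]
  have := Real.add_one_le_exp (lam ^ 4 * ∫ s, H s ^ 4 ∂μ + lam ^ 2 * ∫ s, g s ^ 2 ∂μ)
  simp only [integral_const, probReal_univ, smul_eq_mul]
  linarith

variable {Ω : Type*} [MeasurableSpace Ω] {P : Measure Ω} {n : ℕ} {M : Fin n → Ω → S}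

lemma truncated_sum_tail [IsProbabilityMeasure P] (hM : ∀ t, HasLaw (M t) μ P)
    (hind : iIndepFun M P) {H g : Fin n → S → ℝ} (hH : ∀ t, Measurable (H t))
    (hg : ∀ t, Measurable (g t)) (hgH : ∀ t s, |g t s| ≤ H t s)
    (hH4 : ∀ t, Integrable (fun s => H t s ^ 4) μ) (hmean : ∀ t, ∫ s, g t s ∂μ = 0)
    {lam V Q τ : ℝ} (hlam : 0 ≤ lam) (hV : ∑ t, ∫ s, g t s ^ 2 ∂μ ≤ V)
    (hQ : ∑ t, ∫ s, H t s ^ 4 ∂μ ≤ Q) :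
    P {ω | τ ≤ ∑ t, truncate lam (H t) (g t) (M t ω)} ≤
      ENNReal.ofReal (Real.exp (-(lam * τ) + (lam ^ 4 * Q + lam ^ 2 * V))) := by
  set X : Fin n → Ω → ℝ := fun t ω => truncate lam (H t) (g t) (M t ω)
  have hmt : ∀ t, Measurable (truncate lam (H t) (g t)) := fun t =>
    measurable_truncate (hH t) (hg t)
  have hX : ∀ t, AEMeasurable (X t) P := fun t => (hmt t).comp_aemeasurable (hM t).aemeasurable
  have hXind : iIndepFun X P := hind.comp _ hmt
  have hone : ∀ t, IsProbabilityMeasure μ := fun t =>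
    (hM t).isProbabilityMeasure_iff.1 inferInstance
  have hexp : ∀ t, Measurable fun s => Real.exp (lam * truncate lam (H t) (g t) s) := fun t =>
    Real.measurable_exp.comp ((hmt t).const_mul lam)
  have hsum : AEMeasurable (fun ω => ∑ t, X t ω) P := Finset.aemeasurable_fun_sum _ fun t _ => hX t
  have hint : ∀ t, Integrable (fun ω => Real.exp (lam * X t ω)) P := fun t => by
    have := hone t
    have h1 := (integral_exp_truncate_le hlam (hH t) (hg t) (hgH t) (hH4 t) (hmean t)).1
    rw [← (hM t).map_eq] at h1
    exact h1.comp_aemeasurable (hM t).aemeasurable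
  have hmgf : ∀ t, mgf (X t) P lam ≤
      Real.exp (lam ^ 4 * ∫ s, H t s ^ 4 ∂μ + lam ^ 2 * ∫ s, g t s ^ 2 ∂μ) := fun t => by
    have := hone t
    refine le_trans (le_of_eq ?_)
      (integral_exp_truncate_le hlam (hH t) (hg t) (hgH t) (hH4 t) (hmean t)).2
    exact (hM t).integral_comp (hexp t).aestronglyMeasurable
  have hfun : (fun ω => ∑ t, X t ω) = ∑ t, X t := by ext ω; simp
  have hprod : ∫ ω, Real.exp (lam * ∑ t, X t ω) ∂P = ∏ t, mgf (X t) P lam := by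
    rw [← hXind.mgf_sum₀ hX Finset.univ, ← hfun]; rfl
  have hbig : ∫ ω, Real.exp (lam * ∑ t, X t ω) ∂P ≤ Real.exp (lam ^ 4 * Q + lam ^ 2 * V) := by
    rw [hprod]
    refine (Finset.prod_le_prod (fun t _ => mgf_nonneg) fun t _ => hmgf t).trans ?_
    rw [← Real.exp_sum, Finset.sum_add_distrib, ← Finset.mul_sum, ← Finset.mul_sum]
    gcongr
  refine measure_ge_le_of_lintegral_exp hsum hlam ?_
  rw [← ofReal_integral_eq_lintegral_ofReal _ (ae_of_all _ fun _ => (Real.exp_pos _).le)]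
  · exact ENNReal.ofReal_le_ofReal hbig
  -- Integrability follows from the positive value of the integral, since an undefined integral is
  -- zero.
  · refine not_imp_comm.1 integral_undef (ne_of_gt ?_)
    rw [hprod]
    exact Finset.prod_pos fun t _ => mgf_pos (hint t)

/-- A maximal inequality of Bernstein type for independent variables with a common envelope which
has four moments. -/
lemma max_sum_tail [IsProbabilityMeasure P] (hM : ∀ t, HasLaw (M t) μ P)
    (hind : iIndepFun M P) {J : Type*} [Fintype J] {H : Fin n → S → ℝ} {g : J → Fin n → S → ℝ}
    (hH : ∀ t, Measurable (H t)) (hg : ∀ j t, Measurable (g j t))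
    (hgH : ∀ j t s, |g j t s| ≤ H t s) (hH4 : ∀ t, Integrable (fun s => H t s ^ 4) μ)
    (hmean : ∀ j t, ∫ s, g j t s ∂μ = 0) {lam V Q τ : ℝ} (hlam : 0 < lam) (hτ : 0 < τ)
    (hV : ∀ j, ∑ t, ∫ s, g j t s ^ 2 ∂μ ≤ V) (hQ : ∑ t, ∫ s, H t s ^ 4 ∂μ ≤ Q) :
    P {ω | ∃ j, τ < |∑ t, g j t (M t ω)|} ≤
      ENNReal.ofReal (2 * (lam ^ 4 * Q) / (lam * τ) +
        Fintype.card J * (2 * Real.exp (-(lam * τ) / 2 + lam ^ 4 * Q + lam ^ 2 * V))) := by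
  set B := Real.exp (-(lam * τ) / 2 + lam ^ 4 * Q + lam ^ 2 * V)
  have hQ0 : 0 ≤ Q :=
    le_trans (Finset.sum_nonneg fun t _ => integral_nonneg fun s => by positivity) hQ
  set T : Ω → ℝ := fun ω => ∑ t, H t (M t ω) ^ 4
  have hTi : ∀ t, Integrable (fun ω => H t (M t ω) ^ 4) P := fun t => by
    have h1 := hH4 t
    rw [← (hM t).map_eq] at h1
    exact h1.comp_aemeasurable (hM t).aemeasurable
  have hTint : Integrable T P := integrable_finsetSum _ fun t _ => hTi t
  have hTle : ∫ ω, T ω ∂P ≤ Q := by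
    refine le_trans (le_of_eq ?_) hQ
    rw [integral_finsetSum _ fun t _ => hTi t]
    exact Finset.sum_congr rfl fun t _ =>
      (hM t).integral_comp ((hH t).pow_const 4).aestronglyMeasurable
  have hT : P {ω | τ / (2 * lam ^ 3) ≤ T ω} ≤ ENNReal.ofReal (2 * (lam ^ 4 * Q) / (lam * τ)) := by
    have h1 := mul_meas_ge_le_integral_of_nonneg (μ := P) (f := T)
      (ae_of_all _ fun ω => Finset.sum_nonneg fun t _ => by positivity) hTint (τ / (2 * lam ^ 3))
    rw [← ofReal_measureReal]
    refine ENNReal.ofReal_le_ofReal ?_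
    have h2 : 2 * (lam ^ 4 * Q) / (lam * τ) = Q / (τ / (2 * lam ^ 3)) := by field_simp
    rw [h2, le_div_iff₀ (by positivity), mul_comm]
    exact h1.trans hTle
  have hneg : ∀ j, P {ω | τ / 2 ≤ ∑ t, truncate lam (H t) (-g j t) (M t ω)} ≤ ENNReal.ofReal B := by
    intro j
    refine (truncated_sum_tail hM hind hH (fun t => (hg j t).neg) (fun t s => ?_) hH4
      (fun t => ?_) hlam.le (V := V) (Q := Q) ?_ hQ).trans_eq ?_
    · simpa using hgH j t s
    · simp [integral_neg, hmean j t]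
    · simpa using hV j
    · congr 2; ring
  have hpos : ∀ j, P {ω | τ / 2 ≤ ∑ t, truncate lam (H t) (g j t) (M t ω)} ≤ ENNReal.ofReal B := by
    intro j
    refine (truncated_sum_tail hM hind hH (hg j) (hgH j) hH4 (hmean j) hlam.le (hV j)
      hQ).trans_eq ?_
    congr 2; ring
  -- The discarded part is at most `lam³ T` for all `j` simultaneously, because the envelope is
  -- common. Markov's inequality for `T` is therefore paid once, and only the exponential bounds are
  -- multiplied by the number of indices.
  have hsub : {ω | ∃ j, τ < |∑ t, g j t (M t ω)|} ⊆ {ω | τ / (2 * lam ^ 3) ≤ T ω} ∪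
      ⋃ j, ({ω | τ / 2 ≤ ∑ t, truncate lam (H t) (g j t) (M t ω)} ∪
        {ω | τ / 2 ≤ ∑ t, truncate lam (H t) (-g j t) (M t ω)}) := by
    rintro ω ⟨j, hj⟩
    by_contra hcon
    simp only [Set.mem_union, Set.mem_iUnion, Set.mem_ofPred_eq, not_or, not_exists,
      not_le] at hcon
    obtain ⟨h1, h2⟩ := hcon
    obtain ⟨h3, h4⟩ := h2 j
    simp only [truncate_neg, Finset.sum_neg_distrib] at h4
    have h5 : |∑ t, truncate lam (H t) (g j t) (M t ω) - ∑ t, g j t (M t ω)| ≤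
        lam ^ 3 * T ω := by
      rw [← Finset.sum_sub_distrib, Finset.mul_sum]
      exact (Finset.abs_sum_le_sum_abs _ _).trans
        (Finset.sum_le_sum fun t _ => abs_truncate_sub_le hlam.le (hgH j t) _)
    have h6 : lam ^ 3 * T ω < τ / 2 := by
      rw [lt_div_iff₀ (by positivity)] at h1
      linarith
    have h7 := abs_le.1 h5
    have h8 : |∑ t, g j t (M t ω)| < τ := abs_lt.2 ⟨by linarith, by linarith⟩
    exact lt_asymm hj h8
  have hpair : ∀ j, P ({ω | τ / 2 ≤ ∑ t, truncate lam (H t) (g j t) (M t ω)} ∪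
        {ω | τ / 2 ≤ ∑ t, truncate lam (H t) (-g j t) (M t ω)}) ≤ ENNReal.ofReal (2 * B) := by
    intro j
    refine (measure_union_le _ _).trans ((add_le_add (hpos j) (hneg j)).trans_eq ?_)
    rw [← ENNReal.ofReal_add (Real.exp_pos _).le (Real.exp_pos _).le, two_mul]
  refine (measure_mono hsub).trans ((measure_union_le _ _).trans ((add_le_add hT
    ((measure_iUnion_fintype_le _ _).trans (Finset.sum_le_sum fun j _ => hpair j))).trans_eq ?_))
  rw [Finset.sum_const, Finset.card_univ, nsmul_eq_mul, ← ENNReal.ofReal_natCast,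
    ← ENNReal.ofReal_mul (Nat.cast_nonneg _), ← ENNReal.ofReal_add (by positivity) (by positivity)]

end Bernstein

/-! ### The two bootstrap schemes in a common form. -/

section Resampling

variable {n : ℕ}

lemma sum_center (hn : 0 < n) (u : Fin n → ℝ) : ∑ t, center u t = 0 := by
  have hn' : (n : ℝ) ≠ 0 := by exact_mod_cast hn.ne'
  simp only [center, Finset.sum_sub_distrib, Finset.sum_const, Finset.card_univ, Fintype.card_fin,
    nsmul_eq_mul]
  rw [mul_div_cancel₀ _ hn', sub_self]

/-- Cauchy–Schwarz applied twice. -/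
lemma pow_four_average_le (hn : 0 < n) (u : Fin n → ℝ) :
    n * ((∑ t, u t) / n) ^ 4 ≤ ∑ t, u t ^ 4 := by
  have hn' : (0 : ℝ) < n := by exact_mod_cast hn
  have h1 := sq_sum_le_card_mul_sum_sq (s := Finset.univ) (f := u)
  have h2 := sq_sum_le_card_mul_sum_sq (s := Finset.univ) (f := fun t => u t ^ 2)
  simp only [Finset.card_univ, Fintype.card_fin, ← pow_mul] at h1 h2
  norm_num at h2
  have h3 : (∑ t, u t) ^ 4 ≤ n ^ 3 * ∑ t, u t ^ 4 := by
    calc (∑ t, u t) ^ 4 = ((∑ t, u t) ^ 2) ^ 2 := by ring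
      _ ≤ (n * ∑ t, u t ^ 2) ^ 2 := by gcongr
      _ = n ^ 2 * (∑ t, u t ^ 2) ^ 2 := by ring
      _ ≤ n ^ 2 * (n * ∑ t, u t ^ 4) := by gcongr
      _ = _ := by ring
  rw [div_pow, mul_div_assoc', div_le_iff₀ (by positivity)]
  calc n * (∑ t, u t) ^ 4 ≤ n * (n ^ 3 * ∑ t, u t ^ 4) := by gcongr
    _ = _ := by ring

lemma sum_center_pow_four_le (hn : 0 < n) (u : Fin n → ℝ) :
    ∑ t, center u t ^ 4 ≤ 16 * ∑ t, u t ^ 4 := by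
  have h1 := pow_four_average_le hn u
  set m := (∑ t, u t) / n with hm
  have h2 : ∀ t, center u t ^ 4 ≤ 8 * u t ^ 4 + 8 * m ^ 4 := fun t => by
    have e1 : center u t = u t - m := rfl
    rw [e1]
    have a1 : (u t - m) ^ 2 ≤ 2 * (u t ^ 2 + m ^ 2) := by nlinarith [sq_nonneg (u t + m)]
    calc (u t - m) ^ 4 = ((u t - m) ^ 2) ^ 2 := by ring
      _ ≤ (2 * (u t ^ 2 + m ^ 2)) ^ 2 := by gcongr
      _ ≤ _ := by nlinarith [sq_nonneg (u t ^ 2 - m ^ 2)]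
  refine (Finset.sum_le_sum fun t _ => h2 t).trans ?_
  rw [Finset.sum_add_distrib, ← Finset.mul_sum, Finset.sum_const, Finset.card_univ,
    Fintype.card_fin, nsmul_eq_mul]
  linarith

lemma abs_center_le (hn : 0 < n) {u : Fin n → ℝ} {R : ℝ} (hu : ∀ t, |u t| ≤ R) (t : Fin n) :
    |center u t| ≤ 2 * R := by
  have hn' : (0 : ℝ) < n := by exact_mod_cast hn
  have h1 : |(∑ t, u t) / n| ≤ R := by
    rw [abs_div, abs_of_pos hn', div_le_iff₀ hn']
    refine (Finset.abs_sum_le_sum_abs _ _).trans ((Finset.sum_le_sum fun t _ => hu t).trans ?_)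
    simp [mul_comm]
  unfold center
  have := abs_sub (u t) ((∑ t, u t) / n)
  linarith [hu t]

lemma center_sub (u v : Fin n → ℝ) : center (u - v) = center u - center v := by
  ext t
  simp only [center, Pi.sub_apply, Finset.sum_sub_distrib]
  ring

lemma center_sum_smul {p : ℕ} (d : Fin p → ℝ) (v : Fin p → Fin n → ℝ) :
    center (∑ k, d k • v k) = ∑ k, d k • center (v k) := by
  ext t
  simp only [center, Finset.sum_apply, Pi.smul_apply, smul_eq_mul, mul_sub, Finset.sum_sub_distrib]
  congr 1
  rw [Finset.sum_comm, Finset.sum_div]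
  exact Finset.sum_congr rfl fun k _ => by rw [← Finset.mul_sum, mul_div_assoc]

variable {S : Type*} [MeasurableSpace S]

/-- A resampling scheme turns a centered vector `u` into independent mean zero variables
`φ u t (M t)`, where the `M t` are i.i.d. with law `μ`. -/
structure ResamplingScheme (μ : Measure S) (φ : (Fin n → ℝ) →ₗ[ℝ] (Fin n → S → ℝ)) (m : ℝ) :
    Prop where
  measurable : ∀ t, Measurable fun q : (Fin n → ℝ) × S => φ q.1 t q.2
  mean : ∀ u, ∑ t, u t = 0 → ∀ t, ∫ s, φ u t s ∂μ = 0
  integrable_pow_four : ∀ u t, Integrable (fun s => φ u t s ^ 4) μ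
  pow_four : ∀ u, ∑ t, ∫ s, φ u t s ^ 4 ∂μ ≤ m * ∑ t, u t ^ 4
  sq : ∀ u, ∑ t, (∫ s, φ u t s ^ 2 ∂μ) ^ 2 ≤ ∑ t, u t ^ 4
  envelope : ∀ u B, (∀ t, |u t| ≤ B) → ∀ t s, |φ u t s| ≤ B * |φ 1 t s|

/-- Multiplication by independent multipliers. -/
def wildMap (n : ℕ) : (Fin n → ℝ) →ₗ[ℝ] (Fin n → ℝ → ℝ) where
  toFun u t w := w * u t
  map_add' u v := by ext t w; simp [mul_add]
  map_smul' r u := by ext t w; simp [mul_left_comm]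

/-- Drawing from the entries of a vector. -/
def drawMap (n : ℕ) : (Fin n → ℝ) →ₗ[ℝ] (Fin n → Fin n → ℝ) where
  toFun u _ s := u s
  map_add' _ _ := rfl
  map_smul' _ _ := rfl

/-- Here the mean vanishes for every `u`, centered or not, and unit variance makes the `sq` bound an
equality. -/
lemma IsMultiplierLaw.resamplingScheme {ν : Measure ℝ} (h : IsMultiplierLaw ν) :
    ResamplingScheme ν (wildMap n) (∫ w, w ^ 4 ∂ν) where
  measurable t := by
    change Measurable fun q : (Fin n → ℝ) × ℝ => q.2 * q.1 t
    fun_prop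
  mean u _ t := by
    change ∫ w, w * u t ∂ν = 0
    rw [integral_mul_const, h.mean, zero_mul]
  integrable_pow_four u t := by
    change Integrable (fun w => (w * u t) ^ 4) ν
    simp_rw [mul_pow]
    exact h.fourth_moment.mul_const _
  pow_four u := by
    change ∑ t, ∫ w, (w * u t) ^ 4 ∂ν ≤ _
    simp_rw [mul_pow, integral_mul_const]
    rw [← Finset.mul_sum]
  sq u := by
    change ∑ t, (∫ w, (w * u t) ^ 2 ∂ν) ^ 2 ≤ _
    simp_rw [mul_pow, integral_mul_const, h.variance]
    exact Finset.sum_le_sum fun t _ => by ring_nf; rfl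
  envelope u B hu t w := by
    change |w * u t| ≤ B * |w * 1|
    rw [mul_one, abs_mul, mul_comm]
    exact mul_le_mul_of_nonneg_right (hu t) (abs_nonneg _)

lemma integral_uniformOn_univ (hn : 0 < n) (f : Fin n → ℝ) :
    ∫ s, f s ∂(uniformOn Set.univ : Measure (Fin n)) = (∑ s, f s) / n := by
  have : Nonempty (Fin n) := ⟨⟨0, hn⟩⟩
  have : IsProbabilityMeasure (uniformOn Set.univ : Measure (Fin n)) :=
    isProbabilityMeasure_uniformOn Set.finite_univ Set.univ_nonempty
  rw [integral_fintype Integrable.of_finite, Finset.sum_div]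
  refine Finset.sum_congr rfl fun s _ => ?_
  rw [measureReal_def, uniformOn_univ]
  simp
  ring

/-- Each draw integrates to an average over the sample: centering gives mean zero, and `sq` is
Cauchy–Schwarz for the average of the squares. -/
lemma resamplingScheme_draw (hn : 0 < n) :
    ResamplingScheme (uniformOn Set.univ : Measure (Fin n)) (drawMap n) 1 where
  measurable t := by
    change Measurable fun q : (Fin n → ℝ) × Fin n => q.1 q.2
    exact measurable_from_prod_countable_left fun s => measurable_pi_apply s
  mean u hu t := by
    change ∫ s, u s ∂_ = 0
    rw [integral_uniformOn_univ hn, hu, zero_div]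
  integrable_pow_four u t := by
    have : IsProbabilityMeasure (uniformOn Set.univ : Measure (Fin n)) :=
      isProbabilityMeasure_uniformOn Set.finite_univ ⟨⟨0, hn⟩, trivial⟩
    exact Integrable.of_finite
  pow_four u := by
    have hn' : (n : ℝ) ≠ 0 := by exact_mod_cast hn.ne'
    change ∑ t : Fin n, ∫ s, u s ^ 4 ∂_ ≤ _
    rw [integral_uniformOn_univ hn, Finset.sum_const, Finset.card_univ, Fintype.card_fin,
      nsmul_eq_mul, mul_div_cancel₀ _ hn', one_mul]
  sq u := by
    have hn' : (0 : ℝ) < n := by exact_mod_cast hn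
    change ∑ t : Fin n, (∫ s, u s ^ 2 ∂_) ^ 2 ≤ _
    rw [integral_uniformOn_univ hn, Finset.sum_const, Finset.card_univ, Fintype.card_fin,
      nsmul_eq_mul, div_pow, mul_div_assoc', div_le_iff₀ (by positivity)]
    have h2 := sq_sum_le_card_mul_sum_sq (s := Finset.univ) (f := fun t => u t ^ 2)
    simp only [Finset.card_univ, Fintype.card_fin, ← pow_mul] at h2
    norm_num at h2
    nlinarith
  envelope u B hu t s := by
    change |u s| ≤ B * |1|
    simpa using hu s

end Resampling

/-! ### Bootstrap scores for fixed data. -/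

section Conditional

variable {n p : ℕ} {S : Type*} [MeasurableSpace S] {μ : Measure S}
  {φ : (Fin n → ℝ) →ₗ[ℝ] (Fin n → S → ℝ)} {m : ℝ}
  {Ω : Type*} [MeasurableSpace Ω] {P : Measure Ω}

/-- Moment and boundedness conditions on regressors and errors which suffice for resampling. -/
structure ModerateSample (X : Matrix (Fin n) (Fin p) ℝ) (ε : Fin n → ℝ) (M R : ℝ) : Prop where
  quartic : ∀ j, ∑ t, X t j ^ 4 ≤ M * n
  quartic_error : ∑ t, ε t ^ 4 ≤ M * n
  bound : ∀ t j, |X t j| ≤ R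

lemma GoodSample.moderate {X : Matrix (Fin n) (Fin p) ℝ} {ε : Fin n → ℝ}
    {Γ : Fin p → Fin p → ℝ} {τ M R : ℝ} (h : GoodSample X ε Γ τ M R) : ModerateSample X ε M R :=
  ⟨h.quartic, h.quartic_error, h.bound⟩

/-- The scores of the resampled errors and of the resampled regressors. -/
structure GoodResample (φ : (Fin n → ℝ) →ₗ[ℝ] (Fin n → S → ℝ)) (X : Matrix (Fin n) (Fin p) ℝ)
    (ε : Fin n → ℝ) (τ₁ τ₂ : ℝ) (w : Fin n → S) : Prop where
  score : ∀ j, |∑ t, X t j * φ (center ε) t (w t)| ≤ τ₁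
  gram : ∀ j k, |∑ t, X t j * φ (center fun t => X t k) t (w t)| ≤ τ₂

lemma ResamplingScheme.measurable_apply (h : ResamplingScheme μ φ m) (u : Fin n → ℝ) (t : Fin n) :
    Measurable (φ u t) :=
  (h.measurable t).comp (measurable_const.prodMk measurable_id)

/-- Cauchy–Schwarz in `t` separates the regressor from the resampled vector. Fourth powers of each
then suffice and no maximum enters the variance; the `16` is the cost of centering. -/
lemma ResamplingScheme.sum_second_moment_le (h : ResamplingScheme μ φ m) {a u : Fin n → ℝ} {B : ℝ}
    (hB : 0 ≤ B) (ha : ∑ t, a t ^ 4 ≤ B) (hu : ∑ t, u t ^ 4 ≤ 16 * B) :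
    ∑ t, ∫ s, (a t * φ u t s) ^ 2 ∂μ ≤ 4 * B := by
  simp_rw [mul_pow, integral_const_mul]
  refine abs_le_of_sq_le_sq' ?_ (by positivity) |>.2
  refine (Finset.sum_mul_sq_le_sq_mul_sq _ _ _).trans ?_
  calc (∑ t, (a t ^ 2) ^ 2) * ∑ t, (∫ s, φ u t s ^ 2 ∂μ) ^ 2 ≤ B * (16 * B) := by
        refine mul_le_mul ?_ ((h.sq u).trans hu) (Finset.sum_nonneg fun t _ => sq_nonneg _) hB
        refine le_trans (le_of_eq ?_) ha
        exact Finset.sum_congr rfl fun t _ => by ring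
    _ = (4 * B) ^ 2 := by ring

/-- The constant in the bound for the resampled scores, given a bound for fourth moments. -/
def resampleConst (M : ℝ) : ℝ := 8 * M + 6

lemma ResamplingScheme.goodResample [IsProbabilityMeasure P] (h : ResamplingScheme μ φ m)
    {W : Fin n → Ω → S} (hW : ∀ t, HasLaw (W t) μ P) (hind : iIndepFun W P)
    {X : Matrix (Fin n) (Fin p) ℝ} {ε : Fin n → ℝ} {M R θ : ℝ} (hM : 0 ≤ M) (hm : 0 ≤ m)
    (hR : 0 ≤ R) (hX : ModerateSample X ε M R) (hn : 0 < n) (hp : 1 < p) (hθ1 : θ ≤ 1)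
    (hθ2 : 16 * m * M * R ^ 4 * Real.log p ≤ θ * n)
    (hθ3 : 65536 * m * R ^ 8 ≤ θ * (n * Real.log p)) :
    P {ω | ¬ GoodResample φ X ε (resampleConst M * √(n * Real.log p)) (√n * Real.log p)
      fun t => W t ω} ≤ ENNReal.ofReal (θ + 4 * Real.exp (256 * M) / p) := by
  have hn' : (0 : ℝ) < n := by exact_mod_cast hn
  have hp' : (0 : ℝ) < p := by exact_mod_cast hp.trans' one_pos
  set L := Real.log p with hL
  have hL0 : 0 < L := Real.log_pos (by exact_mod_cast hp)
  have hexpL : Real.exp L = p := Real.exp_log hp'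
  have hθ0 : 0 ≤ θ := by
    have : 0 ≤ θ * n := le_trans (by positivity) hθ2
    exact nonneg_of_mul_nonneg_left this hn'
  have hMn : 0 ≤ M * n := by positivity
  have hcε : ∑ t, center ε t ^ 4 ≤ 16 * (M * n) :=
    (sum_center_pow_four_le hn ε).trans (by linarith [hX.quartic_error])
  have hcx : ∀ k, ∑ t, center (fun t => X t k) t ^ 4 ≤ 16 * (M * n) := fun k =>
    (sum_center_pow_four_le hn _).trans (by linarith [hX.quartic k])
  have hone : ∑ t : Fin n, (1 : Fin n → ℝ) t ^ 4 = n := by simp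
  -- scores of the errors
  set l1 := √(L / n) with hl1
  have hl1pos : 0 < l1 := Real.sqrt_pos.2 (by positivity)
  have hl1sq : l1 ^ 2 = L / n := Real.sq_sqrt (by positivity)
  have hl1τ : l1 * (resampleConst M * √(n * L)) = resampleConst M * L := by
    rw [mul_left_comm, hl1, ← Real.sqrt_mul (by positivity),
      show L / n * (n * L) = L ^ 2 by field_simp, Real.sqrt_sq hL0.le]
  have hK : 0 < resampleConst M := by unfold resampleConst; positivity
  have b1 := max_sum_tail hW hind (J := Fin p) (H := fun t s => R * |φ (center ε) t s|)
    (g := fun j t s => X t j * φ (center ε) t s)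
    (fun t => (h.measurable_apply _ t).abs.const_mul R)
    (fun j t => (h.measurable_apply _ t).const_mul _)
    (fun j t s => by
      rw [abs_mul]; exact mul_le_mul_of_nonneg_right (hX.bound t j) (abs_nonneg _))
    (fun t => by
      simp_rw [mul_pow, Even.pow_abs (show Even 4 by decide)]
      exact (h.integrable_pow_four _ t).const_mul _)
    (fun j t => by rw [integral_const_mul, h.mean _ (sum_center hn ε), mul_zero])
    (lam := l1) (τ := resampleConst M * √(n * L)) (V := 4 * (M * n))
    (Q := R ^ 4 * (m * (16 * (M * n)))) hl1pos (by positivity)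
    (fun j => h.sum_second_moment_le hMn (hX.quartic j) hcε)
    (by
      simp_rw [mul_pow, Even.pow_abs (show Even 4 by decide), integral_const_mul]
      rw [← Finset.mul_sum]
      gcongr
      exact (h.pow_four _).trans (by gcongr))
  -- The fourth moment term is of order `R⁴ L² / n`. As `R²` is of order `log n + log p`, this is
  -- where `(log p)³ = o(n)` is needed.
  have q1 : l1 ^ 4 * (R ^ 4 * (m * (16 * (M * n)))) ≤ θ * L := by
    have e1 : l1 ^ 4 * (R ^ 4 * (m * (16 * (M * n)))) = 16 * m * M * R ^ 4 * L * (L / n) := by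
      rw [show l1 ^ 4 = (l1 ^ 2) ^ 2 by ring, hl1sq]; field_simp
    rw [e1]
    calc 16 * m * M * R ^ 4 * L * (L / n) ≤ θ * n * (L / n) := by gcongr
      _ = _ := by field_simp
  have v1 : l1 ^ 2 * (4 * (M * n)) = 4 * M * L := by rw [hl1sq]; field_simp
  -- scores of the regressors
  set l2 := 8 / √(n : ℝ) with hl2
  have hsn : 0 < √(n : ℝ) := Real.sqrt_pos.2 hn'
  have hl2pos : 0 < l2 := by positivity
  have hl2sq : l2 ^ 2 = 64 / n := by
    rw [hl2, div_pow, Real.sq_sqrt hn'.le]; norm_num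
  have hl2τ : l2 * (√n * L) = 8 * L := by rw [hl2]; field_simp
  have b2 := max_sum_tail hW hind (J := Fin p × Fin p)
    -- The envelope must not depend on the regressor being resampled, so it is expressed through the
    -- image of the constant vector.
    (H := fun t s => R * (2 * R * |φ 1 t s|))
    (g := fun j t s => X t j.1 * φ (center fun t => X t j.2) t s)
    (fun t => ((h.measurable_apply _ t).abs.const_mul _).const_mul R)
    (fun j t => (h.measurable_apply _ t).const_mul _)
    (fun j t s => by
      rw [abs_mul]
      exact mul_le_mul (hX.bound t j.1)
        (h.envelope _ _ (abs_center_le hn fun t => hX.bound t j.2) t s) (abs_nonneg _) hR)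
    (fun t => by
      simp_rw [mul_pow, Even.pow_abs (show Even 4 by decide)]
      exact ((h.integrable_pow_four _ t).const_mul _).const_mul _)
    (fun j t => by rw [integral_const_mul, h.mean _ (sum_center hn _), mul_zero])
    (lam := l2) (τ := √n * L) (V := 4 * (M * n))
    (Q := R ^ 4 * ((2 * R) ^ 4 * (m * n))) hl2pos (by positivity)
    (fun j => h.sum_second_moment_le hMn (hX.quartic j.1) (hcx j.2))
    (by
      simp_rw [mul_pow _ _ 4, Even.pow_abs (show Even 4 by decide), integral_const_mul]
      rw [← Finset.mul_sum, ← Finset.mul_sum]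
      gcongr
      exact (h.pow_four 1).trans (by rw [hone]))
  -- The larger level `√n L` permits `l2` of order `1 / √n` instead of `√(L / n)`. The condition is
  -- then `R⁸ ≲ n L`, again `(log p)³ = o(n)` up to `log n`, rather than a higher power of `log p`.
  have q2 : l2 ^ 4 * (R ^ 4 * ((2 * R) ^ 4 * (m * n))) ≤ θ * L := by
    have e1 : l2 ^ 4 * (R ^ 4 * ((2 * R) ^ 4 * (m * n))) = 65536 * m * R ^ 8 / n := by
      rw [show l2 ^ 4 = (l2 ^ 2) ^ 2 by ring, hl2sq]; field_simp; ring
    rw [e1, div_le_iff₀ hn']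
    linarith
  have v2 : l2 ^ 2 * (4 * (M * n)) = 256 * M := by rw [hl2sq]; field_simp; ring
  have hsub : {ω | ¬ GoodResample φ X ε (resampleConst M * √(n * L)) (√n * L) fun t => W t ω} ⊆
      {ω | ∃ j, resampleConst M * √(n * L) < |∑ t, X t j * φ (center ε) t (W t ω)|} ∪
      {ω | ∃ j : Fin p × Fin p, √n * L <
        |∑ t, X t j.1 * φ (center fun t => X t j.2) t (W t ω)|} := by
    intro ω hω
    by_contra hcon
    simp only [Set.mem_union, Set.mem_ofPred_eq, not_or, not_exists, not_lt, Prod.forall] at hcon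
    exact hω ⟨hcon.1, hcon.2⟩
  refine (measure_mono hsub).trans ((measure_union_le _ _).trans ((add_le_add b1 b2).trans ?_))
  rw [← ENNReal.ofReal_add (by positivity) (by positivity)]
  refine ENNReal.ofReal_le_ofReal ?_
  rw [hl1τ, hl2τ, v1, v2, Fintype.card_prod, Fintype.card_fin]
  have hm2 : Real.exp (-2 * L) = ((p : ℝ) ^ 2)⁻¹ := by
    rw [← hexpL, ← Real.exp_nat_mul, ← Real.exp_neg]; push_cast; ring_nf
  have hm3 : Real.exp (-3 * L) = ((p : ℝ) ^ 3)⁻¹ := by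
    rw [← hexpL, ← Real.exp_nat_mul, ← Real.exp_neg]; push_cast; ring_nf
  have t1 : 2 * (l1 ^ 4 * (R ^ 4 * (m * (16 * (M * n))))) / (resampleConst M * L) ≤ θ / 3 := by
    rw [div_le_iff₀ (by positivity)]
    have : 6 * (θ * L) ≤ resampleConst M * (θ * L) := by
      refine mul_le_mul_of_nonneg_right ?_ (by positivity)
      unfold resampleConst; linarith
    linarith
  have t2 : 2 * (l2 ^ 4 * (R ^ 4 * ((2 * R) ^ 4 * (m * n)))) / (8 * L) ≤ θ / 4 := by
    rw [div_le_iff₀ (by positivity)]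
    linarith
  have hθL : θ * L ≤ L := by nlinarith
  have x1 : Real.exp (-(resampleConst M * L) / 2 + l1 ^ 4 * (R ^ 4 * (m * (16 * (M * n)))) +
      -- Half of `resampleConst` is `4 M + 3`: the `4 M` cancels the variance, and `θ ≤ 1` uses one
      -- of the remaining three units.
      4 * M * L) ≤ ((p : ℝ) ^ 2)⁻¹ := by
    rw [← hm2]
    refine Real.exp_le_exp.2 ?_
    unfold resampleConst; linarith
  have x2 : Real.exp (-(8 * L) / 2 + l2 ^ 4 * (R ^ 4 * ((2 * R) ^ 4 * (m * n))) +
      256 * M) ≤ ((p : ℝ) ^ 3)⁻¹ * Real.exp (256 * M) := by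
    rw [← hm3, ← Real.exp_add]
    refine Real.exp_le_exp.2 ?_
    linarith
  have hE : 1 ≤ Real.exp (256 * M) := Real.one_le_exp (by positivity)
  have y1 : (p : ℝ) * (2 * ((p : ℝ) ^ 2)⁻¹) ≤ 2 * Real.exp (256 * M) / p := by
    calc (p : ℝ) * (2 * ((p : ℝ) ^ 2)⁻¹) = 2 * 1 / p := by field_simp
      _ ≤ _ := by gcongr
  have y2 : ((p * p : ℕ) : ℝ) * (2 * (((p : ℝ) ^ 3)⁻¹ * Real.exp (256 * M))) =
      2 * Real.exp (256 * M) / p := by push_cast; field_simp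
  have z1 := mul_le_mul_of_nonneg_left (mul_le_mul_of_nonneg_left x1 zero_le_two) hp'.le
  have z2 := mul_le_mul_of_nonneg_left (mul_le_mul_of_nonneg_left x2 zero_le_two)
    (Nat.cast_nonneg (α := ℝ) (p * p))
  have hsum : 2 * Real.exp (256 * M) / p + 2 * Real.exp (256 * M) / p =
      4 * Real.exp (256 * M) / p := by ring
  linarith

end Conditional

/-! ### The Lasso on the bootstrap sample, and conditioning on the data. -/

section Bootstrap

variable {n p : ℕ} {S : Type*} {φ : (Fin n → ℝ) →ₗ[ℝ] (Fin n → S → ℝ)}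

/-- The resampled scores of the Lasso residuals. -/
lemma GoodResample.residual_score {X : Matrix (Fin n) (Fin p) ℝ} {ε : Fin n → ℝ} {τ₁ τ₂ : ℝ}
    {w : Fin n → S} (h : GoodResample φ X ε τ₁ τ₂ w) (d : Fin p → ℝ) (j : Fin p) :
    |∑ t, X t j * φ (center (ε - X.mulVec d)) t (w t)| ≤ τ₁ + norm1 d * τ₂ := by
  have e1 : X.mulVec d = ∑ k, d k • fun t => X t k := by
    ext t
    simp [Matrix.mulVec, dotProduct, mul_comm]
  have e2 : ∑ t, X t j * φ (center (ε - X.mulVec d)) t (w t) =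
      ∑ t, X t j * φ (center ε) t (w t) -
        ∑ k, d k * ∑ t, X t j * φ (center fun t => X t k) t (w t) := by
    rw [e1, center_sub, center_sum_smul, map_sub, map_sum]
    simp only [map_smul, Pi.sub_apply, Finset.sum_apply, Pi.smul_apply, smul_eq_mul, mul_sub,
      Finset.sum_sub_distrib, Finset.mul_sum]
    congr 1
    rw [Finset.sum_comm]
    exact Finset.sum_congr rfl fun k _ => Finset.sum_congr rfl fun t _ => by ring
  rw [e2]
  exact (abs_sub _ _).trans (add_le_add (h.score j) (sum_mul_le_norm1 d _ (h.gram j)))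

/-- The factor by which the Lasso enlarges the sparsity. -/
def sparsityFactor (c φ : ℝ) : ℝ := 128 * (φ + 1) / c

/-- The output sparsity of the first Lasso, `sparsityFactor` times that of `a`, is the input
sparsity of the second. Hence the smallness conditions carry `1 + sparsityFactor`, which covers both
applications, and the final sparsity carries the square. All bounds are multiplicative in `sparsity
a`, so `a = 0` needs no separate treatment. -/
lemma bootstrap_lasso_bounds {X : Matrix (Fin n) (Fin p) ℝ} {a b bS : Fin p → ℝ}
    {ε εS : Fin n → ℝ} {lam lamS κ φ₀ τ L K₁ K₂ : ℝ} {w : Fin n → S} (hn : 0 < n) (hL : 0 ≤ L)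
    (hκ : 0 < κ) (hφ₀ : 0 ≤ φ₀) (hX : DesignBounds X κ φ₀ τ) (hτ : 0 ≤ τ)
    (hscore : ∀ j, |∑ t, X t j * ε t| ≤ K₁ * √(n * L))
    (hre : GoodResample φ X ε (K₂ * √(n * L)) (√n * L) w)
    (hb : IsLasso X (X.mulVec a + ε) lam b) (hbS : IsLasso X (X.mulVec b + εS) lamS bS)
    (hεS : ∀ t, εS t = φ (center (X.mulVec a + ε - X.mulVec b)) t (w t))
    (hlam : 2 * K₁ * √(L / n) ≤ lam) (hlam0 : 0 < lam) (hlamS : 4 * K₂ * √(L / n) ≤ lamS)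
    (hlamS0 : 0 < lamS)
    (h1 : τ * (32 * ((1 + sparsityFactor κ φ₀) * sparsity a)) ≤ κ)
    (h2 : τ * (sparsityFactor κ φ₀ * ((1 + sparsityFactor κ φ₀) * sparsity a) + 1) ≤ 1)
    (h3 : 32 * lam * sparsity a / κ * (√n * L) ≤ K₂ * √(n * L)) :
    norm1 (bS - b) ≤ 32 * lamS * (sparsityFactor κ φ₀ * sparsity a) / κ ∧
      sqNorm2 (X.mulVec (bS - b)) / n ≤ 32 * lamS ^ 2 * (sparsityFactor κ φ₀ * sparsity a) / κ ∧
      (sparsity bS : ℝ) ≤ sparsityFactor κ φ₀ ^ 2 * sparsity a := by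
  have hn' : (0 : ℝ) < n := by exact_mod_cast hn
  set B := sparsityFactor κ φ₀ with hB
  have hB0 : 0 ≤ B := by rw [hB, sparsityFactor]; positivity
  set s : ℝ := (sparsity a : ℝ) with hs
  have hs0 : 0 ≤ s := Nat.cast_nonneg _
  have hBs : ∀ r : ℝ, 128 * (φ₀ + 1) * r / κ = B * r := fun r => by
    rw [hB, sparsityFactor]; ring
  have hsq : √(n * L) = n * √(L / n) := by
    rw [show (n : ℝ) * L = n ^ 2 * (L / n) by field_simp, Real.sqrt_mul (by positivity),
      Real.sqrt_sq hn'.le]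
  have hs1 : s ≤ (1 + B) * s := by nlinarith
  have hs2 : B * s ≤ (1 + B) * s := by nlinarith
  obtain ⟨r1, -, r3⟩ := hb.bounds (s := s) hn hlam0
    (fun j => (hscore j).trans (by rw [hsq]; nlinarith)) le_rfl hκ hφ₀ hτ hX
    (le_trans (by gcongr) h1) (by
      rw [hBs]
      exact le_trans (by gcongr) h2)
  rw [hBs] at r3
  obtain ⟨q1, q2, q3⟩ := hbS.bounds (s := B * s) hn hlamS0 (fun j => by
      have e1 : ∀ t, εS t = φ (center (ε - X.mulVec (b - a))) t (w t) := fun t => by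
        rw [hεS, Matrix.mulVec_sub]
        rw [show X.mulVec a + ε - X.mulVec b = ε - (X.mulVec b - X.mulVec a) by abel]
      simp_rw [e1]
      refine (hre.residual_score (b - a) j).trans ?_
      -- The estimation error of the first Lasso enters the bootstrap score only here and stays
      -- below the level of the true errors; this is why the condition on `lamS` has the factor
      -- four.
      have e2 : norm1 (b - a) * (√n * L) ≤ K₂ * √(n * L) :=
        (mul_le_mul_of_nonneg_right r1 (by positivity)).trans h3
      have e3 : 2 * (K₂ * √(n * L)) ≤ n * (lamS / 2) := by rw [hsq]; nlinarith
      linarith) r3 hκ hφ₀ hτ hX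
    (le_trans (by gcongr) h1) (by
      rw [hBs]
      exact le_trans (by gcongr) h2)
  exact ⟨q1, q2, q3.trans_eq (by rw [hBs]; ring)⟩

variable [MeasurableSpace S] {μ : Measure S} {m : ℝ} {Ω : Type*} [MeasurableSpace Ω] {P : Measure Ω}

/-- A probability bound conditional on the data, uniform in the data, holds unconditionally. -/
lemma measure_le_of_conditional_le [IsProbabilityMeasure P] {D E : Type*} [MeasurableSpace D]
    [MeasurableSpace E] {X : Ω → D} {Y : Ω → E} (hX : AEMeasurable X P) (hY : AEMeasurable Y P)
    (hXY : IndepFun X Y P) {B : Set (D × E)} (hB : MeasurableSet B) {η : ENNReal}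
    (h : ∀ d, P {ω | (d, Y ω) ∈ B} ≤ η) : P {ω | (X ω, Y ω) ∈ B} ≤ η := by
  have h1 : P {ω | (X ω, Y ω) ∈ B} = ((P.map X).prod (P.map Y)) B := by
    rw [← hXY.map_prod_eq_prod_map_map hX hY, Measure.map_apply_of_aemeasurable (hX.prodMk hY) hB]
    rfl
  have : IsProbabilityMeasure (P.map X) := Measure.isProbabilityMeasure_map hX
  have : IsProbabilityMeasure (P.map Y) := Measure.isProbabilityMeasure_map hY
  rw [h1, Measure.prod_apply hB]
  calc ∫⁻ d, P.map Y (Prod.mk d ⁻¹' B) ∂P.map X ≤ ∫⁻ _, η ∂P.map X := by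
        refine lintegral_mono fun d => ?_
        rw [Measure.map_apply_of_aemeasurable hY (measurable_prodMk_left hB)]
        exact h d
    _ = η := by simp

/-- Fubini's theorem in `measure_le_of_conditional_le` needs joint measurability in data and
bootstrap randomness. -/
lemma measurableSet_badResample (h : ResamplingScheme μ φ m) {D : Type*} [MeasurableSpace D]
    {X : D → Matrix (Fin n) (Fin p) ℝ} {ε : D → Fin n → ℝ}
    (hX : ∀ t j, Measurable fun d => X d t j) (hε : ∀ t, Measurable fun d => ε d t)
    (M R τ₁ τ₂ : ℝ) :
    MeasurableSet {q : D × (Fin n → S) | ModerateSample (X q.1) (ε q.1) M R ∧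
      ¬ GoodResample φ (X q.1) (ε q.1) τ₁ τ₂ q.2} := by
  have hφ : ∀ (u : D → Fin n → ℝ) (t : Fin n), (∀ r, Measurable fun d => u d r) →
      Measurable fun q : D × (Fin n → S) => φ (center (u q.1)) t (q.2 t) := fun u t hu => by
    have h1 : Measurable fun q : D × (Fin n → S) => (center (u q.1), q.2 t) := by
      refine Measurable.prodMk (measurable_pi_lambda _ fun r => ?_)
        ((measurable_pi_apply t).comp measurable_snd)
      unfold center
      exact ((hu r).sub ((Finset.measurable_fun_sum _ fun s _ => hu s).div_const _)).comp
        measurable_fst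
    exact (h.measurable t).comp h1
  have hX' : ∀ t j, Measurable fun q : D × (Fin n → S) => X q.1 t j := fun t j =>
    (hX t j).comp measurable_fst
  have hε' : ∀ t, Measurable fun q : D × (Fin n → S) => ε q.1 t := fun t =>
    (hε t).comp measurable_fst
  have e1 : {q : D × (Fin n → S) | ModerateSample (X q.1) (ε q.1) M R ∧
      ¬ GoodResample φ (X q.1) (ε q.1) τ₁ τ₂ q.2} =
      ((⋂ j, {q | ∑ t, X q.1 t j ^ 4 ≤ M * n}) ∩ {q | ∑ t, ε q.1 t ^ 4 ≤ M * n} ∩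
        ⋂ t, ⋂ j, {q | |X q.1 t j| ≤ R}) ∩
      ((⋂ j, {q | |∑ t, X q.1 t j * φ (center (ε q.1)) t (q.2 t)| ≤ τ₁}) ∩
        ⋂ j, ⋂ k, {q | |∑ t, X q.1 t j * φ (center fun t => X q.1 t k) t (q.2 t)| ≤ τ₂})ᶜ := by
    ext q
    simp only [Set.mem_ofPred_eq, Set.mem_inter_iff, Set.mem_iInter, Set.mem_compl_iff]
    refine and_congr ⟨fun h => ⟨⟨h.1, h.2⟩, h.3⟩, fun h => ⟨h.1.1, h.1.2, h.2⟩⟩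
      (not_congr ⟨fun h => ⟨h.1, h.2⟩, fun h => ⟨h.1, h.2⟩⟩)
  rw [e1]
  refine MeasurableSet.inter (((MeasurableSet.iInter fun j => ?_).inter ?_).inter
    (MeasurableSet.iInter fun t => MeasurableSet.iInter fun j => ?_))
    (((MeasurableSet.iInter fun j => ?_).inter
      (MeasurableSet.iInter fun j => MeasurableSet.iInter fun k => ?_)).compl)
  · exact measurableSet_le (Finset.measurable_fun_sum _ fun t _ => (hX' t j).pow_const 4)
      measurable_const
  · exact measurableSet_le (Finset.measurable_fun_sum _ fun t _ => (hε' t).pow_const 4)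
      measurable_const
  · exact measurableSet_le (hX' t j).abs measurable_const
  · exact measurableSet_le (Finset.measurable_fun_sum _ fun t _ =>
      (hX' t j).mul (hφ ε t hε)).abs measurable_const
  · exact measurableSet_le (Finset.measurable_fun_sum _ fun t _ =>
      (hX' t j).mul (hφ (fun d r => X d r k) t fun r => hX r k)).abs measurable_const

variable {A Q : Matrix (Fin p) (Fin p) ℝ} {y e : ℕ → Ω → EuclideanSpace ℝ (Fin p)} {c C : ℝ}

lemma IsStationaryVAR.aemeasurable_observations (h : IsStationaryVAR P A Q y e) (n : ℕ) :
    AEMeasurable (observations y n) P :=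
  aemeasurable_pi_lambda _ fun t => h.aemeasurable t

lemma IsStationaryVAR.response_eq (h : IsStationaryVAR P A Q y e) (i : Fin p) (n : ℕ) (ω : Ω) :
    response y i n ω = (design y n ω).mulVec (A i) + innovations e i n ω := by
  ext t
  have h1 := h.recursion t ω i
  simp only [response, Pi.add_apply, innovations]
  rw [h1]
  congr 1
  simp [Matrix.mulVec, dotProduct, design, mul_comm]

/-- With high probability, the sample and the resample are both regular. -/
lemma IsStationaryVAR.goodResample [IsProbabilityMeasure P] (hc : 0 < c) (hC : 0 < C)
    (hst : StableVAR c C A Q) (h : IsStationaryVAR P A Q y e) (i : Fin p)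
    (hφ : ResamplingScheme μ φ m) (hm : 0 ≤ m) {W : Fin n → Ω → S} (hW : ∀ t, HasLaw (W t) μ P)
    (hind : iIndepFun W P) (hWy : IndepFun (observations y n) (fun ω t => W t ω) P) {θ : ℝ}
    (hn : 0 < n) (hp : 1 < p) (hL2 : Real.log p ^ 2 ≤ n)
    (hLn : 5 * (Real.log p / n) * covBound c C ^ 2 ≤ 1) (hθ1 : θ ≤ 1)
    (hθ2 : 16 * m * quarticConst c C * √(4 * covBound c C * (Real.log n + Real.log p)) ^ 4 *
      Real.log p ≤ θ * n)
    (hθ3 : 65536 * m * √(4 * covBound c C * (Real.log n + Real.log p)) ^ 8 ≤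
      θ * (n * Real.log p)) :
    P {ω | ¬ (GoodSample (design y n ω) (innovations e i n ω) (statCov P y)
        (scoreConst c C * √(n * Real.log p)) (quarticConst c C)
        √(4 * covBound c C * (Real.log n + Real.log p)) ∧
      GoodResample φ (design y n ω) (innovations e i n ω)
        (resampleConst (quarticConst c C) * √(n * Real.log p)) (√n * Real.log p)
        fun t => W t ω)} ≤
      ENNReal.ofReal (θ + (4 * Real.exp (256 * quarticConst c C) + 10) / p) := by
  have hp' : (0 : ℝ) < p := by exact_mod_cast hp.trans' one_pos
  set M := quarticConst c C with hM
  have hM0 : 0 ≤ M := by rw [hM, quarticConst]; positivity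
  set R := √(4 * covBound c C * (Real.log n + Real.log p))
  set τ₁ := resampleConst M * √(n * Real.log p)
  set τ₂ := √(n : ℝ) * Real.log p
  have hn' : (0 : ℝ) < n := by exact_mod_cast hn
  have hθ0 : 0 ≤ θ := by
    have hL0 : 0 ≤ Real.log p := Real.log_nonneg (by exact_mod_cast hp.le)
    have : 0 ≤ θ * n := le_trans (by positivity) hθ2
    exact nonneg_of_mul_nonneg_left this hn'
  -- Regressors and innovations are recovered as measurable functions of the observations, the
  -- innovations as `y (t+1) - A y t` in coordinate `i`, so that fixing the data fixes both.
  let D := Fin (n + 1) → EuclideanSpace ℝ (Fin p)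
  let Xf : D → Matrix (Fin n) (Fin p) ℝ := fun d => Matrix.of fun t j => d t.castSucc j
  let εf : D → Fin n → ℝ := fun d t => d t.succ i - ∑ k, A i k * d t.castSucc k
  have hXf : ∀ t j, Measurable fun d => Xf d t j := fun t j => by
    change Measurable fun d : D => d t.castSucc j
    fun_prop
  have hεf : ∀ t, Measurable fun d => εf d t := fun t => by
    change Measurable fun d : D => d t.succ i - ∑ k, A i k * d t.castSucc k
    fun_prop
  have hX : ∀ ω, Xf (observations y n ω) = design y n ω := fun ω => rfl
  have hε : ∀ ω, εf (observations y n ω) = innovations e i n ω := fun ω => by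
    ext t
    have h1 := h.recursion t ω i
    simp only [εf, observations, innovations, Fin.val_succ, Fin.val_castSucc]
    rw [h1]
    simp [Matrix.mulVec, dotProduct]
  have hWm : AEMeasurable (fun ω t => W t ω) P :=
    aemeasurable_pi_lambda _ fun t => (hW t).aemeasurable
  have b1 := h.goodSample hc hC hst i hn hL2 hLn
  have b2 := measure_le_of_conditional_le (h.aemeasurable_observations n) hWm hWy
    (measurableSet_badResample hφ hXf hεf M R τ₁ τ₂)
    (η := ENNReal.ofReal (θ + 4 * Real.exp (256 * M) / p)) fun d => by
      -- The resampling bound holds only for moderate data. The bad set includes that requirement,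
      -- so its section over other data is empty and the bound is uniform.
      by_cases hd : ModerateSample (Xf d) (εf d) M R
      · refine le_trans (measure_mono fun ω hω => ?_) (hφ.goodResample hW hind hM0 hm
          (Real.sqrt_nonneg _) hd hn hp hθ1 hθ2 hθ3)
        exact hω.2
      · refine (measure_mono (fun ω hω => hd hω.1 : _ ⊆ (∅ : Set Ω))).trans ?_
        exact measure_empty.trans_le bot_le
  refine (measure_mono (fun ω hω => ?_)).trans ((measure_union_le _ _).trans
    ((add_le_add b1 b2).trans_eq ?_))
  · by_cases hg : GoodSample (design y n ω) (innovations e i n ω) (statCov P y)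
        (scoreConst c C * √(n * Real.log p)) M R
    · refine Or.inr ⟨?_, ?_⟩
      · change ModerateSample (Xf (observations y n ω)) (εf (observations y n ω)) M R
        rw [hX, hε]
        exact hg.moderate
      · intro hr
        have hr' : GoodResample φ (Xf (observations y n ω)) (εf (observations y n ω)) τ₁ τ₂
          fun t => W t ω := hr
        rw [hX, hε] at hr'
        exact hω ⟨hg, hr'⟩
    · exact Or.inl hg
  · rw [← ENNReal.ofReal_add (by positivity) (by positivity)]
    congr 1
    rw [Real.exp_neg, Real.exp_log hp']
    ring

end Bootstrap

/-! ### Rates and the failure probability. -/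

section Rates

/-- Bootstrap errors obtained from a resampling scheme applied to the vector `r`. -/
def IsResampled {n : ℕ} {Ω D : Type*} [MeasurableSpace Ω] [MeasurableSpace D]
    (P : Measure Ω) (data : Ω → D) (r εs : Ω → Fin n → ℝ) (m : ℝ) : Prop :=
  ∃ (S : Type) (_ : MeasurableSpace S) (μ : Measure S) (φ : (Fin n → ℝ) →ₗ[ℝ] (Fin n → S → ℝ))
    (W : Fin n → Ω → S), ResamplingScheme μ φ m ∧ (∀ t, HasLaw (W t) μ P) ∧ iIndepFun W P ∧
      IndepFun data (fun ω t => W t ω) P ∧ ∀ ω t, εs ω t = φ (r ω) t (W t ω)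

lemma IsResidualBootstrap.isResampled {n : ℕ} {Ω D : Type*} [MeasurableSpace Ω]
    [MeasurableSpace D] {P : Measure Ω} {data : Ω → D} {r εs : Ω → Fin n → ℝ} (hn : 0 < n)
    (h : IsResidualBootstrap P data r εs) : IsResampled P data r εs 1 := by
  obtain ⟨U, h1, h2, h3, h4⟩ := h
  exact ⟨Fin n, inferInstance, _, drawMap n, U, resamplingScheme_draw hn, h1, h2, h3, h4⟩

lemma IsWildBootstrap.isResampled {n : ℕ} {Ω D : Type*} [MeasurableSpace Ω]
    [MeasurableSpace D] {P : Measure Ω} {ν : Measure ℝ} (hν : IsMultiplierLaw ν) {data : Ω → D}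
    {r εs : Ω → Fin n → ℝ} (h : IsWildBootstrap P ν data r εs) :
    IsResampled P data r εs (∫ w, w ^ 4 ∂ν) := by
  obtain ⟨W, h1, h2, h3, h4⟩ := h
  exact ⟨ℝ, inferInstance, _, wildMap n, W, hν.resamplingScheme, h1, h2, h3, h4⟩

lemma isBigOp_of_measure_le {Ω : ℕ → Type*} [∀ n, MeasurableSpace (Ω n)] {P : ∀ n, Measure (Ω n)}
    {Z : ∀ n, Ω n → ℝ} {r β : ℕ → ℝ} (hβ : Tendsto β atTop (𝓝 0)) {M : ℝ} (hM : 0 < M)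
    (h : ∀ᶠ n in atTop, P n {ω | M * r n < |Z n ω|} ≤ ENNReal.ofReal (β n)) : IsBigOp P Z r := by
  intro η hη
  refine ⟨M, hM, ?_⟩
  filter_upwards [h, hβ.eventually_le_const hη] with n h1 h2
  exact h1.trans (ENNReal.ofReal_le_ofReal h2)

/-- The constant in the tuning parameters. -/
def lassoConst (c C : ℝ) : ℝ :=
  2 * scoreConst c C + 4 * resampleConst (quarticConst c C)

lemma scoreConst_pos (c C : ℝ) : 0 < scoreConst c C := by unfold scoreConst; positivity

lemma resampleConst_quarticConst_pos (c C : ℝ) : 0 < resampleConst (quarticConst c C) := by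
  unfold resampleConst quarticConst; positivity

lemma lassoConst_pos (c C : ℝ) : 0 < lassoConst c C := by
  have := scoreConst_pos c C
  have := resampleConst_quarticConst_pos c C
  unfold lassoConst; positivity

/-- The constant in the failure probability of the bootstrap approximation. -/
def failureConst (c C m : ℝ) : ℝ :=
  256 * m * quarticConst c C * covBound c C ^ 2 + 16777216 * m * covBound c C ^ 4

/-- A bound for the failure probability of the bootstrap approximation. -/
def failureRate (c C m n u : ℝ) : ℝ :=
  failureConst c C m * (8 * Real.log n ^ 4 / n + 8 * u ^ 2)

/-- Both conditions reduce to `(log n + L)⁴ ≲ θ n L`. The fourth power splits into `log⁴ n`, small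
against `n`, and `L⁴ = L · L³` with `L³ ≤ u² n`. -/
lemma failureRate_bounds {c C m n L u : ℝ} (hc : 0 < c) (hC : 0 < C) (hm : 0 ≤ m) (hn : 1 ≤ n)
    (hL : 1 ≤ L) (hu : L ^ 3 / n ≤ u ^ 2) :
    16 * m * quarticConst c C * √(4 * covBound c C * (Real.log n + L)) ^ 4 * L ≤
        failureRate c C m n u * n ∧
      65536 * m * √(4 * covBound c C * (Real.log n + L)) ^ 8 ≤
        failureRate c C m n u * (n * L) := by
  have hn0 : 0 < n := by linarith
  have hlog : 0 ≤ Real.log n := Real.log_nonneg hn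
  set l := Real.log n
  set σ := covBound c C
  have hσ : 0 < σ := covBound_pos hc hC
  set M := quarticConst c C with hM
  have hM0 : 0 ≤ M := by rw [hM, quarticConst]; positivity
  have e0 : √(4 * σ * (l + L)) ^ 2 = 4 * σ * (l + L) := Real.sq_sqrt (by positivity)
  have e4 : √(4 * σ * (l + L)) ^ 4 = 16 * σ ^ 2 * (l + L) ^ 2 := by
    rw [show √(4 * σ * (l + L)) ^ 4 = (√(4 * σ * (l + L)) ^ 2) ^ 2 by ring, e0]; ring
  have e8 : √(4 * σ * (l + L)) ^ 8 = 256 * σ ^ 4 * (l + L) ^ 4 := by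
    rw [show √(4 * σ * (l + L)) ^ 8 = (√(4 * σ * (l + L)) ^ 2) ^ 4 by ring, e0]; ring
  have hF : 0 ≤ failureConst c C m := by unfold failureConst; positivity
  have h1 : (l + L) ^ 4 ≤ 8 * (l ^ 4 + L ^ 4) := by
    have a1 : (l + L) ^ 2 ≤ 2 * (l ^ 2 + L ^ 2) := by nlinarith [sq_nonneg (l - L)]
    calc (l + L) ^ 4 = ((l + L) ^ 2) ^ 2 := by ring
      _ ≤ (2 * (l ^ 2 + L ^ 2)) ^ 2 := by gcongr
      _ ≤ _ := by nlinarith [sq_nonneg (l ^ 2 - L ^ 2)]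
  have h2 : failureConst c C m * (l + L) ^ 4 ≤ failureRate c C m n u * (n * L) := by
    have a1 : L ^ 3 ≤ u ^ 2 * n := (div_le_iff₀ hn0).1 hu
    have a2 : failureRate c C m n u * (n * L) =
        failureConst c C m * (8 * (l ^ 4 * L + u ^ 2 * n * L)) := by
      change failureConst c C m * (8 * l ^ 4 / n + 8 * u ^ 2) * (n * L) = _
      field_simp
    rw [a2]
    refine mul_le_mul_of_nonneg_left (h1.trans ?_) hF
    have a3 : l ^ 4 * 1 ≤ l ^ 4 * L := by gcongr
    have a4 : L ^ 3 * L ≤ u ^ 2 * n * L := by gcongr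
    linarith
  have h3 : 0 ≤ 256 * m * M * σ ^ 2 := by positivity
  have h4 : 0 ≤ 16777216 * m * σ ^ 4 := by positivity
  constructor
  · rw [e4]
    refine le_of_mul_le_mul_right ?_ (by linarith : 0 < L)
    have a1 : L ^ 2 * (l + L) ^ 2 ≤ (l + L) ^ 4 := by
      calc L ^ 2 * (l + L) ^ 2 ≤ (l + L) ^ 2 * (l + L) ^ 2 := by gcongr; linarith
        _ = _ := by ring
    calc 16 * m * M * (16 * σ ^ 2 * (l + L) ^ 2) * L * L
        = 256 * m * M * σ ^ 2 * (L ^ 2 * (l + L) ^ 2) := by ring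
      _ ≤ 256 * m * M * σ ^ 2 * (l + L) ^ 4 := by gcongr
      _ ≤ failureConst c C m * (l + L) ^ 4 := by
        refine mul_le_mul_of_nonneg_right ?_ (by positivity)
        unfold failureConst; linarith
      _ ≤ _ := h2.trans_eq (by ring)
  · rw [e8]
    calc 65536 * m * (256 * σ ^ 4 * (l + L) ^ 4) = 16777216 * m * σ ^ 4 * (l + L) ^ 4 := by ring
      _ ≤ failureConst c C m * (l + L) ^ 4 := by
        refine mul_le_mul_of_nonneg_right ?_ (by positivity)
        unfold failureConst; linarith
      _ ≤ _ := h2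

lemma tendsto_log_pow_four_div : Tendsto (fun n : ℕ => Real.log n ^ 4 / (n : ℝ)) atTop (𝓝 0) :=
  ((Real.isLittleO_pow_log_id_atTop (n := 4)).tendsto_div_nhds_zero).comp
    tendsto_natCast_atTop_atTop

/-- Consequences of the sparsity assumption. -/
lemma rate_bounds {n L s u : ℝ} (hn : 0 < n) (hL : 1 ≤ L) 
    (hu : max 1 s * L ^ (3 / 2 : ℝ) / √n = u) :
    √(L / n) ≤ u ∧ s * √(L / n) ≤ u ∧ s * L / √n ≤ u ∧ L ^ 3 / n ≤ u ^ 2 := by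
  have hL0 : 0 < L := by linarith
  have hr : L ^ (3 / 2 : ℝ) = L * √L := by
    rw [show (3 / 2 : ℝ) = 1 + 1 / 2 by norm_num, Real.rpow_add hL0, Real.rpow_one,
      ← Real.sqrt_eq_rpow]
  rw [hr] at hu
  have hsn : 0 < √n := Real.sqrt_pos.2 hn
  have hsL : 1 ≤ √L := Real.one_le_sqrt.2 hL
  have h1 : 1 ≤ max 1 s := le_max_left _ _
  have h2 : s ≤ max 1 s := le_max_right _ _
  set k := max 1 s
  have hk : 0 < k := by linarith
  have e1 : √(L / n) = √L / √n := Real.sqrt_div hL0.le n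
  have k1 : k * √(L / n) ≤ u := by
    rw [e1, ← hu, mul_div_assoc']
    gcongr
    nlinarith
  have k2 : k * L / √n ≤ u := by
    rw [← hu]
    gcongr
    nlinarith
  have h0 : 0 ≤ √(L / n) := Real.sqrt_nonneg _
  refine ⟨?_, le_trans (by gcongr) k1, le_trans (by gcongr) k2, ?_⟩
  · nlinarith
  · have e2 : u ^ 2 = k ^ 2 * (L ^ 3 / n) := by
      rw [← hu, div_pow, mul_pow, mul_pow, Real.sq_sqrt hn.le, Real.sq_sqrt hL0.le]; ring
    have h3 : 0 ≤ L ^ 3 / n := by positivity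
    rw [e2]
    exact le_mul_of_one_le_left h3 (one_le_pow₀ h1)

variable {n p : ℕ} {Ω : Type*} [MeasurableSpace Ω] {P : Measure Ω}
  {A Q : Matrix (Fin p) (Fin p) ℝ} {y e : ℕ → Ω → EuclideanSpace ℝ (Fin p)} {c C : ℝ}

/-- The bootstrap Lasso bounds for a VAR sample, outside an event of small probability. -/
lemma IsResampled.lasso_bounds [IsProbabilityMeasure P] (hc : 0 < c) (hC : 0 < C)
    (hst : StableVAR c C A Q) (h : IsStationaryVAR P A Q y e) (i : Fin p) {m : ℝ} (hm : 0 ≤ m)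
    {lam u : ℝ} {b : Ω → Fin p → ℝ} {εs : Ω → Fin n → ℝ}
    (hb : ∀ ω, IsLasso (design y n ω) (response y i n ω) lam (b ω))
    (hεs : IsResampled P (observations y n)
      (fun ω => center (response y i n ω - (design y n ω).mulVec (b ω))) εs m)
    (hn : 0 < n) (hL : 1 ≤ Real.log p) {K₀ : ℝ}
    (hu : max 1 (sparsity (A i) : ℝ) * Real.log p ^ (3 / 2 : ℝ) / √(n : ℝ) = u) (hu1 : u ≤ 1)
    (hu2 : 5 * covBound c C ^ 2 * u ≤ 1)
    (hu3 : scoreConst c C * 32 * (1 + sparsityFactor c (covBound c C)) * u ≤ c)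
    (hu4 : scoreConst c C * (sparsityFactor c (covBound c C) *
      (1 + sparsityFactor c (covBound c C)) + 1) * u ≤ 1)
    (hu5 : 32 * K₀ / c * u ≤ resampleConst (quarticConst c C))
    (hrate : failureRate c C m n u ≤ 1)
    (hlam : 2 * scoreConst c C * √(Real.log p / n) ≤ lam) (hlam' : lam ≤ K₀ * √(Real.log p / n)) :
    P {ω | ¬ ∀ (lamS : ℝ) (bS : Fin p → ℝ),
      4 * resampleConst (quarticConst c C) * √(Real.log p / n) ≤ lamS →
      IsLasso (design y n ω) ((design y n ω).mulVec (b ω) + εs ω) lamS bS →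
      norm1 (bS - b ω) ≤
          32 * lamS * (sparsityFactor c (covBound c C) * sparsity (A i)) / c ∧
        sqNorm2 ((design y n ω).mulVec (bS - b ω)) / n ≤
          32 * lamS ^ 2 * (sparsityFactor c (covBound c C) * sparsity (A i)) / c ∧
        (sparsity bS : ℝ) ≤ sparsityFactor c (covBound c C) ^ 2 * sparsity (A i)} ≤
      ENNReal.ofReal (failureRate c C m n u +
        (4 * Real.exp (256 * quarticConst c C) + 10) / p) := by
  obtain ⟨S, _, μ, φ, W, hφ, hW, hind, hWy, hεW⟩ := hεs
  have hn' : (0 : ℝ) < n := by exact_mod_cast hn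
  have hn1 : (1 : ℝ) ≤ n := by exact_mod_cast hn
  have hp : 1 < p := by
    by_contra hp
    have : Real.log p ≤ 0 := Real.log_nonpos (Nat.cast_nonneg _) (by exact_mod_cast not_lt.1 hp)
    linarith
  have hs0 : (0 : ℝ) ≤ sparsity (A i) := Nat.cast_nonneg _
  obtain ⟨r1, r2, r3, r4⟩ := rate_bounds hn' hL hu
  set L := Real.log p
  set s : ℝ := (sparsity (A i) : ℝ)
  set η := √(L / n) with hη
  have hL0 : 0 < L := by linarith
  have hη0 : 0 < η := Real.sqrt_pos.2 (by positivity)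
  have hη2 : η ^ 2 = L / n := Real.sq_sqrt (by positivity)
  have hu0 : 0 ≤ u := hη0.le.trans r1
  have huu : u ^ 2 ≤ u := by nlinarith
  have hσ : 0 < covBound c C := covBound_pos hc hC
  set σ := covBound c C
  have hBpos : 0 ≤ sparsityFactor c σ := by unfold sparsityFactor; positivity
  set B := sparsityFactor c σ
  have hK1 := scoreConst_pos c C
  have hK2 := resampleConst_quarticConst_pos c C
  set K₁ := scoreConst c C
  set K₂ := resampleConst (quarticConst c C)
  have hLn3 : L ^ 3 ≤ n := by
    have := (div_le_iff₀ hn').1 (r4.trans (huu.trans hu1))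
    linarith
  have hL2 : L ^ 2 ≤ n := le_trans (pow_le_pow_right₀ hL (by norm_num)) hLn3
  have hLn : 5 * (L / n) * σ ^ 2 ≤ 1 := by
    have : L / n ≤ u := by
      rw [← hη2]
      exact (pow_le_pow_left₀ hη0.le r1 2).trans huu
    calc 5 * (L / n) * σ ^ 2 ≤ 5 * u * σ ^ 2 := by gcongr
      _ ≤ 1 := by linarith
  obtain ⟨f1, f2⟩ := failureRate_bounds hc hC hm hn1 hL r4
  -- The bad event is only contained in a controlled one. Monotonicity of the outer measure
  -- suffices, so no measurable choice of Lasso minimizers is required and all penalties are treated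
  -- at once.
  refine le_trans (measure_mono fun ω hω => ?_)
    (h.goodResample hc hC hst i hφ hm hW hind hWy hn hp hL2 hLn hrate f1 f2)
  intro hgood
  refine hω ?_
  intro lamS bS hlamS hbS
  obtain ⟨g1, g2⟩ := hgood
  have hstat : ∀ v : Fin p → ℝ, ∑ j, ∑ k, v j * v k * statCov P y j k = statVar A Q v :=
    h.sum_statCov hc hst
  have hX : DesignBounds (design y n ω) c σ (K₁ * √(n * L) / n) := g1.designBounds hn
    (fun v => by rw [hstat]; exact hst.statVar_ge hc v)
    (fun v => by rw [hstat]; exact hst.statVar_le hc hC.le v)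
  have hsq : √(n * L) = n * η := by
    rw [hη, show (n : ℝ) * L = n ^ 2 * (L / n) by field_simp, Real.sqrt_mul (by positivity),
      Real.sqrt_sq hn'.le]
  have hτ : K₁ * √(n * L) / n = K₁ * η := by rw [hsq]; field_simp
  rw [hτ] at hX
  have hresp := h.response_eq i n ω
  have hb' := hb ω
  rw [hresp] at hb'
  refine bootstrap_lasso_bounds (a := A i) hn hL0.le hc hσ.le hX (by positivity) g1.score g2 hb' hbS
    (fun t => by rw [hεW, ← hresp]) hlam (lt_of_lt_of_le (by positivity) hlam) hlamS
    (lt_of_lt_of_le (by positivity) hlamS) ?_ ?_ ?_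
  · calc K₁ * η * (32 * ((1 + B) * s)) = K₁ * 32 * (1 + B) * (s * η) := by ring
      _ ≤ K₁ * 32 * (1 + B) * u := by gcongr
      _ ≤ c := hu3
  · calc K₁ * η * (B * ((1 + B) * s) + 1) = K₁ * (B * (1 + B) * (s * η) + η) := by ring
      _ ≤ K₁ * (B * (1 + B) * u + u) := by gcongr
      _ ≤ 1 := by linarith
  · have hsn : 0 < √(n : ℝ) := Real.sqrt_pos.2 hn'
    have e1 : η * √n * √n = √(n * L) := by
      rw [mul_assoc, Real.mul_self_sqrt hn'.le, hsq, mul_comm]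
    have hK0 : 0 ≤ K₀ := by
      have : 0 < K₀ * η := lt_of_lt_of_le (by positivity) (hlam.trans hlam')
      exact (pos_of_mul_pos_left this hη0.le).le
    -- The upper bound on `lam` is used here only: a large penalty would make the residuals too far
    -- from the errors. What must be small is `s L / √n`.
    calc 32 * lam * s / c * (√n * L) ≤ 32 * (K₀ * η) * s / c * (√n * L) := by gcongr
      _ = 32 * K₀ / c * (s * L / √n) * (η * √n * √n) := by field_simp
      _ ≤ 32 * K₀ / c * u * (η * √n * √n) := by gcongr
      _ ≤ K₂ * (η * √n * √n) := by gcongr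
      _ = _ := by rw [e1]

end Rates

/-! ### Passage to the limit. -/

section Limits

variable {p : ℕ → ℕ}

lemma tendsto_log_natCast_comp (hp : Tendsto p atTop atTop) :
    Tendsto (fun n => Real.log (p n)) atTop atTop :=
  Real.tendsto_log_atTop.comp (tendsto_natCast_atTop_atTop.comp hp)

/-- The bootstrap Lasso bounds hold with probability tending to one. -/
theorem eventually_lasso_bounds {c C : ℝ} (hc : 0 < c) (hC : 0 < C)
    {A S : ∀ n, Matrix (Fin (p n)) (Fin (p n)) ℝ} {Ω : ℕ → Type*} [∀ n, MeasurableSpace (Ω n)]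
    {P : ∀ n, Measure (Ω n)} [∀ n, IsProbabilityMeasure (P n)]
    {y e : ∀ n, ℕ → Ω n → EuclideanSpace ℝ (Fin (p n))} (hp : Tendsto p atTop atTop)
    (hst : ∀ n, StableVAR c C (A n) (S n))
    (hvar : ∀ n, IsStationaryVAR (P n) (A n) (S n) (y n) (e n))
    (i : ∀ n, Fin (p n)) {lam : ℕ → ℝ} {aLasso : ∀ n, Ω n → Fin (p n) → ℝ}
    {εs : ∀ n, Ω n → Fin n → ℝ}
    (hrate : Tendsto (fun n : ℕ => max 1 (sparsity (A n (i n)) : ℝ) *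
      Real.log (p n) ^ (3 / 2 : ℝ) / √(n : ℝ)) atTop (𝓝 0))
    (hlam : AsympEq lam fun n => √(Real.log (p n) / n))
    (hK : ∀ᶠ n : ℕ in atTop, 2 * scoreConst c C * √(Real.log (p n) / n) ≤ lam n)
    (haL : ∀ n ω, IsLasso (design (y n) n ω) (response (y n) (i n) n ω) (lam n) (aLasso n ω))
    {m : ℝ} (hm : 0 ≤ m) (hεs : ∀ n, 0 < n → IsResampled (P n) (observations (y n) n)
      (fun ω => center (response (y n) (i n) n ω - (design (y n) n ω).mulVec (aLasso n ω)))
      (εs n) m) :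
    ∃ β : ℕ → ℝ, Tendsto β atTop (𝓝 0) ∧ ∀ᶠ n : ℕ in atTop,
      P n {ω | ¬ ∀ (lamS : ℝ) (bS : Fin (p n) → ℝ),
        4 * resampleConst (quarticConst c C) * √(Real.log (p n) / n) ≤ lamS →
        IsLasso (design (y n) n ω) ((design (y n) n ω).mulVec (aLasso n ω) + εs n ω) lamS bS →
        norm1 (bS - aLasso n ω) ≤
            32 * lamS * (sparsityFactor c (covBound c C) * sparsity (A n (i n))) / c ∧
          sqNorm2 ((design (y n) n ω).mulVec (bS - aLasso n ω)) / n ≤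
            32 * lamS ^ 2 * (sparsityFactor c (covBound c C) * sparsity (A n (i n))) / c ∧
          (sparsity bS : ℝ) ≤ sparsityFactor c (covBound c C) ^ 2 * sparsity (A n (i n))} ≤
        ENNReal.ofReal (β n) := by
  obtain ⟨_, K₀, _, _, hK₀⟩ := hlam
  set u : ℕ → ℝ := fun n => max 1 (sparsity (A n (i n)) : ℝ) *
      Real.log (p n) ^ (3 / 2 : ℝ) / √(n : ℝ) with hu
  have hF : Tendsto (fun n : ℕ => failureRate c C m n (u n)) atTop (𝓝 0) := by
    have h1 := ((tendsto_log_pow_four_div.const_mul 8).add ((hrate.pow 2).const_mul 8)).const_mul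
      (failureConst c C m)
    simp only [mul_zero, ne_eq, OfNat.ofNat_ne_zero, not_false_eq_true, zero_pow, add_zero] at h1
    refine h1.congr fun n => ?_
    rw [failureRate, mul_div_assoc]
  have hpinv : Tendsto (fun n => (4 * Real.exp (256 * quarticConst c C) + 10) / (p n : ℝ)) atTop
      (𝓝 0) := (tendsto_natCast_atTop_atTop.comp hp).const_div_atTop _
  -- Every smallness condition of `lasso_bounds` is linear in `u`, so a single null sequence serves
  -- all of them.
  have hsmall : ∀ K r : ℝ, 0 < r → ∀ᶠ n in atTop, K * u n ≤ r := fun K r hr => by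
    have h1 := hrate.const_mul K
    rw [mul_zero] at h1
    exact h1.eventually_le_const hr
  refine ⟨_, by simpa using hF.add hpinv, ?_⟩
  filter_upwards [hK, hK₀, eventually_gt_atTop 0,
    (tendsto_log_natCast_comp hp).eventually_ge_atTop 1, hF.eventually_le_const one_pos,
    hsmall 1 1 one_pos, hsmall (5 * covBound c C ^ 2) 1 one_pos,
    hsmall (scoreConst c C * 32 * (1 + sparsityFactor c (covBound c C))) c hc,
    hsmall (scoreConst c C * (sparsityFactor c (covBound c C) *
      (1 + sparsityFactor c (covBound c C)) + 1)) 1 one_pos,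
    hsmall (32 * K₀ / c) _ (resampleConst_quarticConst_pos c C)] with
    n h1 h2 h3 h4 h5 h6 h7 h8 h9 h10
  exact (hεs n h3).lasso_bounds hc hC (hst n) (hvar n) (i n) hm (haL n) h3 h4 (hu := rfl)
    (by simpa using h6) h7 h8 h9 h10 h5 h1 h2.2

end Limits

end

end VARBootstrap

/-! ### The theorem. -/

theorem mainTheorem5 (c C : ℝ) (hc : 0 < c) :
    ∃ K : ℝ, 0 < K ∧
      ∀ (p : ℕ → ℕ) (A S : ∀ n, Matrix (Fin (p n)) (Fin (p n)) ℝ)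
        (Ω : ℕ → Type*) [∀ n, MeasurableSpace (Ω n)]
        (P : ∀ n, Measure (Ω n)) [∀ n, IsProbabilityMeasure (P n)]
        (y e : ∀ n, ℕ → Ω n → EuclideanSpace ℝ (Fin (p n)))
        (i : ∀ n, Fin (p n)) (lam : ℕ → ℝ)
        (aLasso : ∀ n, Ω n → Fin (p n) → ℝ) (εs : ∀ n, Ω n → Fin n → ℝ),
        Tendsto p atTop atTop →
        (∀ n, VARBootstrap.StableVAR c C (A n) (S n)) →
        (∀ n, VARBootstrap.IsStationaryVAR (P n) (A n) (S n) (y n) (e n)) →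
        Tendsto (fun n : ℕ => max 1 (VARBootstrap.sparsity (A n (i n)) : ℝ) *
          Real.log (p n) ^ (3 / 2 : ℝ) / √(n : ℝ)) atTop (𝓝 0) →
        VARBootstrap.AsympEq lam (fun n => √(Real.log (p n) / n)) →
        (∀ᶠ n : ℕ in atTop, K * √(Real.log (p n) / n) ≤ lam n) →
        (∀ n ω, VARBootstrap.IsLasso (VARBootstrap.design (y n) n ω)
          (VARBootstrap.response (y n) (i n) n ω) (lam n) (aLasso n ω)) →
        ((∀ n, VARBootstrap.IsResidualBootstrap (P n) (VARBootstrap.observations (y n) n)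
            (fun ω => VARBootstrap.center (VARBootstrap.response (y n) (i n) n ω -
              (VARBootstrap.design (y n) n ω).mulVec (aLasso n ω))) (εs n)) ∨
          ∃ ν : Measure ℝ, VARBootstrap.IsMultiplierLaw ν ∧
            ∀ n, VARBootstrap.IsWildBootstrap (P n) ν (VARBootstrap.observations (y n) n)
              (fun ω => VARBootstrap.center (VARBootstrap.response (y n) (i n) n ω -
                (VARBootstrap.design (y n) n ω).mulVec (aLasso n ω))) (εs n)) →
        ∀ (lamStar : ℕ → ℝ) (aStar : ∀ n, Ω n → Fin (p n) → ℝ),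
          (∀ n ω, VARBootstrap.IsLasso (VARBootstrap.design (y n) n ω)
            ((VARBootstrap.design (y n) n ω).mulVec (aLasso n ω) + εs n ω)
            (lamStar n) (aStar n ω)) →
          (VARBootstrap.AsympEq lamStar (fun n => Real.log (p n) / √(n : ℝ)) →
            VARBootstrap.IsBigOp P
                (fun n ω => VARBootstrap.norm1 (aStar n ω - aLasso n ω))
                (fun n => (VARBootstrap.sparsity (A n (i n)) : ℝ) *
                  Real.log (p n) / √(n : ℝ)) ∧
              VARBootstrap.IsBigOp P
                (fun n ω => VARBootstrap.sqNorm2 ((VARBootstrap.design (y n) n ω).mulVec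
                  (aStar n ω - aLasso n ω)) / (n : ℝ))
                (fun n => (VARBootstrap.sparsity (A n (i n)) : ℝ) *
                  Real.log (p n) ^ 2 / (n : ℝ))) ∧
          ((∀ᶠ n : ℕ in atTop, K * √(Real.log (p n) / n) ≤ lamStar n) →
            VARBootstrap.IsBigOp P
              (fun n ω => (VARBootstrap.sparsity (aStar n ω) : ℝ))
              (fun n => (VARBootstrap.sparsity (A n (i n)) : ℝ))) := by
  refine ⟨VARBootstrap.lassoConst c C, VARBootstrap.lassoConst_pos c C, ?_⟩
  intro p A S Ω _ P _ y e i lam aLasso εs hp hst hvar hrate hlam hK haL hboot lamStar aStar haS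
  -- The index `i 0` provides a unit vector, and testing the noise covariance on it gives `c ≤ C`.
  have hC : 0 < C := hc.trans_le ((hst 0).c_le_C (i 0))
  have hboot' : ∃ m : ℝ, 0 ≤ m ∧ ∀ n, 0 < n → VARBootstrap.IsResampled (P n)
      (VARBootstrap.observations (y n) n) (fun ω => VARBootstrap.center
        (VARBootstrap.response (y n) (i n) n ω -
          (VARBootstrap.design (y n) n ω).mulVec (aLasso n ω))) (εs n) m := by
    rcases hboot with h | ⟨ν, hν, h⟩
    · exact ⟨1, zero_le_one, fun n hn => (h n).isResampled hn⟩
    · exact ⟨∫ w, w ^ 4 ∂ν, integral_nonneg fun w => by positivity,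
        fun n _ => (h n).isResampled hν⟩
  obtain ⟨m, hm, hres⟩ := hboot'
  obtain ⟨β, hβ, hbad⟩ := VARBootstrap.eventually_lasso_bounds hc hC hp hst hvar i hrate hlam
    (hK.mono fun n h => le_trans (mul_le_mul_of_nonneg_right (by
      have := VARBootstrap.resampleConst_quarticConst_pos c C
      unfold VARBootstrap.lassoConst; linarith) (Real.sqrt_nonneg _)) h) haL hm hres
  have hσ := VARBootstrap.covBound_pos hc hC
  have hB : 0 < VARBootstrap.sparsityFactor c (VARBootstrap.covBound c C) := by
    unfold VARBootstrap.sparsityFactor; positivity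
  set B := VARBootstrap.sparsityFactor c (VARBootstrap.covBound c C)
  have hK2 := VARBootstrap.resampleConst_quarticConst_pos c C
  set K₂ := VARBootstrap.resampleConst (VARBootstrap.quarticConst c C)
  constructor
  · rintro ⟨d₁, d₂, hd₁, hd₂, hd⟩
    have hlarge := (VARBootstrap.tendsto_log_natCast_comp hp).eventually_ge_atTop
      ((4 * K₂ / d₁) ^ 2)
    -- In part (a) the penalty exceeds `√(log p / n)` by a factor of order `√(log p)`, which is
    -- unbounded; no lower constant has to be imposed.
    have hmin : ∀ᶠ n : ℕ in atTop, 4 * K₂ * √(Real.log (p n) / n) ≤ lamStar n := by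
      filter_upwards [hd, hlarge, eventually_gt_atTop 0] with n h1 h2 hn
      have hn' : (0 : ℝ) < n := by exact_mod_cast hn
      have hL0 : 0 ≤ Real.log (p n) := (sq_nonneg _).trans h2
      have h3 : 4 * K₂ ≤ d₁ * √(Real.log (p n)) := by
        have := Real.le_sqrt_of_sq_le h2
        rw [div_le_iff₀ hd₁] at this
        linarith
      calc 4 * K₂ * √(Real.log (p n) / n)
          ≤ d₁ * √(Real.log (p n)) * √(Real.log (p n) / n) := by gcongr
        _ = d₁ * (Real.log (p n) / √(n : ℝ)) := by
          rw [Real.sqrt_div hL0, mul_assoc, mul_div_assoc', Real.mul_self_sqrt hL0]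
        _ ≤ _ := h1.1
    constructor
    · refine VARBootstrap.isBigOp_of_measure_le hβ (M := 32 * d₂ * B / c) (by positivity) ?_
      filter_upwards [hbad, hd, hmin] with n h1 h2 h3
      refine le_trans (measure_mono fun ω hω => ?_) h1
      intro hgood
      have hω' : 32 * d₂ * B / c * ((VARBootstrap.sparsity (A n (i n)) : ℝ) *
          Real.log (p n) / √(n : ℝ)) < |VARBootstrap.norm1 (aStar n ω - aLasso n ω)| := hω
      rw [abs_of_nonneg (VARBootstrap.norm1_nonneg _)] at hω'
      refine absurd hω' (not_lt.2 ((hgood _ _ h3 (haS n ω)).1.trans ?_))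
      calc 32 * lamStar n * (B * (VARBootstrap.sparsity (A n (i n)) : ℝ)) / c
          ≤ 32 * (d₂ * (Real.log (p n) / √(n : ℝ))) *
            (B * (VARBootstrap.sparsity (A n (i n)) : ℝ)) / c := by gcongr; exact h2.2
        _ = _ := by ring
    · refine VARBootstrap.isBigOp_of_measure_le hβ (M := 32 * d₂ ^ 2 * B / c) (by positivity) ?_
      filter_upwards [hbad, hd, hmin, eventually_gt_atTop 0] with n h1 h2 h3 hn
      refine le_trans (measure_mono fun ω hω => ?_) h1
      intro hgood
      have hn' : (0 : ℝ) < n := by exact_mod_cast hn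
      have hω' : 32 * d₂ ^ 2 * B / c * ((VARBootstrap.sparsity (A n (i n)) : ℝ) *
          Real.log (p n) ^ 2 / (n : ℝ)) < |VARBootstrap.sqNorm2
            ((VARBootstrap.design (y n) n ω).mulVec (aStar n ω - aLasso n ω)) / (n : ℝ)| := hω
      rw [abs_of_nonneg (div_nonneg (VARBootstrap.sqNorm2_nonneg _) hn'.le)] at hω'
      refine absurd hω' (not_lt.2 ((hgood _ _ h3 (haS n ω)).2.1.trans ?_))
      have h4 : 0 ≤ lamStar n := le_trans (by positivity) h3
      calc 32 * lamStar n ^ 2 * (B * (VARBootstrap.sparsity (A n (i n)) : ℝ)) / c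
          ≤ 32 * (d₂ * (Real.log (p n) / √(n : ℝ))) ^ 2 *
            (B * (VARBootstrap.sparsity (A n (i n)) : ℝ)) / c := by gcongr; exact h2.2
        _ = _ := by
          rw [mul_pow, div_pow, Real.sq_sqrt hn'.le]; ring
  · intro hKS
    refine VARBootstrap.isBigOp_of_measure_le hβ (M := B ^ 2) (by positivity) ?_
    filter_upwards [hbad, hKS] with n h1 h2
    have h3 : 4 * K₂ * √(Real.log (p n) / n) ≤ lamStar n :=
      le_trans (mul_le_mul_of_nonneg_right (by
        have := VARBootstrap.scoreConst_pos c C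
        unfold VARBootstrap.lassoConst; linarith) (Real.sqrt_nonneg _)) h2
    refine le_trans (measure_mono fun ω hω => ?_) h1
    intro hgood
    have hω' : B ^ 2 * (VARBootstrap.sparsity (A n (i n)) : ℝ) <
        |(VARBootstrap.sparsity (aStar n ω) : ℝ)| := hω
    rw [abs_of_nonneg (Nat.cast_nonneg _)] at hω'
    exact absurd hω' (not_lt.2 (hgood _ _ h3 (haS n ω)).2.2)
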